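/- Let $V\subset\mathbb Z^D$ be a finite set of $m=|V|$ bosonic modes with Fock space $\mathcal H_V$ (orthonormal basis $|n\rangle$, $n\in\mathbb N_0^V$), annihilation and creation operators $a_j,a_j^*$, and let $i\sim j$ mean that $i=j$ or that $i,j\in V$ are nearest neighbours in $\mathbb Z^D$. Let $\mathcal T_1$ be the Banach space of trace-class operators on $\mathcal H_V$ and $\mathcal T_f=\operatorname{span}\{|n\rangle\langle n'|\}$. For $\ell\ge 2$, $\alpha\in\mathbb C^V$ and a 2-body Hamiltonian $$H=\sum_{i\sim j}H_{ij},\qquad H_{ij}=\sum_{u\in\mathbb N_0^4,\ \|u\|_1\le d}\Bigl(\lambda^{(u)}_{ij}\,a_i^{u_1}a_j^{u_3}(a_i^*)^{u_2}(a_j^*)^{u_4}+\overline{\lambda^{(u)}_{ij}}\,a_j^{u_4}a_i^{u_2}(a_j^*)^{u_3}(a_i^*)^{u_1}\Bigr)$$ of degree $d\le 2(\ell-2)$, put, on the domain $\mathcal T_f$, $$\mathcal L_\ell^{(H)}(\rho)=-i[H,\rho]+\sum_{j\in V}\Bigl(L_j\rho L_j^*-\tfrac12\{L_j^*L_j,\rho\}\Bigr),\qquad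 L_j=a_j^\ell-\alpha_j^\ell .$$ Let $B\subset V$, let $H_B=\sum_{i\sim j;\ i,j\in B}(H_B)_{ij}$ be a 2-body Hamiltonian of the same form supported on $B$, of degree $d_H\le 2(\ell-2)$, and assume $\ell-1>2d_H|B|$. For $\varepsilon\ge0$ put $\mathcal L=\mathcal L_\ell^{(H)}-i\varepsilon[H_B,\cdot]$ on $\mathcal T_f$. Then the closures of $\mathcal L_\ell^{(H)}$ and of $\mathcal L$ generate quantum Markov semigroups (strongly continuous semigroups of completely positive trace-preserving maps on $\mathcal T_1$), and for every region $A\subset V$, every bounded observable $O_A$ acting on the modes in $A$, every state $\rho$ and every $t\ge 0$, $$\Bigl|\operatorname{tr}\bigl[O_A e^{t\mathcal L_\ell^{(H)}}(\rho)\bigr]-\operatorname{tr}\bigl[O_A e^{t\mathcal L}(\rho)\bigr]\Bigr|\le\varepsilon\,\|O_A\|_\infty\Bigl(c_1\,t^{1-\frac{d_H}{\ell-1}}\Bigl(\frac{d_H}{(\ell-1)\mu}\Bigr)^{\frac{d_H}{\ell-1}}+c_1\,t\,\Bigl(\frac c\mu\Bigr)^{\frac{d_H}{d_H+\ell-1}}\Bigr)$$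 (with $0^0=1$), where $c_1,\mu,c>0$ depend only on $D,\ell,d,d_H,|B|$ and on upper bounds for $|\alpha_j|$ and for the moduli of the coefficients of $H$ and of $H_B$. In particular the constants do not depend on the number of modes $m$, nor on $V$, $\varepsilon$, $t$, $\rho$, $A$ and $O_A$. -/

import Mathlib

open scoped ENNReal InnerProductSpace ComplexOrder Topology

/-! ### Trace-class operators -/

section TraceClassOperators

/-- The trace norm `‖A‖₁ = tr |A|` in its variational form: the supremum of
`∑ i, |⟨e i, A (f i)⟩|` over all pairs of finite orthonormal families `e`, `f`. -/
noncomputable def traceNorm {H : Type*} [NormedAddCommGroup H] [InnerProductSpace ℂ H]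
    (A : H →L[ℂ] H) : ℝ≥0∞ :=
  ⨆ p : {q : (n : ℕ) × ((Fin n → H) × (Fin n → H)) //
      Orthonormal ℂ q.2.1 ∧ Orthonormal ℂ q.2.2},
    ∑ i, ‖⟪p.1.2.1 i, A (p.1.2.2 i)⟫_ℂ‖ₑ

theorem le_traceNorm {H : Type*} [NormedAddCommGroup H] [InnerProductSpace ℂ H]
    (A : H →L[ℂ] H) {n : ℕ} {e f : Fin n → H} (he : Orthonormal ℂ e) (hf : Orthonormal ℂ f) :
    ∑ i, ‖⟪e i, A (f i)⟫_ℂ‖ₑ ≤ traceNorm A :=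
  le_iSup (fun p : {q : (n : ℕ) × ((Fin n → H) × (Fin n → H)) //
      Orthonormal ℂ q.2.1 ∧ Orthonormal ℂ q.2.2} =>
    ∑ i, ‖⟪p.1.2.1 i, A (p.1.2.2 i)⟫_ℂ‖ₑ) ⟨⟨n, (e, f)⟩, he, hf⟩

theorem traceNorm_zero {H : Type*} [NormedAddCommGroup H] [InnerProductSpace ℂ H] :
    traceNorm (0 : H →L[ℂ] H) = 0 := by
  simp [traceNorm]

theorem traceNorm_add_le {H : Type*} [NormedAddCommGroup H] [InnerProductSpace ℂ H]
    (A B : H →L[ℂ] H) : traceNorm (A + B) ≤ traceNorm A + traceNorm B := by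
  refine iSup_le fun p => ?_
  refine le_trans ?_ (add_le_add (le_traceNorm A p.2.1 p.2.2) (le_traceNorm B p.2.1 p.2.2))
  rw [← Finset.sum_add_distrib]
  refine Finset.sum_le_sum fun i _ => ?_
  rw [add_apply, inner_add_right]
  exact enorm_add_le _ _

theorem traceNorm_smul {H : Type*} [NormedAddCommGroup H] [InnerProductSpace ℂ H]
    (c : ℂ) (A : H →L[ℂ] H) : traceNorm (c • A) = ‖c‖ₑ * traceNorm A := by
  unfold traceNorm
  rw [ENNReal.mul_iSup]
  refine iSup_congr fun p => ?_
  rw [Finset.mul_sum]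
  refine Finset.sum_congr rfl fun i _ => ?_
  rw [smul_apply, inner_smul_right, enorm_mul]

theorem eq_zero_of_traceNorm_eq_zero {H : Type*} [NormedAddCommGroup H] [InnerProductSpace ℂ H]
    (A : H →L[ℂ] H) (h : traceNorm A = 0) : A = 0 := by
  have key : ∀ x y : H, ‖x‖ = 1 → ‖y‖ = 1 → ⟪x, A y⟫_ℂ = 0 := by
    intro x y hx hy
    have he : Orthonormal ℂ (fun _ : Fin 1 => x) :=
      ⟨fun _ => hx, fun i j hij => absurd (Subsingleton.elim i j) hij⟩
    have hf : Orthonormal ℂ (fun _ : Fin 1 => y) :=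
      ⟨fun _ => hy, fun i j hij => absurd (Subsingleton.elim i j) hij⟩
    have := le_traceNorm A he hf
    rw [h] at this
    simpa using this
  ext y
  by_contra hne
  have hA : A y ≠ 0 := by simpa using hne
  have hy : y ≠ 0 := by
    rintro rfl
    simp at hA
  have h1 := key (((‖A y‖⁻¹ : ℝ) : ℂ) • A y) (((‖y‖⁻¹ : ℝ) : ℂ) • y)
    (by rw [norm_smul]; simp [norm_ne_zero_iff.2 hA]) (by rw [norm_smul]; simp [norm_ne_zero_iff.2 hy])
  rw [map_smul, inner_smul_left, inner_smul_right] at h1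
  simp [hA, hy] at h1

/-- The trace-class operators, as a subspace of the bounded operators. -/
noncomputable def traceClassSubmodule (H : Type*) [NormedAddCommGroup H] [InnerProductSpace ℂ H] :
    Submodule ℂ (H →L[ℂ] H) where
  carrier := {A | traceNorm A ≠ ∞}
  add_mem' {A B} hA hB :=
    ne_top_of_le_ne_top (ENNReal.add_ne_top.2 ⟨hA, hB⟩) (traceNorm_add_le A B)
  zero_mem' := by simp [traceNorm_zero]
  smul_mem' c A hA := by
    simp only [Set.mem_ofPred_eq, traceNorm_smul]
    exact ENNReal.mul_ne_top (by simp) hA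

/-- The space `𝒯₁(H)` of trace-class operators. It is a type of its own, so that it carries the
trace norm and not the operator norm. -/
def TraceClass (H : Type*) [NormedAddCommGroup H] [InnerProductSpace ℂ H] : Type _ :=
  ↥(traceClassSubmodule H)

noncomputable instance instAddCommGroupTraceClass (H : Type*) [NormedAddCommGroup H]
    [InnerProductSpace ℂ H] : AddCommGroup (TraceClass H) :=
  inferInstanceAs (AddCommGroup ↥(traceClassSubmodule H))

noncomputable instance instModuleTraceClass (H : Type*) [NormedAddCommGroup H]
    [InnerProductSpace ℂ H] : Module ℂ (TraceClass H) :=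
  inferInstanceAs (Module ℂ ↥(traceClassSubmodule H))

/-- The bounded operator underlying a trace-class operator. -/
noncomputable def TraceClass.toOp {H : Type*} [NormedAddCommGroup H] [InnerProductSpace ℂ H] :
    TraceClass H →ₗ[ℂ] (H →L[ℂ] H) :=
  (traceClassSubmodule H).subtype

theorem TraceClass.toOp_ne_top {H : Type*} [NormedAddCommGroup H] [InnerProductSpace ℂ H]
    (A : TraceClass H) : traceNorm (TraceClass.toOp A) ≠ ∞ :=
  Subtype.property (p := fun B => B ∈ traceClassSubmodule H) A

theorem TraceClass.toOp_injective {H : Type*} [NormedAddCommGroup H] [InnerProductSpace ℂ H] :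
    Function.Injective (TraceClass.toOp (H := H)) :=
  (traceClassSubmodule H).injective_subtype

/-- `𝒯₁(H)` is normed by the trace norm. -/
noncomputable instance instNormTraceClass (H : Type*) [NormedAddCommGroup H]
    [InnerProductSpace ℂ H] : Norm (TraceClass H) :=
  ⟨fun A => (traceNorm (TraceClass.toOp A)).toReal⟩

theorem TraceClass.normedSpaceCore (H : Type*) [NormedAddCommGroup H] [InnerProductSpace ℂ H] :
    NormedSpace.Core ℂ (TraceClass H) where
  norm_nonneg _ := ENNReal.toReal_nonneg
  norm_smul c A := by
    change (traceNorm (TraceClass.toOp (c • A))).toReal = _ * (traceNorm (TraceClass.toOp A)).toReal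
    rw [map_smul, traceNorm_smul, ENNReal.toReal_mul]
    simp
  norm_triangle A B := by
    change (traceNorm (TraceClass.toOp (A + B))).toReal ≤
      (traceNorm (TraceClass.toOp A)).toReal + (traceNorm (TraceClass.toOp B)).toReal
    rw [map_add, ← ENNReal.toReal_add A.toOp_ne_top B.toOp_ne_top]
    exact ENNReal.toReal_mono (ENNReal.add_ne_top.2 ⟨A.toOp_ne_top, B.toOp_ne_top⟩)
      (traceNorm_add_le _ _)
  norm_eq_zero_iff A := by
    change (traceNorm (TraceClass.toOp A)).toReal = 0 ↔ _
    rw [ENNReal.toReal_eq_zero_iff]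
    constructor
    · rintro (h | h)
      · exact TraceClass.toOp_injective (by rw [eq_zero_of_traceNorm_eq_zero _ h, map_zero])
      · exact absurd h A.toOp_ne_top
    · rintro rfl
      left
      rw [map_zero, traceNorm_zero]

noncomputable instance instNormedAddCommGroupTraceClass (H : Type*) [NormedAddCommGroup H]
    [InnerProductSpace ℂ H] : NormedAddCommGroup (TraceClass H) :=
  NormedAddCommGroup.ofCore (TraceClass.normedSpaceCore H)

noncomputable instance instNormedSpaceTraceClass (H : Type*) [NormedAddCommGroup H]
    [InnerProductSpace ℂ H] : NormedSpace ℂ (TraceClass H) :=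
  NormedSpace.ofCore (TraceClass.normedSpaceCore H)

theorem traceNorm_rankOne_le {H : Type*} [NormedAddCommGroup H] [InnerProductSpace ℂ H]
    (x y : H) :
    traceNorm (InnerProductSpace.rankOne ℂ x y) ≤ ENNReal.ofReal (‖x‖ * ‖y‖) := by
  refine iSup_le ?_
  rintro ⟨⟨n, e, f⟩, he, hf⟩
  simp only at he hf ⊢
  have h1 : ∑ i, ‖⟪e i, (InnerProductSpace.rankOne ℂ x y) (f i)⟫_ℂ‖ₑ =
      ENNReal.ofReal (∑ i, ‖⟪e i, x⟫_ℂ‖ * ‖⟪f i, y⟫_ℂ‖) := by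
    rw [ENNReal.ofReal_sum_of_nonneg (fun i _ => by positivity)]
    refine Finset.sum_congr rfl fun i _ => ?_
    rw [InnerProductSpace.rankOne_apply, inner_smul_right, ← ofReal_norm, norm_mul,
      norm_inner_symm y (f i), mul_comm]
  rw [h1]
  refine ENNReal.ofReal_le_ofReal ?_
  refine abs_le_of_sq_le_sq' ?_ (by positivity) |>.2
  refine (Finset.sum_mul_sq_le_sq_mul_sq _ _ _).trans ?_
  rw [mul_pow]
  exact mul_le_mul (he.sum_inner_products_le x) (hf.sum_inner_products_le y)
    (Finset.sum_nonneg fun i _ => by positivity) (by positivity)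

/-- The rank-one operator `|x⟩⟨y|` as a trace-class operator. -/
noncomputable def ketBra {H : Type*} [NormedAddCommGroup H] [InnerProductSpace ℂ H] (x y : H) :
    TraceClass H :=
  (⟨InnerProductSpace.rankOne ℂ x y,
    ne_top_of_le_ne_top ENNReal.ofReal_ne_top (traceNorm_rankOne_le x y)⟩ :
      ↥(traceClassSubmodule H))

theorem toOp_ketBra {H : Type*} [NormedAddCommGroup H] [InnerProductSpace ℂ H] (x y : H) :
    (ketBra x y).toOp = InnerProductSpace.rankOne ℂ x y := rfl

theorem TraceClass.norm_def {H : Type*} [NormedAddCommGroup H] [InnerProductSpace ℂ H]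
    (A : TraceClass H) : ‖A‖ = (traceNorm A.toOp).toReal := rfl

end TraceClassOperators

/-! ### Fock space, creation and annihilation operators -/

section Fock

/-- The Fock space of the modes `V`: the Hilbert space with orthonormal basis
`|n⟩`, `n : V → ℕ` (that is, the `V`-fold tensor power of `ℓ²(ℕ)`). -/
abbrev FockSpace (V : Type*) : Type _ := lp (fun _ : V → ℕ => ℂ) 2

/-- The Fock basis vector `|n⟩`. -/
noncomputable def ket {V : Type*} [DecidableEq V] [Fintype V] (n : V → ℕ) : FockSpace V :=
  lp.single 2 n (1 : ℂ)

/-- Finite linear combinations of Fock basis vectors, given by their coefficients; polynomials in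
the creation and annihilation operators act on this space. -/
abbrev FiniteFock (V : Type*) : Type _ := (V → ℕ) →₀ ℂ

/-- The inclusion of the finite vectors into Fock space. -/
noncomputable def FiniteFock.incl {V : Type*} [DecidableEq V] [Fintype V] :
    FiniteFock V →ₗ[ℂ] FockSpace V :=
  Finsupp.linearCombination ℂ ket

/-- The annihilation operator `a_i |n⟩ = √(n_i) |n - 1_i⟩`. -/
noncomputable def annih {V : Type*} [DecidableEq V] (i : V) : Module.End ℂ (FiniteFock V) :=
  Finsupp.linearCombination ℂ fun n : V → ℕ =>
    ((Real.sqrt (n i) : ℝ) : ℂ) • Finsupp.single (Function.update n i (n i - 1)) (1 : ℂ)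

/-- The creation operator `a_i† |n⟩ = √(n_i + 1) |n + 1_i⟩`. -/
noncomputable def creat {V : Type*} [DecidableEq V] (i : V) : Module.End ℂ (FiniteFock V) :=
  Finsupp.linearCombination ℂ fun n : V → ℕ =>
    ((Real.sqrt (n i + 1) : ℝ) : ℂ) • Finsupp.single (Function.update n i (n i + 1)) (1 : ℂ)

/-- The trace of a trace-class operator, computed in the Fock basis. -/
noncomputable def fockTrace {V : Type*} [DecidableEq V] [Fintype V]
    (A : FockSpace V →L[ℂ] FockSpace V) : ℂ :=
  ∑' n : V → ℕ, ⟪ket n, A (ket n)⟫_ℂ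

/-- `ρ` is a state (density operator). -/
def IsState {V : Type*} [DecidableEq V] [Fintype V] (ρ : TraceClass (FockSpace V)) : Prop :=
  ρ.toOp.IsPositive ∧ fockTrace ρ.toOp = 1

/-- The bounded operator `O` is of the form `O_A ⊗ 1`, i.e. it acts on the modes in `A` only:
its matrix elements vanish unless the occupation numbers off `A` agree, and then depend only on the
occupation numbers in `A`. -/
def ActsOn {V : Type*} [DecidableEq V] [Fintype V] (A : Finset V)
    (O : FockSpace V →L[ℂ] FockSpace V) : Prop :=
  (∀ n m : V → ℕ, (∃ i, i ∉ A ∧ n i ≠ m i) → ⟪ket n, O (ket m)⟫_ℂ = 0) ∧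
  ∀ n m n' m' : V → ℕ, (∀ i ∉ A, n i = m i) → (∀ i ∉ A, n' i = m' i) →
    (∀ i ∈ A, n i = n' i) → (∀ i ∈ A, m i = m' i) →
    ⟪ket n, O (ket m)⟫_ℂ = ⟪ket n', O (ket m')⟫_ℂ

end Fock

/-! ### Quantum Markov semigroups and their generators -/

section Semigroups

/-- Complete positivity: all amplifications `id_k ⊗ T` preserve positivity of operators on
`ℂᵏ ⊗ H`, written as `k × k` block matrices of operators on `H`. -/
def IsCompletelyPositive {H : Type*} [NormedAddCommGroup H] [InnerProductSpace ℂ H]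
    (T : TraceClass H →L[ℂ] TraceClass H) : Prop :=
  ∀ (k : ℕ) (ρ : Fin k → Fin k → TraceClass H),
    (∀ x : Fin k → H, 0 ≤ ∑ i, ∑ j, ⟪x i, (ρ i j).toOp (x j)⟫_ℂ) →
    ∀ x : Fin k → H, 0 ≤ ∑ i, ∑ j, ⟪x i, (T (ρ i j)).toOp (x j)⟫_ℂ

/-- `(T t)`, `t ≥ 0`, is a quantum Markov semigroup: a strongly continuous semigroup of completely
positive, trace-preserving maps on the trace-class operators (values at `t < 0` play no role). -/
structure IsQMS {V : Type*} [DecidableEq V] [Fintype V]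
    (T : ℝ → TraceClass (FockSpace V) →L[ℂ] TraceClass (FockSpace V)) : Prop where
  map_zero : T 0 = ContinuousLinearMap.id ℂ (TraceClass (FockSpace V))
  map_add : ∀ s t : ℝ, 0 ≤ s → 0 ≤ t → T (s + t) = (T s).comp (T t)
  continuous_zero : ∀ ρ, Filter.Tendsto (fun t => T t ρ) (𝓝[>] 0) (𝓝 ρ)
  completelyPositive : ∀ t : ℝ, 0 ≤ t → IsCompletelyPositive (T t)
  tracePreserving : ∀ t : ℝ, 0 ≤ t → ∀ ρ, fockTrace (T t ρ).toOp = fockTrace ρ.toOp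

/-- The graph of the generator of a semigroup. -/
def generatorGraph {E : Type*} [NormedAddCommGroup E] [NormedSpace ℂ E] (T : ℝ → E →L[ℂ] E) :
    Set (E × E) :=
  {p | Filter.Tendsto (fun t : ℝ => ((t⁻¹ : ℝ) : ℂ) • (T t p.1 - p.1)) (𝓝[>] 0) (𝓝 p.2)}

/-- The closure of the densely defined operator with graph `G` is the generator of `T`
(in particular `G` is closable). -/
def ClosureGenerates {E : Type*} [NormedAddCommGroup E] [NormedSpace ℂ E]
    (G : Submodule ℂ (E × E)) (T : ℝ → E →L[ℂ] E) : Prop :=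
  closure (G : Set (E × E)) = generatorGraph T

end Semigroups

/-! ### Lindblad operators on the lattice -/

section Lattice

/-- The value of `-i[h, ·] + ∑ j, (L_j · L_j† - ½ {L_j† L_j, ·})` at `|x⟩⟨y|`, where `x`, `y` are
finite vectors and `h` is a symmetric polynomial in creation and annihilation operators. -/
noncomputable def lindbladKetBra {V : Type*} [DecidableEq V] [Fintype V]
    (h : Module.End ℂ (FiniteFock V)) (L Ldag : V → Module.End ℂ (FiniteFock V))
    (x y : FiniteFock V) : TraceClass (FockSpace V) :=
  (-Complex.I) • (ketBra (h x).incl y.incl - ketBra x.incl (h y).incl) +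
    ∑ j, (ketBra (L j x).incl (L j y).incl -
      (1 / 2 : ℂ) • (ketBra ((Ldag j * L j) x).incl y.incl +
        ketBra x.incl ((Ldag j * L j) y).incl))

/-- The graph of `-i[h, ·] + ∑ j, (L_j · L_j† - ½ {L_j† L_j, ·})` on its domain `𝒯_f`, the span of
the operators `|x⟩⟨y|` with finite vectors `x`, `y` (equivalently of the `|n⟩⟨m|`). -/
noncomputable def lindbladGraph {V : Type*} [DecidableEq V] [Fintype V]
    (h : Module.End ℂ (FiniteFock V)) (L Ldag : V → Module.End ℂ (FiniteFock V)) :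
    Submodule ℂ (TraceClass (FockSpace V) × TraceClass (FockSpace V)) :=
  Submodule.span ℂ (Set.range fun p : FiniteFock V × FiniteFock V =>
    (ketBra p.1.incl p.2.incl, lindbladKetBra h L Ldag p.1 p.2))

/-- The jump operator `a_j^ℓ - α_j^ℓ`. -/
noncomputable def photonJump {V : Type*} [DecidableEq V] (ℓ : ℕ) (α : V → ℂ) (j : V) :
    Module.End ℂ (FiniteFock V) :=
  annih j ^ ℓ - α j ^ ℓ • 1

/-- The adjoint `(a_j†)^ℓ - conj (α_j)^ℓ` of the jump operator. -/
noncomputable def photonJumpDag {V : Type*} [DecidableEq V] (ℓ : ℕ) (α : V → ℂ) (j : V) :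
    Module.End ℂ (FiniteFock V) :=
  creat j ^ ℓ - (starRingEnd ℂ (α j)) ^ ℓ • 1

/-- The multi-mode generator `-i[h, ·] + ∑ j, 𝓛[a_j^ℓ - α_j^ℓ]` on `𝒯_f`. -/
noncomputable def photonDissipation {V : Type*} [DecidableEq V] [Fintype V] (ℓ : ℕ) (α : V → ℂ)
    (h : Module.End ℂ (FiniteFock V)) :
    Submodule ℂ (TraceClass (FockSpace V) × TraceClass (FockSpace V)) :=
  lindbladGraph h (photonJump ℓ α) (photonJumpDag ℓ α)

/-- The relation `i ∼ j` on sites of the lattice `ℤ^D`: nearest neighbours, or `i = j`. -/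
def LatticeEdge {D : ℕ} (i j : Fin D → ℤ) : Prop :=
  i = j ∨ ∑ s, |i s - j s| = 1

/-- The multi-indices `u ∈ ℕ₀⁴` with `‖u‖₁ ≤ d`. -/
def degreeLE (d : ℕ) : Finset (Fin 4 → ℕ) :=
  (Fintype.piFinset fun _ => Finset.range (d + 1)).filter fun u => ∑ s, u s ≤ d

/-- The interaction `H_ij` of degree at most `d` with coefficients `c`. -/
noncomputable def pairHamiltonian {V : Type*} [DecidableEq V] (d : ℕ) (c : (Fin 4 → ℕ) → ℂ)
    (i j : V) : Module.End ℂ (FiniteFock V) :=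
  ∑ u ∈ degreeLE d,
    (c u • (annih i ^ u 0 * annih j ^ u 2 * creat i ^ u 1 * creat j ^ u 3) +
      starRingEnd ℂ (c u) • (annih j ^ u 3 * annih i ^ u 1 * creat j ^ u 2 * creat i ^ u 0))

open Classical in
/-- The 2-body Hamiltonian `∑_{i ∼ j} H_ij` with all sites `i`, `j` in `B`. -/
noncomputable def latticeHamiltonian {D : ℕ} {V : Finset (Fin D → ℤ)} (B : Finset V) (d : ℕ)
    (c : V → V → (Fin 4 → ℕ) → ℂ) : Module.End ℂ (FiniteFock V) :=
  ∑ i ∈ B, ∑ j ∈ B.filter (fun j => LatticeEdge i.1 j.1), pairHamiltonian d (c i j) i j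

end Lattice

/-! ### The Banach space of trace-class operators -/

section TraceClassTheory

variable {H : Type*} [NormedAddCommGroup H] [InnerProductSpace ℂ H]

/-! Loss of ℓ photons at a time is so strong at high occupation that it dominates every Hamiltonian
of degree at most 2(ℓ - 2). It even creates moments: after any positive time the local moments of
order ℓ - 1 are bounded independently of the initial state and of the number of modes. A
perturbation on B of degree d_H < ℓ - 1 then has an effect whose singularity at time 0 is
integrable.

Generation. Drift and jumps are compressed to the box of occupation numbers at most N, which gives a
bounded Lindblad generator. Its exponential is completely positive as a Chernoff limit, and trace
preserving because photon loss never leaves the box; together these bound it by 8 in trace norm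
(`norm_le_of_positive_of_tracePreserving`). The moment ∑ (n_j + 1)^(2ℓ) grows at most exponentially,
uniformly in N, and C/(N + 1) times this moment dominates the squared norm of the part of the drift
that leaves the box (`HasMomentBound`). Duhamel's formula then makes the truncated evolutions Cauchy
on finite-rank operators. The same bound shows that truncated orbits almost solve the untruncated
equation, so 𝒯_f is a core for the limit (`exists_isQMS_of_hasMomentBound`).

Moments. All operators are sums of weighted shifts of the occupation basis. The commutator of (n +
1)^k with a shift of degree at most 2(ℓ - 1) has order k - 1 + (ℓ - 1), one less than the loss term
-(n + 1)^(k + ℓ - 1), which therefore absorbs it (`momentRate_photonDrift_le`). To control one site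
b without paying for all modes, site j gets the weight 2^(-|j - b|₁): the weights sum to at most
3^D, and neighbouring ones differ by a factor of at most 2, so interactions are absorbed with
constants free of the number of modes. For k = ℓ - 1 the loss term is quadratic in the k-th powers,
and the resulting Riccati inequality bounds the moment at time t by a multiple of κ + 1/(at),
whatever its initial value (`boxExpectation_powerWeight_le`).

Perturbation. In Duhamel's formula between the truncated evolutions with and without εH_B, the
integrand is controlled by ε and the square root of the expectation of ∑_{b ∈ B} (n_b + 1)^{d_H}.
Interpolating between the trace and the moment of order ℓ - 1 bounds this expectation by a multiple
of (κ + 1/(as))^ξ with ξ = d_H/(ℓ - 1) < 1. Since s^(-ξ) is integrable, the outcome is a multiple of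
t + t^(1-ξ)/(1-ξ) (`norm_expSG_truncLindblad_sub_le`). The estimate passes to N → ∞ and from pure
finite states to all positive operators (`norm_apply_le_of_isPositive`). -/

theorem TraceClass.toOp_smul (c : ℂ) (X : TraceClass H) : (c • X).toOp = c • X.toOp :=
  _root_.map_smul TraceClass.toOp c X

theorem TraceClass.sum_norm_inner_le (X : TraceClass H) {ι : Type*} (s : Finset ι) {e f : ι → H}
    (he : Orthonormal ℂ e) (hf : Orthonormal ℂ f) :
    ∑ i ∈ s, ‖⟪e i, X.toOp (f i)⟫_ℂ‖ ≤ ‖X‖ := by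
  have hinj : Function.Injective fun k : Fin s.card => ((s.equivFin.symm k : s) : ι) :=
    Subtype.val_injective.comp s.equivFin.symm.injective
  have h := le_traceNorm X.toOp (he.comp _ hinj) (hf.comp _ hinj)
  have h2 : ∑ k : Fin s.card, ‖⟪e (s.equivFin.symm k : s), X.toOp (f (s.equivFin.symm k : s))⟫_ℂ‖ₑ
      = ENNReal.ofReal (∑ i ∈ s, ‖⟪e i, X.toOp (f i)⟫_ℂ‖) := by
    rw [Equiv.sum_comp s.equivFin.symm (fun k : s => ‖⟪e k, X.toOp (f k)⟫_ℂ‖ₑ),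
      Finset.sum_coe_sort s (fun k => ‖⟪e k, X.toOp (f k)⟫_ℂ‖ₑ),
      ENNReal.ofReal_sum_of_nonneg (fun i _ => norm_nonneg _)]
    simp
  simp only [Function.comp_apply] at h
  rw [h2] at h
  exact (ENNReal.ofReal_le_iff_le_toReal X.toOp_ne_top).1 h

theorem traceNorm_le_ofReal {A : H →L[ℂ] H} {C : ℝ}
    (h : ∀ (n : ℕ) (e f : Fin n → H), Orthonormal ℂ e → Orthonormal ℂ f →
      ∑ i, ‖⟪e i, A (f i)⟫_ℂ‖ ≤ C) : traceNorm A ≤ ENNReal.ofReal C := by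
  refine iSup_le ?_
  rintro ⟨⟨n, e, f⟩, he, hf⟩
  refine le_trans (le_of_eq ?_) (ENNReal.ofReal_le_ofReal (h n e f he hf))
  rw [ENNReal.ofReal_sum_of_nonneg (fun i _ => norm_nonneg _)]
  simp

/-- The standard way to build a trace-class operator here: bounding the finite sums settles
membership and the norm at once. -/
theorem TraceClass.exists_of_bound {A : H →L[ℂ] H} {C : ℝ}
    (h : ∀ (n : ℕ) (e f : Fin n → H), Orthonormal ℂ e → Orthonormal ℂ f →
      ∑ i, ‖⟪e i, A (f i)⟫_ℂ‖ ≤ C) : ∃ X : TraceClass H, X.toOp = A ∧ ‖X‖ ≤ C := by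
  -- The empty families have sum zero.
  have hC : 0 ≤ C := by
    simpa using h 0 (fun i => i.elim0) (fun i => i.elim0) ⟨fun i => i.elim0, fun i => i.elim0⟩
      ⟨fun i => i.elim0, fun i => i.elim0⟩
  have hA := traceNorm_le_ofReal h
  refine ⟨(⟨A, ne_top_of_le_ne_top ENNReal.ofReal_ne_top hA⟩ : ↥(traceClassSubmodule H)), rfl, ?_⟩
  exact ENNReal.toReal_le_of_le_ofReal hC hA

theorem TraceClass.norm_le_of_bound {X : TraceClass H} {C : ℝ}
    (h : ∀ (n : ℕ) (e f : Fin n → H), Orthonormal ℂ e → Orthonormal ℂ f →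
      ∑ i, ‖⟪e i, X.toOp (f i)⟫_ℂ‖ ≤ C) : ‖X‖ ≤ C := by
  obtain ⟨Y, hY, hn⟩ := TraceClass.exists_of_bound h
  rwa [← TraceClass.toOp_injective hY]

theorem TraceClass.norm_inner_le (X : TraceClass H) (x y : H) :
    ‖⟪x, X.toOp y⟫_ℂ‖ ≤ ‖X‖ * ‖x‖ * ‖y‖ := by
  rcases eq_or_ne x 0 with rfl | hx
  · simp
  rcases eq_or_ne y 0 with rfl | hy
  · simp
  have he : Orthonormal ℂ (fun _ : Unit => ((‖x‖⁻¹ : ℝ) : ℂ) • x) :=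
    ⟨fun _ => by rw [norm_smul]; simp [norm_ne_zero_iff.2 hx],
      fun i j hij => absurd (Subsingleton.elim i j) hij⟩
  have hf : Orthonormal ℂ (fun _ : Unit => ((‖y‖⁻¹ : ℝ) : ℂ) • y) :=
    ⟨fun _ => by rw [norm_smul]; simp [norm_ne_zero_iff.2 hy],
      fun i j hij => absurd (Subsingleton.elim i j) hij⟩
  have h := X.sum_norm_inner_le Finset.univ he hf
  simp only [Finset.univ_unique, Finset.sum_singleton] at h
  rw [_root_.map_smul, inner_smul_left, inner_smul_right, norm_mul, norm_mul] at h
  simp only [map_inv₀, Complex.ofReal_inv, Complex.conj_ofReal, norm_inv, Complex.norm_real,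
    norm_norm] at h
  have hx' := norm_pos_iff.2 hx
  have hy' := norm_pos_iff.2 hy
  rw [← mul_assoc, ← mul_inv, inv_mul_le_iff₀ (by positivity)] at h
  linarith

theorem TraceClass.opNorm_le (X : TraceClass H) : ‖X.toOp‖ ≤ ‖X‖ := by
  refine ContinuousLinearMap.opNorm_le_bound _ (norm_nonneg _) fun y => ?_
  have h := X.norm_inner_le (X.toOp y) y
  rw [inner_self_eq_norm_sq_to_K] at h
  norm_cast at h
  rw [abs_of_nonneg (by positivity)] at h
  rcases (norm_nonneg (X.toOp y)).eq_or_lt with h0 | h0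
  · rw [← h0]; positivity
  · refine le_of_mul_le_mul_right ?_ h0
    nlinarith

theorem norm_ketBra_le (x y : H) : ‖ketBra x y‖ ≤ ‖x‖ * ‖y‖ :=
  ENNReal.toReal_le_of_le_ofReal (by positivity) (traceNorm_rankOne_le x y)

/-- The operator-norm limit is the candidate. The trace norm is lower semicontinuous: each finite
sum of matrix elements passes to the limit, so the Cauchy bound survives. -/
instance TraceClass.instCompleteSpace [CompleteSpace H] : CompleteSpace (TraceClass H) := by
  refine Metric.complete_of_cauchySeq_tendsto fun u hu => ?_
  have hop : CauchySeq fun n => (u n).toOp := by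
    rw [Metric.cauchySeq_iff] at hu ⊢
    intro ε hε
    obtain ⟨N, hN⟩ := hu ε hε
    refine ⟨N, fun m hm n hn => lt_of_le_of_lt ?_ (hN m hm n hn)⟩
    rw [dist_eq_norm, dist_eq_norm, ← map_sub]
    exact TraceClass.opNorm_le _
  obtain ⟨A, hA⟩ := cauchySeq_tendsto_of_complete hop
  have key : ∀ ε > 0, ∃ N, ∀ n ≥ N, ∃ X : TraceClass H, X.toOp = (u n).toOp - A ∧ ‖X‖ ≤ ε := by
    intro ε hε
    obtain ⟨N, hN⟩ := Metric.cauchySeq_iff.1 hu ε hε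
    refine ⟨N, fun n hn => TraceClass.exists_of_bound fun k e f he hf => ?_⟩
    have hlim : Filter.Tendsto (fun m => ∑ i, ‖⟪e i, ((u n).toOp - (u m).toOp) (f i)⟫_ℂ‖)
        Filter.atTop (𝓝 (∑ i, ‖⟪e i, ((u n).toOp - A) (f i)⟫_ℂ‖)) := by
      refine tendsto_finsetSum _ fun i _ => Filter.Tendsto.norm ?_
      refine Filter.Tendsto.inner tendsto_const_nhds ?_
      exact (((ContinuousLinearMap.apply ℂ H (f i)).continuous.tendsto _).comp
        (tendsto_const_nhds.sub hA))
    refine le_of_tendsto hlim ?_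
    filter_upwards [Filter.eventually_ge_atTop N] with m hm
    have h1 := (u n - u m).sum_norm_inner_le Finset.univ he hf
    rw [map_sub] at h1
    refine h1.trans ?_
    rw [← dist_eq_norm]
    exact (hN n hn m hm).le
  obtain ⟨N, hN⟩ := key 1 one_pos
  obtain ⟨X, hX, -⟩ := hN N le_rfl
  -- The operator limit `A` is trace class because it differs from `u N` by the trace-class operator
  -- `X`.
  refine ⟨u N - X, ?_⟩
  rw [Metric.tendsto_atTop]
  intro ε hε
  obtain ⟨N', hN'⟩ := key (ε / 2) (by positivity)
  refine ⟨N', fun n hn => ?_⟩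
  obtain ⟨Y, hY, hYn⟩ := hN' n hn
  have : u n - (u N - X) = Y := by
    apply TraceClass.toOp_injective
    rw [map_sub, map_sub, hX, hY]
    abel
  rw [dist_eq_norm, this]
  linarith

/-- A linear map of bounded operators that is bounded for the trace norm. -/
noncomputable def TraceClass.lift (F : (H →L[ℂ] H) →ₗ[ℂ] (H →L[ℂ] H)) (C : ℝ)
    (h : ∀ X : TraceClass H, ∃ Y : TraceClass H, Y.toOp = F X.toOp ∧ ‖Y‖ ≤ C * ‖X‖) :
    TraceClass H →L[ℂ] TraceClass H :=
  LinearMap.mkContinuous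
    { toFun := fun X => (h X).choose
      map_add' := fun X Y => TraceClass.toOp_injective <| by
        refine ((h (X + Y)).choose_spec.1.trans ?_).trans (map_add _ _ _).symm
        rw [(h X).choose_spec.1, (h Y).choose_spec.1, map_add, map_add]
      map_smul' := fun c X => TraceClass.toOp_injective <| by
        refine ((h (c • X)).choose_spec.1.trans ?_).trans (TraceClass.toOp_smul _ _).symm
        rw [(h X).choose_spec.1, TraceClass.toOp_smul, _root_.map_smul, RingHom.id_apply] }
    C fun X => (h X).choose_spec.2

theorem TraceClass.toOp_lift {F : (H →L[ℂ] H) →ₗ[ℂ] (H →L[ℂ] H)} {C : ℝ}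
    (h : ∀ X : TraceClass H, ∃ Y : TraceClass H, Y.toOp = F X.toOp ∧ ‖Y‖ ≤ C * ‖X‖)
    (X : TraceClass H) : (TraceClass.lift F C h X).toOp = F X.toOp :=
  (h X).choose_spec.1

variable [CompleteSpace H]

theorem orthonormal_unitary_apply {ι : Type*} {e : ι → H} (he : Orthonormal ℂ e)
    (U : unitary (H →L[ℂ] H)) : Orthonormal ℂ fun i => (U : H →L[ℂ] H) (e i) := by
  have hU : ∀ x y, ⟪(U : H →L[ℂ] H) x, (U : H →L[ℂ] H) y⟫_ℂ = ⟪x, y⟫_ℂ := by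
    intro x y
    rw [← ContinuousLinearMap.adjoint_inner_right, ← ContinuousLinearMap.star_eq_adjoint,
      ← mul_apply_eq_comp, Unitary.coe_star_mul_self, one_apply_eq_self]
  classical
  rw [orthonormal_iff_ite] at he ⊢
  intro i j
  rw [hU, he]

/-- A bounded operator is a combination of four unitaries with coefficients at most ‖A‖/2, and
unitaries preserve orthonormal families. The factor 2 is 4 · ½; it is not optimal, but only a
universal constant matters later. -/
theorem TraceClass.sum_norm_inner_mul_left_le (X : TraceClass H) (A : H →L[ℂ] H) {ι : Type*}
    (s : Finset ι) {e f : ι → H} (he : Orthonormal ℂ e) (hf : Orthonormal ℂ f) :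
    ∑ i ∈ s, ‖⟪e i, (A * X.toOp) (f i)⟫_ℂ‖ ≤ 2 * ‖A‖ * ‖X‖ := by
  obtain ⟨u, c, hA, hc⟩ := CStarAlgebra.exists_sum_four_unitary A
  have h1 : ∀ i ∈ s, ‖⟪e i, (A * X.toOp) (f i)⟫_ℂ‖ ≤
      ∑ k, ‖A‖ / 2 * ‖⟪(star (u k) : unitary (H →L[ℂ] H)).1 (e i), X.toOp (f i)⟫_ℂ‖ := by
    intro i _
    conv_lhs => rw [hA]
    rw [Finset.sum_mul, _root_.sum_apply, inner_sum]
    refine (norm_sum_le _ _).trans (Finset.sum_le_sum fun k _ => ?_)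
    rw [smul_mul_assoc, smul_apply, inner_smul_right, norm_mul, Unitary.coe_star,
      ContinuousLinearMap.star_eq_adjoint, ContinuousLinearMap.adjoint_inner_left]
    exact mul_le_mul_of_nonneg_right (hc k) (norm_nonneg _)
  refine (Finset.sum_le_sum h1).trans ?_
  rw [Finset.sum_comm]
  have h2 : ∀ k : Fin 4, ∑ i ∈ s, ‖A‖ / 2 *
      ‖⟪(star (u k) : unitary (H →L[ℂ] H)).1 (e i), X.toOp (f i)⟫_ℂ‖ ≤ ‖A‖ / 2 * ‖X‖ := by
    intro k
    rw [← Finset.mul_sum]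
    exact mul_le_mul_of_nonneg_left
      (X.sum_norm_inner_le s (orthonormal_unitary_apply he _) hf) (by positivity)
  refine (Finset.sum_le_sum fun k _ => h2 k).trans (le_of_eq ?_)
  simp
  ring

theorem TraceClass.sum_norm_inner_mul_right_le (X : TraceClass H) (A : H →L[ℂ] H) {ι : Type*}
    (s : Finset ι) {e f : ι → H} (he : Orthonormal ℂ e) (hf : Orthonormal ℂ f) :
    ∑ i ∈ s, ‖⟪e i, (X.toOp * A) (f i)⟫_ℂ‖ ≤ 2 * ‖A‖ * ‖X‖ := by
  obtain ⟨u, c, hA, hc⟩ := CStarAlgebra.exists_sum_four_unitary A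
  have h1 : ∀ i ∈ s, ‖⟪e i, (X.toOp * A) (f i)⟫_ℂ‖ ≤
      ∑ k, ‖A‖ / 2 * ‖⟪e i, X.toOp ((u k : H →L[ℂ] H) (f i))⟫_ℂ‖ := by
    intro i _
    conv_lhs => rw [hA]
    rw [Finset.mul_sum, _root_.sum_apply, inner_sum]
    refine (norm_sum_le _ _).trans (Finset.sum_le_sum fun k _ => ?_)
    rw [mul_smul_comm, smul_apply, inner_smul_right, norm_mul, mul_apply_eq_comp]
    exact mul_le_mul_of_nonneg_right (hc k) (norm_nonneg _)
  refine (Finset.sum_le_sum h1).trans ?_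
  rw [Finset.sum_comm]
  have h2 : ∀ k : Fin 4, ∑ i ∈ s, ‖A‖ / 2 *
      ‖⟪e i, X.toOp ((u k : H →L[ℂ] H) (f i))⟫_ℂ‖ ≤ ‖A‖ / 2 * ‖X‖ := by
    intro k
    rw [← Finset.mul_sum]
    exact mul_le_mul_of_nonneg_left
      (X.sum_norm_inner_le s he (orthonormal_unitary_apply hf _)) (by positivity)
  refine (Finset.sum_le_sum fun k _ => h2 k).trans (le_of_eq ?_)
  simp
  ring

/-- The map `X ↦ A X` on trace-class operators. -/
noncomputable def TraceClass.lmul (A : H →L[ℂ] H) : TraceClass H →L[ℂ] TraceClass H :=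
  TraceClass.lift (LinearMap.mulLeft ℂ A) (2 * ‖A‖) fun X =>
    TraceClass.exists_of_bound fun _ _ _ he hf =>
      X.sum_norm_inner_mul_left_le A Finset.univ he hf

/-- The map `X ↦ X A` on trace-class operators. -/
noncomputable def TraceClass.rmul (A : H →L[ℂ] H) : TraceClass H →L[ℂ] TraceClass H :=
  TraceClass.lift (LinearMap.mulRight ℂ A) (2 * ‖A‖) fun X =>
    TraceClass.exists_of_bound fun _ _ _ he hf =>
      X.sum_norm_inner_mul_right_le A Finset.univ he hf

theorem TraceClass.toOp_lmul (A : H →L[ℂ] H) (X : TraceClass H) :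
    (TraceClass.lmul A X).toOp = A * X.toOp :=
  TraceClass.toOp_lift _ X

theorem TraceClass.toOp_rmul (A : H →L[ℂ] H) (X : TraceClass H) :
    (TraceClass.rmul A X).toOp = X.toOp * A :=
  TraceClass.toOp_lift _ X

theorem TraceClass.lmul_ketBra (A : H →L[ℂ] H) (x y : H) :
    TraceClass.lmul A (ketBra x y) = ketBra (A x) y := by
  apply TraceClass.toOp_injective
  rw [TraceClass.toOp_lmul, toOp_ketBra, toOp_ketBra]
  ext z
  simp [InnerProductSpace.rankOne_apply]

theorem TraceClass.rmul_ketBra (A : H →L[ℂ] H) (x y : H) :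
    TraceClass.rmul A (ketBra x y) = ketBra x (A.adjoint y) := by
  apply TraceClass.toOp_injective
  rw [TraceClass.toOp_rmul, toOp_ketBra, toOp_ketBra]
  ext z
  simp [InnerProductSpace.rankOne_apply, ContinuousLinearMap.adjoint_inner_left]

theorem TraceClass.exists_adjoint (X : TraceClass H) :
    ∃ Y : TraceClass H, Y.toOp = X.toOp.adjoint ∧ ‖Y‖ ≤ ‖X‖ := by
  refine TraceClass.exists_of_bound fun n e f he hf => ?_
  refine le_trans (le_of_eq ?_) (X.sum_norm_inner_le Finset.univ hf he)
  refine Finset.sum_congr rfl fun i _ => ?_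
  rw [ContinuousLinearMap.adjoint_inner_right, norm_inner_symm]

/-- Approximating the positive spectral projection by the continuous function t⁺/(t⁺ + ε) writes a⁺
as a · s up to operator norm ε, with ‖s‖ ≤ 1. On families of length n the error is at most nε, and ε
→ 0 for fixed n. -/
theorem TraceClass.exists_posPart (X : TraceClass H) (hX : IsSelfAdjoint X.toOp) :
    ∃ Y : TraceClass H, Y.toOp = (X.toOp)⁺ ∧ ‖Y‖ ≤ 2 * ‖X‖ := by
  refine TraceClass.exists_of_bound fun n e f he hf => ?_
  set a := X.toOp with ha
  have hpos : a⁺ = cfc (fun t : ℝ => t⁺) a := by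
    rw [CFC.posPart_def, cfcₙ_eq_cfc (by fun_prop) (by simp)]
  have key : ∀ ε : ℝ, 0 < ε → ∑ i, ‖⟪e i, (a⁺) (f i)⟫_ℂ‖ ≤ 2 * ‖X‖ + n * ε := by
    intro ε hε
    have hne : ∀ t : ℝ, t⁺ + ε ≠ 0 := fun t => by
      have := posPart_nonneg t
      positivity
    have hcont : Continuous fun t : ℝ => t⁺ / (t⁺ + ε) := by
      have : Continuous fun t : ℝ => t⁺ := by fun_prop
      exact this.div (this.add continuous_const) hne
    set s := cfc (fun t : ℝ => t⁺ / (t⁺ + ε)) a with hs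
    have hs1 : ‖s‖ ≤ 1 := by
      refine norm_cfc_le zero_le_one fun t _ => ?_
      have := posPart_nonneg t
      rw [Real.norm_of_nonneg (by positivity), div_le_one (by positivity)]
      linarith
    have hdiff : ‖a⁺ - a * s‖ ≤ ε := by
      have h1 : a * s = cfc (fun t : ℝ => t * (t⁺ / (t⁺ + ε))) a := by
        rw [cfc_mul (fun t : ℝ => t) _ a (by fun_prop) hcont.continuousOn, cfc_id' ℝ a, hs]
      rw [h1, hpos, ← cfc_sub (fun t : ℝ => t⁺) (fun t : ℝ => t * (t⁺ / (t⁺ + ε))) a (by fun_prop)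
        (continuous_id'.mul hcont).continuousOn]
      refine norm_cfc_le hε.le fun t _ => ?_
      rcases le_total t 0 with ht | ht
      · rw [posPart_eq_zero.2 ht]; simpa using hε.le
      · rw [posPart_eq_self.2 ht]
        have : t - t * (t / (t + ε)) = ε * (t / (t + ε)) := by field_simp; ring
        rw [this, Real.norm_of_nonneg (by positivity)]
        refine mul_le_of_le_one_right hε.le ((div_le_one (by positivity)).2 (by linarith))
    have h2 : ∀ i, ‖⟪e i, (a⁺) (f i)⟫_ℂ‖ ≤ ‖⟪e i, (a * s) (f i)⟫_ℂ‖ + ε := by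
      intro i
      have h3 : (a⁺) (f i) = (a * s) (f i) + (a⁺ - a * s) (f i) := by simp
      rw [h3, inner_add_right]
      refine (norm_add_le _ _).trans (add_le_add le_rfl ?_)
      refine (norm_inner_le_norm _ _).trans ?_
      rw [he.1 i, one_mul]
      refine (ContinuousLinearMap.le_opNorm _ _).trans ?_
      rw [hf.1 i, mul_one]
      exact hdiff
    refine (Finset.sum_le_sum fun i _ => h2 i).trans ?_
    rw [Finset.sum_add_distrib]
    have h4 := X.sum_norm_inner_mul_right_le s Finset.univ he hf
    have h5 : 2 * ‖s‖ * ‖X‖ ≤ 2 * ‖X‖ := by nlinarith [norm_nonneg X]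
    simp only [Finset.sum_const, Finset.card_univ, Fintype.card_fin, nsmul_eq_mul]
    linarith
  refine le_of_forall_pos_le_add fun δ hδ => ?_
  have h6 := key (δ / (n + 1)) (by positivity)
  have h7 : (n : ℝ) * (δ / (n + 1)) ≤ δ := by
    rw [mul_div_assoc', div_le_iff₀ (by positivity)]
    nlinarith
  linarith

/-- Real and imaginary parts, each split into positive and negative part; the factor 2 is the loss
in `exists_posPart`. -/
theorem TraceClass.exists_eq_sum_positive (X : TraceClass H) :
    ∃ P : Fin 4 → TraceClass H, (∀ i, (P i).toOp.IsPositive) ∧ (∀ i, ‖P i‖ ≤ 2 * ‖X‖) ∧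
      X = P 0 - P 1 + Complex.I • (P 2 - P 3) := by
  obtain ⟨Y, hY, hYn⟩ := X.exists_adjoint
  have hsa : ∀ Z : TraceClass H, IsSelfAdjoint Z.toOp →
      ∃ P Q : TraceClass H, P.toOp.IsPositive ∧ Q.toOp.IsPositive ∧ ‖P‖ ≤ 2 * ‖Z‖ ∧
        ‖Q‖ ≤ 2 * ‖Z‖ ∧ Z = P - Q := by
    intro Z hZ
    obtain ⟨P, hP, hPn⟩ := Z.exists_posPart hZ
    obtain ⟨Q, hQ, hQn⟩ := (-Z).exists_posPart (by rw [map_neg]; exact hZ.neg)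
    rw [norm_neg] at hQn
    rw [map_neg, CFC.posPart_neg] at hQ
    refine ⟨P, Q, ?_, ?_, hPn, hQn, ?_⟩
    · rw [hP, ← ContinuousLinearMap.nonneg_iff_isPositive]; exact CFC.posPart_nonneg _
    · rw [hQ, ← ContinuousLinearMap.nonneg_iff_isPositive]; exact CFC.negPart_nonneg _
    · apply TraceClass.toOp_injective
      rw [map_sub, hP, hQ, CFC.posPart_sub_negPart _ hZ]
  have hA : IsSelfAdjoint ((1 / 2 : ℂ) • (X + Y)).toOp := by
    rw [isSelfAdjoint_iff, TraceClass.toOp_smul, map_add, hY,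
      ← ContinuousLinearMap.star_eq_adjoint, star_smul, star_add, star_star, add_comm]
    simp
  have hB : IsSelfAdjoint ((-Complex.I / 2 : ℂ) • (X - Y)).toOp := by
    rw [isSelfAdjoint_iff, TraceClass.toOp_smul, map_sub, hY,
      ← ContinuousLinearMap.star_eq_adjoint, star_smul, star_sub, star_star]
    simp only [star_div₀, star_neg, RCLike.star_def, Complex.conj_I, neg_neg, map_ofNat]
    rw [← neg_sub X.toOp, smul_neg, ← neg_smul]
    congr 1
    ring
  obtain ⟨P0, P1, h0, h1, n0, n1, e01⟩ := hsa _ hA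
  obtain ⟨P2, P3, h2, h3, n2, n3, e23⟩ := hsa _ hB
  have hAn : ‖(1 / 2 : ℂ) • (X + Y)‖ ≤ ‖X‖ := by
    rw [norm_smul]
    have := norm_add_le X Y
    norm_num
    linarith
  have hBn : ‖(-Complex.I / 2 : ℂ) • (X - Y)‖ ≤ ‖X‖ := by
    rw [norm_smul]
    have := norm_sub_le X Y
    norm_num
    linarith
  refine ⟨![P0, P1, P2, P3], ?_, ?_, ?_⟩
  · intro i; fin_cases i <;> assumption
  · intro i
    fin_cases i <;> simp <;> linarith
  · simp only [Matrix.cons_val_zero, Matrix.cons_val_one, Matrix.cons_val]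
    rw [← e01, ← e23, smul_smul]
    have : Complex.I * (-Complex.I / 2) = 1 / 2 := by
      rw [mul_div_assoc', mul_neg, Complex.I_mul_I, neg_neg]
    rw [this]
    module

end TraceClassTheory


/-! ### The trace and positive trace-class operators on Fock space -/

section FockTrace

/-- Square roots of positive bounded operators. -/
theorem ContinuousLinearMap.IsPositive.exists_sqrt {H : Type*} [NormedAddCommGroup H]
    [InnerProductSpace ℂ H] [CompleteSpace H] {A : H →L[ℂ] H} (hA : A.IsPositive) :
    ∃ S : H →L[ℂ] H, (∀ x y, ⟪S x, y⟫_ℂ = ⟪x, S y⟫_ℂ) ∧ ∀ x y, ⟪x, A y⟫_ℂ = ⟪S x, S y⟫_ℂ := by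
  have h0 : 0 ≤ A := (ContinuousLinearMap.nonneg_iff_isPositive A).2 hA
  have hS := (ContinuousLinearMap.nonneg_iff_isPositive _).1 (CFC.sqrt_nonneg A)
  refine ⟨CFC.sqrt A, hS.inner_left_eq_inner_right, fun x y => ?_⟩
  rw [hS.inner_left_eq_inner_right, ← mul_apply_eq_comp, CFC.sqrt_mul_sqrt_self A h0]

variable {V : Type*} [DecidableEq V] [Fintype V]

/-- The occupation number basis as a Hilbert basis. -/
noncomputable def fockBasis (V : Type*) [DecidableEq V] [Fintype V] :
    HilbertBasis (V → ℕ) ℂ (FockSpace V) :=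
  HilbertBasis.ofRepr (LinearIsometryEquiv.refl ℂ _)

theorem fockBasis_apply (n : V → ℕ) : fockBasis V n = ket n := by
  classical
  rw [← HilbertBasis.repr_symm_single]
  rfl

theorem coe_fockBasis : (fockBasis V : (V → ℕ) → FockSpace V) = ket :=
  funext fockBasis_apply

theorem orthonormal_ket : Orthonormal ℂ (ket : (V → ℕ) → FockSpace V) :=
  coe_fockBasis (V := V) ▸ (fockBasis V).orthonormal

theorem inner_ket_ket (n m : V → ℕ) : ⟪ket n, ket m⟫_ℂ = if n = m then 1 else 0 :=
  orthonormal_iff_ite.1 orthonormal_ket n m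

theorem FockSpace.ext_ket {x y : FockSpace V} (h : ∀ n, ⟪ket n, x⟫_ℂ = ⟪ket n, y⟫_ℂ) : x = y := by
  apply (fockBasis V).repr.injective
  ext n
  rw [HilbertBasis.repr_apply_apply, HilbertBasis.repr_apply_apply, fockBasis_apply]
  exact h n

theorem FockSpace.op_ext_ket {A B : FockSpace V →L[ℂ] FockSpace V}
    (h : ∀ n m, ⟪ket n, A (ket m)⟫_ℂ = ⟪ket n, B (ket m)⟫_ℂ) : A = B := by
  refine ContinuousLinearMap.ext_on (s := Set.range (ket : (V → ℕ) → FockSpace V)) ?_ ?_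
  · have := (fockBasis V).dense_span
    rw [coe_fockBasis] at this
    exact Submodule.dense_iff_topologicalClosure_eq_top.2 this
  · rintro _ ⟨m, rfl⟩
    exact FockSpace.ext_ket fun n => h n m

theorem FockSpace.hasSum_inner_mul_inner (x y : FockSpace V) :
    HasSum (fun n => ⟪x, ket n⟫_ℂ * ⟪ket n, y⟫_ℂ) ⟪x, y⟫_ℂ := by
  have := (fockBasis V).hasSum_inner_mul_inner x y
  simpa only [fockBasis_apply] using this

theorem FockSpace.hasSum_norm_sq (x : FockSpace V) :
    HasSum (fun n => ‖⟪ket n, x⟫_ℂ‖ ^ 2) (‖x‖ ^ 2) := by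
  have h := FockSpace.hasSum_inner_mul_inner x x
  have h2 := (Complex.reCLM.hasSum h)
  simp only [Complex.reCLM_apply] at h2
  convert h2 using 1
  · funext n
    rw [← inner_conj_symm x (ket n), Complex.conj_mul', ← Complex.ofReal_pow, Complex.ofReal_re]
  · rw [inner_self_eq_norm_sq_to_K]
    norm_cast

theorem FiniteFock.incl_single (n : V → ℕ) (c : ℂ) :
    FiniteFock.incl (Finsupp.single n c) = c • ket n := by
  simp [FiniteFock.incl]

theorem FiniteFock.inner_ket_incl (n : V → ℕ) (x : FiniteFock V) : ⟪ket n, x.incl⟫_ℂ = x n := by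
  induction x using Finsupp.induction_linear with
  | zero => simp
  | add x y hx hy => rw [map_add, inner_add_right, hx, hy, Finsupp.add_apply]
  | single m c =>
    rw [FiniteFock.incl_single, inner_smul_right, inner_ket_ket, Finsupp.single_apply]
    simp only [eq_comm (a := m) (b := n)]
    simp

theorem TraceClass.summable_inner_ket (X : TraceClass (FockSpace V))
    (O : FockSpace V →L[ℂ] FockSpace V) :
    Summable fun n => ‖⟪ket n, (O.comp X.toOp) (ket n)⟫_ℂ‖ :=
  summable_of_sum_le (fun _ => norm_nonneg _) fun s =>
    X.sum_norm_inner_mul_left_le O s orthonormal_ket orthonormal_ket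

/-- The functional `X ↦ tr (O X)` on trace-class operators. -/
noncomputable def traceAgainst (O : FockSpace V →L[ℂ] FockSpace V) :
    TraceClass (FockSpace V) →L[ℂ] ℂ :=
  LinearMap.mkContinuous
    { toFun := fun X => fockTrace (O.comp X.toOp)
      map_add' := fun X Y => by
        simp only [fockTrace]
        rw [← (X.summable_inner_ket O).of_norm.tsum_add (Y.summable_inner_ket O).of_norm]
        refine tsum_congr fun n => ?_
        rw [map_add, ContinuousLinearMap.comp_add, _root_.add_apply, inner_add_right]
      map_smul' := fun c X => by
        simp only [fockTrace]
        rw [RingHom.id_apply, smul_eq_mul, ← tsum_mul_left]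
        refine tsum_congr fun n => ?_
        rw [TraceClass.toOp_smul, ContinuousLinearMap.comp_smul, _root_.smul_apply,
          inner_smul_right] }
    (2 * ‖O‖) fun X => by
      refine (norm_tsum_le_tsum_norm (X.summable_inner_ket O)).trans ?_
      exact (X.summable_inner_ket O).tsum_le_of_sum_le fun s =>
        X.sum_norm_inner_mul_left_le O s orthonormal_ket orthonormal_ket

theorem traceAgainst_apply (O : FockSpace V →L[ℂ] FockSpace V) (X : TraceClass (FockSpace V)) :
    traceAgainst O X = fockTrace (O.comp X.toOp) := rfl

theorem norm_traceAgainst_le (O : FockSpace V →L[ℂ] FockSpace V) (X : TraceClass (FockSpace V)) :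
    ‖traceAgainst O X‖ ≤ 2 * ‖O‖ * ‖X‖ :=
  (norm_tsum_le_tsum_norm (X.summable_inner_ket O)).trans <|
    (X.summable_inner_ket O).tsum_le_of_sum_le fun s =>
      X.sum_norm_inner_mul_left_le O s orthonormal_ket orthonormal_ket

theorem traceAgainst_id (X : TraceClass (FockSpace V)) :
    traceAgainst (ContinuousLinearMap.id ℂ _) X = fockTrace X.toOp := by
  rw [traceAgainst_apply, ContinuousLinearMap.id_comp]

theorem TraceClass.summable_diag (X : TraceClass (FockSpace V)) :
    Summable fun n => ‖⟪ket n, X.toOp (ket n)⟫_ℂ‖ :=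
  X.summable_inner_ket (ContinuousLinearMap.id ℂ _)

theorem fockTrace_ketBra (x y : FockSpace V) : fockTrace (ketBra x y).toOp = ⟪y, x⟫_ℂ := by
  rw [fockTrace, ← (FockSpace.hasSum_inner_mul_inner y x).tsum_eq]
  refine tsum_congr fun n => ?_
  rw [toOp_ketBra, InnerProductSpace.rankOne_apply, inner_smul_right]

/-- The Hilbert-Schmidt norms of an operator and of its adjoint agree. -/
theorem sum_norm_sq_adjoint_le {T T' : FockSpace V →L[ℂ] FockSpace V}
    (hT : ∀ x y, ⟪T x, y⟫_ℂ = ⟪x, T' y⟫_ℂ) {C : ℝ}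
    (h : ∀ s : Finset (V → ℕ), ∑ n ∈ s, ‖T (ket n)‖ ^ 2 ≤ C)
    {ι : Type*} (s : Finset ι) {e : ι → FockSpace V} (he : Orthonormal ℂ e) :
    ∑ i ∈ s, ‖T' (e i)‖ ^ 2 ≤ C := by
  have h1 : HasSum (fun n => ∑ i ∈ s, ‖⟪ket n, T' (e i)⟫_ℂ‖ ^ 2) (∑ i ∈ s, ‖T' (e i)‖ ^ 2) :=
    hasSum_sum fun i _ => FockSpace.hasSum_norm_sq _
  refine le_of_tendsto h1 (Filter.Eventually.of_forall fun S => le_trans ?_ (h S))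
  refine Finset.sum_le_sum fun n _ => ?_
  refine le_trans (le_of_eq ?_) (he.sum_inner_products_le (s := s) (T (ket n)))
  refine Finset.sum_congr rfl fun i _ => ?_
  rw [← hT, norm_inner_symm]

/-- Passing to the adjoint twice: from `T` on the Fock basis to `T'` on the Fock basis, and from
there back to `T` on an arbitrary orthonormal family. -/
theorem sum_norm_sq_le_of_basis {T T' : FockSpace V →L[ℂ] FockSpace V}
    (hT : ∀ x y, ⟪T x, y⟫_ℂ = ⟪x, T' y⟫_ℂ) {C : ℝ}
    (h : ∀ s : Finset (V → ℕ), ∑ n ∈ s, ‖T (ket n)‖ ^ 2 ≤ C)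
    {ι : Type*} (s : Finset ι) {e : ι → FockSpace V} (he : Orthonormal ℂ e) :
    ∑ i ∈ s, ‖T (e i)‖ ^ 2 ≤ C := by
  refine sum_norm_sq_adjoint_le (T := T') (fun x y => ?_)
    (fun S => sum_norm_sq_adjoint_le hT h S orthonormal_ket) s he
  rw [← inner_conj_symm, ← hT, inner_conj_symm]

theorem ContinuousLinearMap.IsPositive.inner_eq_ofReal_norm {H : Type*} [NormedAddCommGroup H]
    [InnerProductSpace ℂ H] {A : H →L[ℂ] H} (hA : A.IsPositive) (x : H) :
    ⟪x, A x⟫_ℂ = (‖⟪x, A x⟫_ℂ‖ : ℂ) := by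
  rw [← Complex.eq_coe_norm_of_nonneg (hA.inner_nonneg_right x)]

/-- With X = S², the trace is the squared Hilbert-Schmidt norm of S, and |⟨e, X f⟩| ≤ (‖S e‖² + ‖S
f‖²)/2. Both halves are bounded by the trace, whichever orthonormal families are used. -/
theorem TraceClass.fockTrace_eq_of_isPositive {X : TraceClass (FockSpace V)}
    (hX : X.toOp.IsPositive) : fockTrace X.toOp = (‖X‖ : ℂ) := by
  have h0 : fockTrace X.toOp = ((∑' n, ‖⟪ket n, X.toOp (ket n)⟫_ℂ‖ : ℝ) : ℂ) := by
    rw [Complex.ofReal_tsum]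
    exact tsum_congr fun n => hX.inner_eq_ofReal_norm _
  rw [h0, Complex.ofReal_inj]
  apply le_antisymm
  · exact X.summable_diag.tsum_le_of_sum_le fun s =>
      X.sum_norm_inner_le s orthonormal_ket orthonormal_ket
  obtain ⟨S, hS, hSS⟩ := hX.exists_sqrt
  have hn : ∀ x, ‖⟪x, X.toOp x⟫_ℂ‖ = ‖S x‖ ^ 2 := fun x => by
    rw [hSS, inner_self_eq_norm_sq_to_K]
    simp
  have hsum : ∀ s : Finset (V → ℕ), ∑ n ∈ s, ‖S (ket n)‖ ^ 2 ≤
      ∑' n, ‖⟪ket n, X.toOp (ket n)⟫_ℂ‖ := fun s => by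
    simp only [← hn]
    exact X.summable_diag.sum_le_tsum s fun _ _ => norm_nonneg _
  refine TraceClass.norm_le_of_bound fun n e f he hf => ?_
  have h1 : ∀ i, ‖⟪e i, X.toOp (f i)⟫_ℂ‖ ≤ (‖S (e i)‖ ^ 2 + ‖S (f i)‖ ^ 2) / 2 := fun i => by
    rw [hSS]
    refine (norm_inner_le_norm _ _).trans ?_
    nlinarith [sq_nonneg (‖S (e i)‖ - ‖S (f i)‖)]
  refine (Finset.sum_le_sum fun i _ => h1 i).trans ?_
  rw [← Finset.sum_div, Finset.sum_add_distrib]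
  have h2 := sum_norm_sq_le_of_basis hS hsum Finset.univ he
  have h3 := sum_norm_sq_le_of_basis hS hsum Finset.univ hf
  linarith

/-! ### Truncation to boxes of occupation numbers -/

/-- The occupation numbers bounded by `N`. -/
def box (V : Type*) [DecidableEq V] [Fintype V] (N : ℕ) : Finset (V → ℕ) :=
  Fintype.piFinset fun _ => Finset.range (N + 1)

theorem mem_box {N : ℕ} {n : V → ℕ} : n ∈ box V N ↔ ∀ i, n i ≤ N := by
  simp [box]

theorem box_mono : Monotone (box V) := fun N M h n hn => by
  rw [mem_box] at hn ⊢
  exact fun i => (hn i).trans h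

theorem tendsto_box : Filter.Tendsto (box V) Filter.atTop Filter.atTop := by
  refine Filter.tendsto_atTop_finset_of_monotone box_mono fun n => ⟨∑ i, n i, ?_⟩
  rw [mem_box]
  exact fun i => Finset.single_le_sum (f := n) (fun _ _ => Nat.zero_le _) (Finset.mem_univ i)

/-- Diagonal operators on finite vectors. -/
noncomputable def diagonal (g : (V → ℕ) → ℂ) : Module.End ℂ (FiniteFock V) :=
  Finsupp.linearCombination ℂ fun n => Finsupp.single n (g n)

theorem diagonal_apply (g : (V → ℕ) → ℂ) (x : FiniteFock V) (n : V → ℕ) :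
    diagonal g x n = g n * x n := by
  classical
  induction x using Finsupp.induction_linear with
  | zero => simp
  | add x y hx hy => rw [map_add, Finsupp.add_apply, hx, hy, Finsupp.add_apply, mul_add]
  | single m c =>
    simp only [diagonal, Finsupp.linearCombination_single, Finsupp.smul_apply,
      Finsupp.single_apply, smul_eq_mul]
    split_ifs with h
    · rw [h]; ring
    · simp

/-- The projection of finite vectors to the box of size `N`. -/
noncomputable def cut (N : ℕ) : Module.End ℂ (FiniteFock V) :=
  diagonal fun n => if n ∈ box V N then 1 else 0

theorem cut_apply (N : ℕ) (x : FiniteFock V) (n : V → ℕ) :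
    cut N x n = if n ∈ box V N then x n else 0 := by
  rw [cut, diagonal_apply]
  split_ifs <;> simp

theorem cut_eq_self_iff {N : ℕ} {x : FiniteFock V} :
    cut N x = x ↔ ∀ n, n ∉ box V N → x n = 0 := by
  constructor
  · intro h n hn
    rw [← h, cut_apply, if_neg hn]
  · intro h
    ext n
    rw [cut_apply]
    split_ifs with hn
    · rfl
    · exact (h n hn).symm

theorem cut_cut (N : ℕ) (x : FiniteFock V) : cut N (cut N x) = cut N x :=
  cut_eq_self_iff.2 fun n hn => by rw [cut_apply, if_neg hn]

theorem cut_eq_self_mono {N M : ℕ} (h : N ≤ M) {x : FiniteFock V} (hx : cut N x = x) :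
    cut M x = x :=
  cut_eq_self_iff.2 fun n hn => cut_eq_self_iff.1 hx n fun hN => hn (box_mono h hN)

theorem exists_cut_eq_self (x : FiniteFock V) : ∃ N, cut N x = x := by
  obtain ⟨N, hN⟩ := (Filter.tendsto_atTop.1 tendsto_box x.support).exists
  exact ⟨N, cut_eq_self_iff.2 fun n hn => by
    by_contra h
    exact hn (hN (Finsupp.mem_support_iff.2 h))⟩

theorem cut_single {N : ℕ} {n : V → ℕ} (h : n ∈ box V N) (c : ℂ) :
    cut N (Finsupp.single n c : FiniteFock V) = Finsupp.single n c :=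
  cut_eq_self_iff.2 fun m hm => Finsupp.single_eq_of_ne (by rintro rfl; exact hm h)

theorem eq_sum_single_of_cut {N : ℕ} {x : FiniteFock V} (hx : cut N x = x) :
    x = ∑ n ∈ box V N, x n • Finsupp.single n (1 : ℂ) := by
  ext m
  rw [Finsupp.finsetSum_apply]
  simp only [Finsupp.smul_apply, Finsupp.single_apply, smul_eq_mul, mul_ite, mul_one, mul_zero,
    Finset.sum_ite_eq']
  split_ifs with h
  · rfl
  · exact cut_eq_self_iff.1 hx m h

/-- The compression of an operator on finite vectors to the box of size `N`, as a bounded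
operator on Fock space. -/
noncomputable def compress (N : ℕ) (M : Module.End ℂ (FiniteFock V)) :
    FockSpace V →L[ℂ] FockSpace V :=
  ∑ n ∈ box V N, InnerProductSpace.rankOne ℂ (cut N (M (Finsupp.single n 1))).incl (ket n)

theorem compress_apply (N : ℕ) (M : Module.End ℂ (FiniteFock V)) (z : FockSpace V) :
    compress N M z = ∑ n ∈ box V N, ⟪ket n, z⟫_ℂ • (cut N (M (Finsupp.single n 1))).incl := by
  rw [compress, _root_.sum_apply]
  exact Finset.sum_congr rfl fun n _ => InnerProductSpace.rankOne_apply _ _ _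

theorem compress_incl {N : ℕ} (M : Module.End ℂ (FiniteFock V)) {x : FiniteFock V}
    (hx : cut N x = x) : compress N M x.incl = (cut N (M x)).incl := by
  rw [compress_apply]
  conv_rhs => rw [eq_sum_single_of_cut hx]
  simp only [map_sum, _root_.map_smul, FiniteFock.inner_ket_incl]

theorem compress_ket_of_notMem {N : ℕ} (M : Module.End ℂ (FiniteFock V)) {n : V → ℕ}
    (hn : n ∉ box V N) : compress N M (ket n) = 0 := by
  rw [compress_apply]
  refine Finset.sum_eq_zero fun m hm => ?_
  rw [inner_ket_ket, if_neg (by rintro rfl; exact hn hm), zero_smul]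

theorem ket_eq_incl (n : V → ℕ) : ket n = FiniteFock.incl (Finsupp.single n (1 : ℂ)) := by
  rw [FiniteFock.incl_single, one_smul]

theorem compress_ket_of_mem {N : ℕ} (M : Module.End ℂ (FiniteFock V)) {n : V → ℕ}
    (hn : n ∈ box V N) : compress N M (ket n) = (cut N (M (Finsupp.single n 1))).incl := by
  rw [ket_eq_incl n, compress_incl M (cut_single hn 1)]

theorem inner_ket_compress {N : ℕ} (M : Module.End ℂ (FiniteFock V)) {n : V → ℕ}
    (hn : n ∉ box V N) (z : FockSpace V) : ⟪ket n, compress N M z⟫_ℂ = 0 := by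
  rw [compress_apply, inner_sum]
  refine Finset.sum_eq_zero fun m _ => ?_
  rw [inner_smul_right, FiniteFock.inner_ket_incl, cut_apply, if_neg hn, mul_zero]

theorem compress_one_ket (N : ℕ) (n : V → ℕ) :
    compress N (1 : Module.End ℂ (FiniteFock V)) (ket n) = if n ∈ box V N then ket n else 0 := by
  split_ifs with h
  · rw [compress_ket_of_mem _ h, Module.End.one_apply, cut_single h, ← ket_eq_incl]
  · exact compress_ket_of_notMem _ h

theorem inner_compress_one (N : ℕ) (x y : FockSpace V) :
    ⟪compress N 1 x, y⟫_ℂ = ⟪x, compress N 1 y⟫_ℂ := by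
  rw [compress_apply, compress_apply, sum_inner, inner_sum]
  refine Finset.sum_congr rfl fun n hn => ?_
  rw [Module.End.one_apply, cut_single hn, ← ket_eq_incl, inner_smul_left, inner_smul_right,
    inner_conj_symm, mul_comm]

end FockTrace


/-! ### Finite-rank approximation -/

section Density

variable {V : Type*} [DecidableEq V] [Fintype V]

/-- The compression `X ↦ P X P` of trace-class operators to the box of size `N`. -/
noncomputable def cutTrace (N : ℕ) : TraceClass (FockSpace V) →L[ℂ] TraceClass (FockSpace V) :=
  (TraceClass.lmul (compress N 1)).comp (TraceClass.rmul (compress N 1))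

theorem inner_cutTrace (N : ℕ) (X : TraceClass (FockSpace V)) (x y : FockSpace V) :
    ⟪x, (cutTrace N X).toOp y⟫_ℂ = ⟪compress N 1 x, X.toOp (compress N 1 y)⟫_ℂ := by
  rw [cutTrace, ContinuousLinearMap.comp_apply, TraceClass.toOp_lmul, TraceClass.toOp_rmul,
    mul_apply_eq_comp, mul_apply_eq_comp, inner_compress_one]

theorem cutTrace_isPositive (N : ℕ) {X : TraceClass (FockSpace V)} (hX : X.toOp.IsPositive) :
    (cutTrace N X).toOp.IsPositive := by
  rw [ContinuousLinearMap.isPositive_iff_complex]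
  intro x
  have h : 0 ≤ ⟪x, (cutTrace N X).toOp x⟫_ℂ := by
    rw [inner_cutTrace]
    exact hX.inner_nonneg_right _
  rw [← inner_conj_symm, Complex.eq_coe_norm_of_nonneg h]
  simp

theorem inner_ket_cutTrace {N : ℕ} {n : V → ℕ} (hn : n ∉ box V N) (X : TraceClass (FockSpace V))
    (y : FockSpace V) : ⟪ket n, (cutTrace N X).toOp y⟫_ℂ = 0 := by
  rw [inner_cutTrace, compress_one_ket, if_neg hn, inner_zero_left]

/-- With X = S² and Q = 1 - P, one has X - PXP = QX + PXQ. Each term is a product of a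
Hilbert-Schmidt operator built from S and one built from SQ; the squared Hilbert-Schmidt norm of the
latter is at most the tail of the diagonal of X outside the box. -/
theorem tendsto_cutTrace {X : TraceClass (FockSpace V)} (hX : X.toOp.IsPositive) :
    Filter.Tendsto (fun N => cutTrace N X) Filter.atTop (𝓝 X) := by
  obtain ⟨S, hS, hSS⟩ := hX.exists_sqrt
  set g : (V → ℕ) → ℝ := fun n => ‖⟪ket n, X.toOp (ket n)⟫_ℂ‖ with hg
  have hgS : ∀ n, g n = ‖S (ket n)‖ ^ 2 := fun n => by
    rw [hg]
    simp only
    rw [hSS, inner_self_eq_norm_sq_to_K]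
    simp
  have hsum : Summable g := X.summable_diag
  set P : ℕ → FockSpace V →L[ℂ] FockSpace V := fun N => compress N 1 with hP
  set Q : ℕ → FockSpace V →L[ℂ] FockSpace V := fun N => 1 - P N with hQ
  have hQsa : ∀ N x y, ⟪Q N x, y⟫_ℂ = ⟪x, Q N y⟫_ℂ := fun N x y => by
    simp only [hQ, hP, _root_.sub_apply, one_apply_eq_self, inner_sub_left, inner_sub_right,
      inner_compress_one]
  have hQk : ∀ N n, Q N (ket n) = if n ∈ box V N then 0 else ket n := fun N n => by
    simp only [hQ, hP, _root_.sub_apply, one_apply_eq_self, compress_one_ket]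
    split_ifs <;> simp
  set τ := ∑' n, g n with hτ
  set δ : ℕ → ℝ := fun N => ∑' n : {n // n ∉ box V N}, g n with hδ
  have hδ0 : Filter.Tendsto δ Filter.atTop (𝓝 0) := (tendsto_tsum_compl_atTop_zero g).comp tendsto_box
  have b1 : ∀ s : Finset (V → ℕ), ∑ n ∈ s, ‖S (ket n)‖ ^ 2 ≤ τ := fun s => by
    simp only [← hgS]
    exact hsum.sum_le_tsum s fun n _ => norm_nonneg _
  have b2 : ∀ N (s : Finset (V → ℕ)), ∑ n ∈ s, ‖(S * Q N) (ket n)‖ ^ 2 ≤ δ N := fun N s => by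
    have e1 : ∀ n, ‖(S * Q N) (ket n)‖ ^ 2 = Set.indicator {n | n ∉ box V N} g n := fun n => by
      rw [mul_apply_eq_comp, hQk, Set.indicator_apply, hgS]
      by_cases h : n ∈ box V N <;> simp [h]
    have e2 : δ N = ∑' n, Set.indicator {n | n ∉ box V N} g n := tsum_subtype _ _
    simp only [e1, e2]
    exact (hsum.indicator _).sum_le_tsum s fun n _ =>
      Set.indicator_nonneg (fun n _ => norm_nonneg _) n
  have b3 : ∀ N (s : Finset (V → ℕ)), ∑ n ∈ s, ‖(S * P N) (ket n)‖ ^ 2 ≤ τ := fun N s => by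
    refine (Finset.sum_le_sum fun n _ => ?_).trans (b1 s)
    simp only [mul_apply_eq_comp, hP, compress_one_ket]
    split_ifs
    · exact le_rfl
    · simp
  have hadjQ : ∀ N x y, ⟪(S * Q N) x, y⟫_ℂ = ⟪x, (Q N * S) y⟫_ℂ := fun N x y => by
    rw [mul_apply_eq_comp, mul_apply_eq_comp, hS, hQsa]
  have hadjP : ∀ N x y, ⟪(S * P N) x, y⟫_ℂ = ⟪x, (P N * S) y⟫_ℂ := fun N x y => by
    simp only [mul_apply_eq_comp, hP, hS, inner_compress_one]
  have hCS : ∀ (n : ℕ) (A B : FockSpace V →L[ℂ] FockSpace V) (e f : Fin n → FockSpace V) (a b : ℝ),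
      0 ≤ a → ∑ i, ‖A (e i)‖ ^ 2 ≤ a → ∑ i, ‖B (f i)‖ ^ 2 ≤ b →
      ∑ i, ‖⟪A (e i), B (f i)⟫_ℂ‖ ≤ √(a * b) := by
    intro n A B e f a b ha h1 h2
    apply Real.le_sqrt_of_sq_le
    refine le_trans ?_ (mul_le_mul h1 h2 (Finset.sum_nonneg fun i _ => by positivity) ha)
    refine le_trans ?_ (Finset.sum_mul_sq_le_sq_mul_sq _ _ _)
    exact pow_le_pow_left₀ (Finset.sum_nonneg fun i _ => norm_nonneg _)
      (Finset.sum_le_sum fun i _ => norm_inner_le_norm _ _) 2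
  have hτ0 : 0 ≤ τ := tsum_nonneg fun n => norm_nonneg _
  have hδn : ∀ N, 0 ≤ δ N := fun N => tsum_nonneg fun n => norm_nonneg _
  have key : ∀ N, ‖X - cutTrace N X‖ ≤ √(δ N * τ) + √(τ * δ N) := by
    intro N
    refine TraceClass.norm_le_of_bound fun n e f he hf => ?_
    have h1 : ∀ i, ‖⟪e i, (X - cutTrace N X).toOp (f i)⟫_ℂ‖ ≤
        ‖⟪(S * Q N) (e i), S (f i)⟫_ℂ‖ + ‖⟪(S * P N) (e i), (S * Q N) (f i)⟫_ℂ‖ := by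
      intro i
      refine le_trans (le_of_eq ?_) (norm_add_le _ _)
      rw [map_sub, _root_.sub_apply, inner_sub_right, inner_cutTrace]
      simp only [mul_apply_eq_comp]
      rw [← hSS, ← hSS]
      simp only [hQ, hP, _root_.sub_apply, one_apply_eq_self, inner_sub_left, inner_sub_right,
        map_sub]
      congr 1
      ring
    refine (Finset.sum_le_sum fun i _ => h1 i).trans ?_
    rw [Finset.sum_add_distrib]
    refine add_le_add (hCS n _ _ e f _ _ (hδn N) ?_ ?_) (hCS n _ _ e f _ _ hτ0 ?_ ?_)
    · exact sum_norm_sq_le_of_basis (hadjQ N) (b2 N) Finset.univ he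
    · exact sum_norm_sq_le_of_basis hS b1 Finset.univ hf
    · exact sum_norm_sq_le_of_basis (hadjP N) (b3 N) Finset.univ he
    · exact sum_norm_sq_le_of_basis (hadjQ N) (b2 N) Finset.univ hf
  rw [tendsto_iff_norm_sub_tendsto_zero]
  have hlim : Filter.Tendsto (fun N => √(δ N * τ) + √(τ * δ N)) Filter.atTop (𝓝 0) := by
    have h1 := (Real.continuous_sqrt.tendsto _).comp (hδ0.mul_const τ)
    have h2 := (Real.continuous_sqrt.tendsto _).comp (hδ0.const_mul τ)
    have := h1.add h2
    simpa using this
  refine squeeze_zero (fun _ => norm_nonneg _) (fun N => ?_) hlim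
  rw [norm_sub_rev]
  exact key N

/-- A positive operator supported in a box is a sum of rank-one operators there. -/
theorem TraceClass.exists_eq_sum_ketBra {X : TraceClass (FockSpace V)} (hX : X.toOp.IsPositive)
    {N : ℕ} (h : ∀ n, n ∉ box V N → ⟪ket n, X.toOp (ket n)⟫_ℂ = 0) :
    ∃ y : (V → ℕ) → FiniteFock V, (∀ n, cut N (y n) = y n) ∧
      X = ∑ n ∈ box V N, ketBra (y n).incl (y n).incl := by
  obtain ⟨S, hS, hSS⟩ := hX.exists_sqrt
  -- The diagonal entry is ‖S|n⟩‖², so its vanishing annihilates the whole column of S.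
  have hS0 : ∀ n, n ∉ box V N → S (ket n) = 0 := fun n hn => by
    have := h n hn
    rwa [hSS, inner_self_eq_zero] at this
  -- The witnesses are the vectors S|n⟩, as X = S² = ∑ S|n⟩⟨n|S; by self-adjointness of S they are
  -- supported in the box.
  set y : (V → ℕ) → FiniteFock V := fun n =>
    ∑ m ∈ box V N, ⟪ket m, S (ket n)⟫_ℂ • Finsupp.single m (1 : ℂ) with hy
  have hyc : ∀ n m, y n m = if m ∈ box V N then ⟪ket m, S (ket n)⟫_ℂ else 0 := fun n m => by
    simp only [hy, Finsupp.finsetSum_apply, Finsupp.smul_apply, Finsupp.single_apply, smul_eq_mul,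
      mul_ite, mul_one, mul_zero, Finset.sum_ite_eq']
  have hyi : ∀ n, (y n).incl = S (ket n) := fun n => FockSpace.ext_ket fun m => by
    rw [FiniteFock.inner_ket_incl, hyc]
    split_ifs with hm
    · rfl
    · rw [← hS, hS0 m hm, inner_zero_left]
  refine ⟨y, fun n => cut_eq_self_iff.2 fun m hm => by rw [hyc, if_neg hm], ?_⟩
  apply TraceClass.toOp_injective
  refine FockSpace.op_ext_ket fun k m => ?_
  rw [hSS, map_sum, _root_.sum_apply, inner_sum,
    ← (FockSpace.hasSum_inner_mul_inner (S (ket k)) (S (ket m))).tsum_eq,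
    tsum_eq_sum (s := box V N) fun n hn => by rw [← hS (ket n), hS0 n hn, inner_zero_left, mul_zero]]
  refine Finset.sum_congr rfl fun n _ => ?_
  rw [hyi, toOp_ketBra, InnerProductSpace.rankOne_apply, inner_smul_right, hS, hS, mul_comm]

/-- The span of the rank-one operators `|x⟩⟨x|` with finite vectors `x`. -/
noncomputable def finiteRank (V : Type*) [DecidableEq V] [Fintype V] :
    Submodule ℂ (TraceClass (FockSpace V)) :=
  Submodule.span ℂ (Set.range fun x : FiniteFock V => ketBra x.incl x.incl)

theorem cutTrace_mem_finiteRank {X : TraceClass (FockSpace V)} (hX : X.toOp.IsPositive) (N : ℕ) :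
    cutTrace N X ∈ finiteRank V := by
  obtain ⟨y, -, hy⟩ := TraceClass.exists_eq_sum_ketBra (cutTrace_isPositive N hX)
    fun n hn => inner_ket_cutTrace hn X _
  rw [hy]
  exact Submodule.sum_mem _ fun n _ => Submodule.subset_span ⟨y n, rfl⟩

/-- Positive operators are limits of their box compressions, and four of them span any trace-class
operator. -/
theorem dense_finiteRank : Dense (finiteRank V : Set (TraceClass (FockSpace V))) := by
  rw [Submodule.dense_iff_topologicalClosure_eq_top, eq_top_iff]
  rintro X -
  have hpos : ∀ Y : TraceClass (FockSpace V), Y.toOp.IsPositive →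
      Y ∈ (finiteRank V).topologicalClosure := fun Y hY =>
    mem_closure_of_tendsto (tendsto_cutTrace hY)
      (Filter.Eventually.of_forall fun N => cutTrace_mem_finiteRank hY N)
  obtain ⟨P, hP, -, hX⟩ := X.exists_eq_sum_positive
  rw [hX]
  exact Submodule.add_mem _ (Submodule.sub_mem _ (hpos _ (hP 0)) (hpos _ (hP 1)))
    (Submodule.smul_mem _ _ (Submodule.sub_mem _ (hpos _ (hP 2)) (hpos _ (hP 3))))

end Density


/-! ### Exponentials of bounded operators -/

section ExpSemigroup

theorem norm_pow_sub_pow_le_mul {𝔸 : Type*} [NormedRing 𝔸] {X Y : 𝔸} {M : ℝ} (hM : 1 ≤ M)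
    (h1 : ‖(1 : 𝔸)‖ ≤ 1) (hX : ‖X‖ ≤ M) (hY : ‖Y‖ ≤ M) (n : ℕ) :
    ‖X ^ n - Y ^ n‖ ≤ n * M ^ n * ‖X - Y‖ := by
  have hpow : ∀ n : ℕ, ‖Y ^ n‖ ≤ M ^ n := by
    intro n
    induction n with
    | zero => simpa using h1
    | succ n ih =>
      rw [pow_succ, pow_succ]
      exact (norm_mul_le _ _).trans (mul_le_mul ih hY (norm_nonneg _) (by positivity))
  induction n with
  | zero => simp
  | succ n ih =>
    have e : X ^ (n + 1) - Y ^ (n + 1) = X * (X ^ n - Y ^ n) + (X - Y) * Y ^ n := by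
      rw [pow_succ', pow_succ']; noncomm_ring
    rw [e]
    refine (norm_add_le _ _).trans ?_
    have a1 : ‖X * (X ^ n - Y ^ n)‖ ≤ M * (n * M ^ n * ‖X - Y‖) :=
      (norm_mul_le _ _).trans (mul_le_mul hX ih (norm_nonneg _) (by positivity))
    have a2 : ‖(X - Y) * Y ^ n‖ ≤ ‖X - Y‖ * M ^ (n + 1) := by
      refine (norm_mul_le _ _).trans (mul_le_mul_of_nonneg_left ((hpow n).trans ?_) (norm_nonneg _))
      exact pow_le_pow_right₀ hM (Nat.le_succ n)
    push_cast
    rw [pow_succ] at a2 ⊢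
    linarith

/-- Chernoff's product formula for norm-differentiable curves. -/
theorem tendsto_pow_sub_pow_of_hasDerivAt {𝔸 : Type*} [NormedRing 𝔸] [NormedAlgebra ℝ 𝔸]
    (h1 : ‖(1 : 𝔸)‖ ≤ 1) {F G : ℝ → 𝔸} {L : 𝔸} (hF0 : F 0 = 1) (hG0 : G 0 = 1)
    (hF : HasDerivAt F L 0) (hG : HasDerivAt G L 0) {t : ℝ} (ht : 0 ≤ t) :
    Filter.Tendsto (fun n : ℕ => F (t / n) ^ n - G (t / n) ^ n) Filter.atTop (𝓝 0) := by
  have hlim : Filter.Tendsto (fun n : ℕ => t / n) Filter.atTop (𝓝 0) :=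
    tendsto_const_div_atTop_nhds_zero_nat t
  have hb : ∀ {E : ℝ → 𝔸}, E 0 = 1 → HasDerivAt E L 0 →
      ∀ᶠ n : ℕ in Filter.atTop, ‖E (t / n)‖ ≤ 1 + (‖L‖ + 1) * (t / n) := by
    intro E hE0 hE
    have h2 := (hasDerivAt_iff_isLittleO.1 hE).def (c := 1) one_pos
    filter_upwards [hlim.eventually h2] with n hn
    have hp : (0 : ℝ) ≤ t / n := by positivity
    rw [hE0, sub_zero, Real.norm_of_nonneg hp] at hn
    have e : E (t / n) = 1 + ((t / n) • L + (E (t / n) - 1 - (t / n) • L)) := by abel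
    rw [e]
    refine (norm_add_le _ _).trans (add_le_add h1 ?_)
    refine (norm_add_le _ _).trans ?_
    rw [norm_smul, Real.norm_of_nonneg hp]
    nlinarith
  have hd : (fun h => F h - G h) =o[𝓝 0] fun h => h := by
    have := (hasDerivAt_iff_isLittleO.1 hF).sub (hasDerivAt_iff_isLittleO.1 hG)
    refine (this.congr (fun h => ?_) (fun h => ?_))
    · rw [hF0, hG0]; abel
    · exact sub_zero h
  rw [Metric.tendsto_atTop']
  intro ε hε
  -- `K` bounds (1 + (‖L‖ + 1) t/n)^n uniformly in n.
  set K := Real.exp ((‖L‖ + 1) * t) with hK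
  have hK0 : 0 < K := Real.exp_pos _
  -- This tolerance leaves ε t/(2(t + 1)) < ε after multiplication by n · K · t/n; the summand 1
  -- covers t = 0.
  have h3 := hd.def (c := ε / (2 * K * (t + 1))) (by positivity)
  have hall := ((hb hF0 hF).and (hb hG0 hG)).and ((hlim.eventually h3).and (Filter.eventually_gt_atTop 0))
  obtain ⟨N, hN⟩ := Filter.eventually_atTop.1 hall
  refine ⟨N, fun n hn => ?_⟩
  obtain ⟨⟨hX, hY⟩, hXY, hn0⟩ := hN n hn.le
  have hn0' : (0 : ℝ) < n := by exact_mod_cast hn0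
  have hp : (0 : ℝ) ≤ t / n := by positivity
  rw [dist_zero_right]
  refine lt_of_le_of_lt (norm_pow_sub_pow_le_mul (by nlinarith [norm_nonneg L]) h1 hX hY n) ?_
  have hM : (1 + (‖L‖ + 1) * (t / n)) ^ n ≤ K := by
    have h4 : 1 + (‖L‖ + 1) * (t / n) ≤ Real.exp ((‖L‖ + 1) * (t / n)) := by
      rw [add_comm]; exact Real.add_one_le_exp _
    refine (pow_le_pow_left₀ (by positivity) h4 n).trans (le_of_eq ?_)
    rw [← Real.exp_nat_mul, hK]
    congr 1
    field_simp
  rw [Real.norm_of_nonneg hp] at hXY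
  calc (n : ℝ) * (1 + (‖L‖ + 1) * (t / n)) ^ n * ‖F (t / n) - G (t / n)‖
      ≤ n * K * (ε / (2 * K * (t + 1)) * (t / n)) := by gcongr
    _ = ε * (t / (2 * (t + 1))) := by field_simp
    _ < ε * 1 := by
        refine mul_lt_mul_of_pos_left ?_ hε
        rw [div_lt_one (by positivity)]
        linarith
    _ = ε := mul_one ε

variable {E : Type*} [NormedAddCommGroup E] [NormedSpace ℂ E] [CompleteSpace E]

/-- The uniformly continuous semigroup generated by a bounded operator. -/
noncomputable def expSG (L : E →L[ℂ] E) (t : ℝ) : E →L[ℂ] E := NormedSpace.exp (t • L)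

theorem expSG_zero (L : E →L[ℂ] E) : expSG L 0 = ContinuousLinearMap.id ℂ E := by
  rw [expSG, zero_smul, NormedSpace.exp_zero]; rfl

theorem expSG_add (L : E →L[ℂ] E) (s t : ℝ) : expSG L (s + t) = (expSG L s).comp (expSG L t) := by
  let _ : NormedAlgebra ℚ (E →L[ℂ] E) := NormedAlgebra.restrictScalars ℚ ℝ _
  rw [expSG, add_smul, NormedSpace.exp_add_of_commute]
  · rfl
  · exact ((Commute.refl L).smul_left s).smul_right t

theorem hasDerivAt_expSG (L : E →L[ℂ] E) (x : E) (t : ℝ) :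
    HasDerivAt (fun s => expSG L s x) (expSG L t (L x)) t :=
  (((ContinuousLinearMap.apply ℂ E x).restrictScalars ℝ).hasFDerivAt.comp_hasDerivAt t
    (hasDerivAt_exp_smul_const (𝕂 := ℝ) L t))

theorem hasDerivAt_expSG' (L : E →L[ℂ] E) (x : E) (t : ℝ) :
    HasDerivAt (fun s => expSG L s x) (L (expSG L t x)) t :=
  (((ContinuousLinearMap.apply ℂ E x).restrictScalars ℝ).hasFDerivAt.comp_hasDerivAt t
    (hasDerivAt_exp_smul_const' (𝕂 := ℝ) L t))

theorem continuous_expSG (L : E →L[ℂ] E) (x : E) : Continuous fun s => expSG L s x :=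
  continuous_iff_continuousAt.2 fun t => (hasDerivAt_expSG L x t).continuousAt

/-- Functionals that vanish on the range of the generator are conserved. This serves for the trace
and for the diagonal entries outside the box. -/
theorem expSG_functional_eq {L : E →L[ℂ] E} {φ : E →L[ℂ] ℂ} (h : ∀ x, φ (L x) = 0) (t : ℝ)
    (x : E) : φ (expSG L t x) = φ x := by
  have hd : ∀ s, HasDerivAt (fun s => φ (expSG L s x)) 0 s := fun s => by
    have := (φ.restrictScalars ℝ).hasFDerivAt.comp_hasDerivAt s (hasDerivAt_expSG' L x s)
    simpa [Function.comp_def, h] using this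
  have := is_const_of_deriv_eq_zero (fun s => (hd s).differentiableAt) (fun s => (hd s).deriv) t 0
  simpa [expSG_zero] using this

/-- The derivative of `s ↦ e^{(t - s) M} e^{s L} x`. -/
theorem hasDerivAt_expSG_comp (L M : E →L[ℂ] E) (x : E) (t s : ℝ) :
    HasDerivAt (fun s => expSG M (t - s) (expSG L s x))
      (expSG M (t - s) ((L - M) (expSG L s x))) s := by
  have h1 : HasDerivAt (fun s => expSG M (t - s)) (-(expSG M (t - s) * M)) s := by
    have h2 := (hasDerivAt_exp_smul_const (𝕂 := ℝ) M (t - s)).scomp s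
      ((hasDerivAt_const s t).sub (hasDerivAt_id s))
    simpa [Function.comp_def, expSG] using h2
  have h3 := hasDerivAt_expSG' L x s
  let B : (E →L[ℂ] E) →L[ℝ] E →L[ℝ] E := ContinuousLinearMap.restrictScalarsL ℂ E E ℝ ℝ
  have h4 := (B.hasFDerivAt.comp_hasDerivAt s h1).clm_apply h3
  refine HasDerivAt.congr_deriv (f := fun s => expSG M (t - s) (expSG L s x)) h4 ?_
  change (-(expSG M (t - s) * M)) (expSG L s x) + expSG M (t - s) (L (expSG L s x)) = _
  rw [_root_.neg_apply, mul_apply_eq_comp, _root_.sub_apply, map_sub]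
  abel

end ExpSemigroup

/-! ### Completely positive maps and bounded Lindblad generators -/

section CompletelyPositive

variable {H : Type*} [NormedAddCommGroup H] [InnerProductSpace ℂ H]

theorem IsCompletelyPositive.id : IsCompletelyPositive (ContinuousLinearMap.id ℂ (TraceClass H)) :=
  fun _ _ h x => h x

theorem IsCompletelyPositive.comp {S T : TraceClass H →L[ℂ] TraceClass H}
    (hS : IsCompletelyPositive S) (hT : IsCompletelyPositive T) :
    IsCompletelyPositive (S.comp T) :=
  fun k ρ h => hS k (fun i j => T (ρ i j)) (hT k ρ h)

theorem IsCompletelyPositive.add {S T : TraceClass H →L[ℂ] TraceClass H}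
    (hS : IsCompletelyPositive S) (hT : IsCompletelyPositive T) :
    IsCompletelyPositive (S + T) := by
  intro k ρ h x
  have := add_nonneg (hS k ρ h x) (hT k ρ h x)
  simpa only [← Finset.sum_add_distrib, ← inner_add_right, ← _root_.add_apply, ← map_add] using this

theorem IsCompletelyPositive.zero : IsCompletelyPositive (0 : TraceClass H →L[ℂ] TraceClass H) := by
  intro k ρ _ x
  simp

theorem IsCompletelyPositive.sum {ι : Type*} (s : Finset ι)
    {T : ι → TraceClass H →L[ℂ] TraceClass H} (h : ∀ i, IsCompletelyPositive (T i)) :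
    IsCompletelyPositive (∑ i ∈ s, T i) :=
  Finset.sum_induction _ _ (fun _ _ => IsCompletelyPositive.add) IsCompletelyPositive.zero
    fun i _ => h i

theorem IsCompletelyPositive.smul {T : TraceClass H →L[ℂ] TraceClass H}
    (hT : IsCompletelyPositive T) {c : ℝ} (hc : 0 ≤ c) : IsCompletelyPositive ((c : ℂ) • T) := by
  intro k ρ h x
  have := mul_nonneg (Complex.zero_le_real.2 hc) (hT k ρ h x)
  simpa only [Finset.mul_sum, ← inner_smul_right, ← _root_.smul_apply, ← TraceClass.toOp_smul]
    using this

theorem IsCompletelyPositive.pow {T : TraceClass H →L[ℂ] TraceClass H}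
    (hT : IsCompletelyPositive T) (n : ℕ) : IsCompletelyPositive (T ^ n) := by
  induction n with
  | zero => exact IsCompletelyPositive.id
  | succ n ih => rw [pow_succ]; exact ih.comp hT

theorem TraceClass.tendsto_inner {ι : Type*} {l : Filter ι} {X : ι → TraceClass H}
    {Y : TraceClass H} (h : Filter.Tendsto X l (𝓝 Y)) (x y : H) :
    Filter.Tendsto (fun i => ⟪x, (X i).toOp y⟫_ℂ) l (𝓝 ⟪x, Y.toOp y⟫_ℂ) := by
  rw [tendsto_iff_norm_sub_tendsto_zero] at h ⊢
  have h2 : Filter.Tendsto (fun i => ‖X i - Y‖ * ‖x‖ * ‖y‖) l (𝓝 0) := by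
    simpa using (h.mul_const ‖x‖).mul_const ‖y‖
  refine squeeze_zero (fun _ => norm_nonneg _) (fun i => ?_) h2
  have := (X i - Y).norm_inner_le x y
  rwa [map_sub, _root_.sub_apply, inner_sub_right] at this

theorem IsCompletelyPositive.of_tendsto {ι : Type*} {l : Filter ι} [l.NeBot]
    {T : ι → TraceClass H →L[ℂ] TraceClass H} {S : TraceClass H →L[ℂ] TraceClass H}
    (hT : ∀ᶠ i in l, IsCompletelyPositive (T i))
    (h : ∀ X, Filter.Tendsto (fun i => T i X) l (𝓝 (S X))) : IsCompletelyPositive S := by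
  intro k ρ hρ x
  have hlim : Filter.Tendsto (fun a => ∑ i, ∑ j, ⟪x i, (T a (ρ i j)).toOp (x j)⟫_ℂ) l
      (𝓝 (∑ i, ∑ j, ⟪x i, (S (ρ i j)).toOp (x j)⟫_ℂ)) :=
    tendsto_finsetSum _ fun i _ => tendsto_finsetSum _ fun j _ => TraceClass.tendsto_inner (h _) _ _
  exact ge_of_tendsto hlim (hT.mono fun a ha => ha k ρ hρ x)

theorem ContinuousLinearMap.isPositive_iff_inner_nonneg {A : H →L[ℂ] H} :
    A.IsPositive ↔ ∀ x, 0 ≤ ⟪x, A x⟫_ℂ := by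
  refine ⟨fun h x => h.inner_nonneg_right x, fun h => ?_⟩
  rw [ContinuousLinearMap.isPositive_iff_complex]
  intro x
  rw [← inner_conj_symm, Complex.eq_coe_norm_of_nonneg (h x)]
  simp

theorem IsCompletelyPositive.map_isPositive {T : TraceClass H →L[ℂ] TraceClass H}
    (hT : IsCompletelyPositive T) {X : TraceClass H} (hX : X.toOp.IsPositive) :
    (T X).toOp.IsPositive := by
  rw [ContinuousLinearMap.isPositive_iff_inner_nonneg] at hX ⊢
  intro x
  have := hT 1 (fun _ _ => X) (fun y => by simpa using hX (y 0)) (fun _ => x)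
  simpa using this

variable [CompleteSpace H]

/-- The map `X ↦ A X A†`. -/
noncomputable def TraceClass.conj (A : H →L[ℂ] H) : TraceClass H →L[ℂ] TraceClass H :=
  (TraceClass.lmul A).comp (TraceClass.rmul A.adjoint)

theorem TraceClass.inner_conj (A : H →L[ℂ] H) (X : TraceClass H) (x y : H) :
    ⟪x, (TraceClass.conj A X).toOp y⟫_ℂ = ⟪A.adjoint x, X.toOp (A.adjoint y)⟫_ℂ := by
  rw [TraceClass.conj, ContinuousLinearMap.comp_apply, TraceClass.toOp_lmul, TraceClass.toOp_rmul,
    mul_apply_eq_comp, mul_apply_eq_comp, ContinuousLinearMap.adjoint_inner_left]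

theorem TraceClass.conj_ketBra (A : H →L[ℂ] H) (x y : H) :
    TraceClass.conj A (ketBra x y) = ketBra (A x) (A y) := by
  rw [TraceClass.conj, ContinuousLinearMap.comp_apply, TraceClass.rmul_ketBra,
    TraceClass.lmul_ketBra, ContinuousLinearMap.adjoint_adjoint]

theorem TraceClass.conj_isCompletelyPositive (A : H →L[ℂ] H) :
    IsCompletelyPositive (TraceClass.conj A) := by
  intro k ρ h x
  simp only [TraceClass.inner_conj]
  exact h fun i => A.adjoint (x i)

/-- The bounded Lindblad generator `X ↦ A X + X A† + ∑ j, K j X (K j)†`. -/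
noncomputable def boundedLindblad {ι : Type*} [Fintype ι] (A : H →L[ℂ] H) (K : ι → H →L[ℂ] H) :
    TraceClass H →L[ℂ] TraceClass H :=
  TraceClass.lmul A + TraceClass.rmul A.adjoint + ∑ j, TraceClass.conj (K j)

theorem boundedLindblad_ketBra {ι : Type*} [Fintype ι] (A : H →L[ℂ] H) (K : ι → H →L[ℂ] H)
    (x y : H) : boundedLindblad A K (ketBra x y) =
      ketBra (A x) y + ketBra x (A y) + ∑ j, ketBra (K j x) (K j y) := by
  simp only [boundedLindblad, _root_.add_apply, _root_.sum_apply, TraceClass.lmul_ketBra,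
    TraceClass.rmul_ketBra, ContinuousLinearMap.adjoint_adjoint, TraceClass.conj_ketBra]

theorem inner_boundedLindblad {ι : Type*} [Fintype ι] (A : H →L[ℂ] H) (K : ι → H →L[ℂ] H)
    (X : TraceClass H) (x y : H) : ⟪x, (boundedLindblad A K X).toOp y⟫_ℂ =
      ⟪A.adjoint x, X.toOp y⟫_ℂ + ⟪x, X.toOp (A.adjoint y)⟫_ℂ +
        ∑ j, ⟪(K j).adjoint x, X.toOp ((K j).adjoint y)⟫_ℂ := by
  simp only [boundedLindblad, _root_.add_apply, _root_.sum_apply, map_add, map_sum, inner_add_right,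
    inner_sum, TraceClass.inner_conj, TraceClass.toOp_lmul, TraceClass.toOp_rmul,
    mul_apply_eq_comp, ContinuousLinearMap.adjoint_inner_left]

theorem TraceClass.conj_one_add_smul (A : H →L[ℂ] H) (h : ℝ) :
    TraceClass.conj (1 + (h : ℂ) • A) = 1 + (h : ℂ) • (TraceClass.lmul A + TraceClass.rmul A.adjoint)
      + (h : ℂ) ^ 2 • TraceClass.conj A := by
  ext1 X
  apply TraceClass.toOp_injective
  refine ContinuousLinearMap.ext fun y => ext_inner_left ℂ fun x => ?_
  have hadj : (1 + (h : ℂ) • A).adjoint = 1 + (h : ℂ) • A.adjoint := by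
    simp [← ContinuousLinearMap.star_eq_adjoint]
  simp only [TraceClass.inner_conj, hadj, _root_.add_apply, _root_.smul_apply, map_add,
    inner_add_right, inner_add_left, inner_smul_right, inner_smul_left,
    TraceClass.toOp_lmul, TraceClass.toOp_rmul, mul_apply_eq_comp, one_apply_eq_self,
    _root_.map_smul, ContinuousLinearMap.adjoint_inner_left, Complex.conj_ofReal]
  ring

/-- The maps Ψ(h) = (1 + hA)·(1 + hA)† + h ∑ K·K† are completely positive for h ≥ 0 and equal 1 + hL
+ h² A·A†. They agree with e^{hL} to first order, so Ψ(t/n)^n converges to e^{tL} by Chernoff's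
formula, and complete positivity is a closed condition. -/
theorem boundedLindblad_exp_isCompletelyPositive {ι : Type*} [Fintype ι] (A : H →L[ℂ] H)
    (K : ι → H →L[ℂ] H) {t : ℝ} (ht : 0 ≤ t) :
    IsCompletelyPositive (expSG (boundedLindblad A K) t) := by
  set L := boundedLindblad A K with hL
  set Ψ : ℝ → TraceClass H →L[ℂ] TraceClass H := fun h =>
    TraceClass.conj (1 + (h : ℂ) • A) + (h : ℂ) • ∑ j, TraceClass.conj (K j) with hΨ
  have hΨ' : ∀ h : ℝ, Ψ h = 1 + (h • L + h ^ 2 • TraceClass.conj A) := fun h => by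
    simp only [hΨ, TraceClass.conj_one_add_smul, hL, boundedLindblad, ← Complex.coe_smul]
    push_cast
    module
  have hΨcp : ∀ h : ℝ, 0 ≤ h → IsCompletelyPositive (Ψ h) := fun h hh =>
    (TraceClass.conj_isCompletelyPositive _).add
      ((IsCompletelyPositive.sum _ fun j => TraceClass.conj_isCompletelyPositive _).smul hh)
  have hΨd : HasDerivAt Ψ L 0 := by
    have h1 : HasDerivAt (fun h : ℝ => 1 + (h • L + h ^ 2 • TraceClass.conj A)) L 0 := by
      have h2 := (((hasDerivAt_id (0 : ℝ)).smul_const L).add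
        (((hasDerivAt_id (0 : ℝ)).pow 2).smul_const (TraceClass.conj A))).const_add 1
      simpa using h2
    exact h1.congr_of_eventuallyEq (Filter.Eventually.of_forall hΨ')
  have hed : HasDerivAt (fun h : ℝ => expSG L h) L 0 := by
    have := hasDerivAt_exp_smul_const (𝕂 := ℝ) L 0
    simpa [expSG] using this
  have h1 : ‖(1 : TraceClass H →L[ℂ] TraceClass H)‖ ≤ 1 := ContinuousLinearMap.norm_id_le
  have hlim := tendsto_pow_sub_pow_of_hasDerivAt h1 (F := Ψ) (G := fun h => expSG L h)
    (by rw [hΨ']; simp) (expSG_zero L) hΨd hed ht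
  have hpow : ∀ n : ℕ, 0 < n → expSG L (t / n) ^ n = expSG L t := fun n hn => by
    let _ : NormedAlgebra ℚ (TraceClass H →L[ℂ] TraceClass H) :=
      NormedAlgebra.restrictScalars ℚ ℝ _
    rw [expSG, ← NormedSpace.exp_nsmul, expSG, ← Nat.cast_smul_eq_nsmul ℝ, smul_smul]
    congr 2
    field_simp
  have hlim2 : Filter.Tendsto (fun n : ℕ => Ψ (t / n) ^ n) Filter.atTop (𝓝 (expSG L t)) := by
    have := hlim.add_const (expSG L t)
    rw [zero_add] at this
    refine this.congr' ?_
    filter_upwards [Filter.eventually_gt_atTop 0] with n hn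
    rw [hpow n hn]
    abel
  refine IsCompletelyPositive.of_tendsto (l := Filter.atTop)
    (T := fun n : ℕ => Ψ (t / n) ^ n) (Filter.Eventually.of_forall fun n => (hΨcp _ (by positivity)).pow n)
    fun X => ?_
  exact ((ContinuousLinearMap.apply ℂ _ X).continuous.tendsto _).comp hlim2

variable {V : Type*} [DecidableEq V] [Fintype V]

theorem fockTrace_map_eq_of_finite {T : TraceClass (FockSpace V) →L[ℂ] TraceClass (FockSpace V)}
    {c : ℂ} (h : ∀ x : FiniteFock V, fockTrace (T (ketBra x.incl x.incl)).toOp =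
      c * fockTrace (ketBra x.incl x.incl).toOp) (X : TraceClass (FockSpace V)) :
    fockTrace (T X).toOp = c * fockTrace X.toOp := by
  set φ := (traceAgainst (ContinuousLinearMap.id ℂ (FockSpace V))).comp T with hφ
  set ψ := c • traceAgainst (ContinuousLinearMap.id ℂ (FockSpace V)) with hψ
  have : φ = ψ := by
    refine ContinuousLinearMap.ext_on (s := Set.range fun x : FiniteFock V =>
      ketBra x.incl x.incl) dense_finiteRank ?_
    rintro _ ⟨x, rfl⟩
    simp only [hφ, hψ, ContinuousLinearMap.comp_apply, traceAgainst_id, _root_.smul_apply,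
      smul_eq_mul]
    exact h x
  have h2 := congrArg (fun f => f X) this
  simpa only [hφ, hψ, ContinuousLinearMap.comp_apply, traceAgainst_id, _root_.smul_apply,
      smul_eq_mul] using h2

/-- Positive trace-preserving maps are bounded by a universal constant. -/
theorem norm_le_of_positive_of_tracePreserving
    {T : TraceClass (FockSpace V) →L[ℂ] TraceClass (FockSpace V)} (hT : IsCompletelyPositive T)
    (htr : ∀ X, fockTrace (T X).toOp = fockTrace X.toOp) (X : TraceClass (FockSpace V)) :
    ‖T X‖ ≤ 8 * ‖X‖ := by
  obtain ⟨P, hP, hPn, hX⟩ := X.exists_eq_sum_positive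
  -- On positive operators the trace norm is the trace, so `T` is isometric there. Four pieces of
  -- norm at most 2‖X‖ give the constant 8.
  have h1 : ∀ i, ‖T (P i)‖ ≤ 2 * ‖X‖ := fun i => by
    have h2 := TraceClass.fockTrace_eq_of_isPositive (hT.map_isPositive (hP i))
    rw [htr, TraceClass.fockTrace_eq_of_isPositive (hP i), Complex.ofReal_inj] at h2
    rw [← h2]
    exact hPn i
  have h3 : T X = T (P 0) - T (P 1) + Complex.I • (T (P 2) - T (P 3)) := by
    conv_lhs => rw [hX]
    simp only [map_add, map_sub, _root_.map_smul]
  rw [h3]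
  refine (norm_add_le _ _).trans ?_
  rw [norm_smul, Complex.norm_I, one_mul]
  have h4 := norm_sub_le (T (P 0)) (T (P 1))
  have h5 := norm_sub_le (T (P 2)) (T (P 3))
  linarith [h1 0, h1 1, h1 2, h1 3]

theorem boundedLindblad_exp_tracePreserving {ι : Type*} [Fintype ι]
    {A : FockSpace V →L[ℂ] FockSpace V} {K : ι → FockSpace V →L[ℂ] FockSpace V}
    (h : ∀ x : FiniteFock V, ⟪x.incl, A x.incl⟫_ℂ + ⟪A x.incl, x.incl⟫_ℂ +
      ∑ j, ⟪K j x.incl, K j x.incl⟫_ℂ = 0) (t : ℝ) (X : TraceClass (FockSpace V)) :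
    fockTrace (expSG (boundedLindblad A K) t X).toOp = fockTrace X.toOp := by
  have h0 : ∀ X, traceAgainst (ContinuousLinearMap.id ℂ (FockSpace V)) (boundedLindblad A K X) = 0 :=
    fun X => by
      rw [traceAgainst_id, fockTrace_map_eq_of_finite (c := 0), zero_mul]
      intro x
      rw [zero_mul, boundedLindblad_ketBra, ← h x]
      rw [← traceAgainst_id, map_add, map_add, map_sum]
      simp only [traceAgainst_id, fockTrace_ketBra]
  have := expSG_functional_eq h0 t X
  rwa [traceAgainst_id, traceAgainst_id] at this

end CompletelyPositive


/-! ### Convergence of uniformly continuous semigroups -/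

section Convergence

variable {E : Type*} [NormedAddCommGroup E] [NormedSpace ℂ E]

/-- A bounded strongly continuous semigroup; values at negative times play no role. -/
structure IsBoundedSemigroup (T : ℝ → E →L[ℂ] E) (M : ℝ) : Prop where
  map_zero : T 0 = ContinuousLinearMap.id ℂ E
  map_add : ∀ s t : ℝ, 0 ≤ s → 0 ≤ t → T (s + t) = (T s).comp (T t)
  norm_le : ∀ t : ℝ, 0 ≤ t → ∀ x, ‖T t x‖ ≤ M * ‖x‖
  continuous_zero : ∀ x, Filter.Tendsto (fun t => T t x) (𝓝[>] 0) (𝓝 x)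

namespace IsBoundedSemigroup

variable {T : ℝ → E →L[ℂ] E} {M : ℝ}

theorem exists_norm_sub_le (h : IsBoundedSemigroup T M) (x : E) {ε : ℝ} (hε : 0 < ε) :
    ∃ δ > 0, ∀ t, 0 ≤ t → t ≤ δ → ‖T t x - x‖ ≤ ε := by
  have h1 := (Metric.tendsto_nhds.1 (h.continuous_zero x)) ε hε
  rw [eventually_nhdsWithin_iff, Metric.eventually_nhds_iff] at h1
  obtain ⟨δ, hδ, h2⟩ := h1
  refine ⟨δ / 2, by positivity, fun t ht htδ => ?_⟩
  rcases ht.eq_or_lt with rfl | ht'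
  · rw [h.map_zero]; simpa using hε.le
  · have := h2 (y := t) (by rw [Real.dist_eq, sub_zero, abs_of_pos ht']; linarith) ht'
    rw [dist_eq_norm] at this
    exact this.le

theorem norm_sub_le (h : IsBoundedSemigroup T M) (x : E) {s t : ℝ} (hs : 0 ≤ s) (ht : 0 ≤ t) :
    ‖T t x - T s x‖ ≤ M * ‖T |t - s| x - x‖ := by
  wlog hst : s ≤ t generalizing s t
  · rw [norm_sub_rev, abs_sub_comm]
    exact this ht hs (le_of_not_ge hst)
  have h1 : T t x - T s x = T s (T (t - s) x - x) := by
    rw [map_sub, ← ContinuousLinearMap.comp_apply, ← h.map_add s (t - s) hs (by linarith)]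
    congr 3
    ring
  rw [h1, abs_of_nonneg (by linarith)]
  exact h.norm_le s hs _

theorem continuousOn (h : IsBoundedSemigroup T M) (hM : 0 < M) (x : E) :
    ContinuousOn (fun t => T t x) (Set.Ici 0) := by
  intro s hs
  rw [ContinuousWithinAt, Metric.tendsto_nhds]
  intro ε hε
  obtain ⟨δ, hδ, h1⟩ := h.exists_norm_sub_le x (ε := ε / (2 * M)) (by positivity)
  rw [eventually_nhdsWithin_iff, Metric.eventually_nhds_iff]
  refine ⟨δ, hδ, fun t hts ht => ?_⟩
  rw [dist_eq_norm]
  refine lt_of_le_of_lt (h.norm_sub_le x hs ht) ?_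
  rw [Real.dist_eq] at hts
  have := h1 |t - s| (abs_nonneg _) hts.le
  calc M * ‖T |t - s| x - x‖ ≤ M * (ε / (2 * M)) := by gcongr
    _ = ε / 2 := by field_simp
    _ < ε := by linarith

theorem hasDerivWithinAt (h : IsBoundedSemigroup T M) {p : E × E} (hp : p ∈ generatorGraph T)
    {t : ℝ} (ht : 0 ≤ t) :
    HasDerivWithinAt (fun s => T s p.1) (T t p.2) (Set.Ioi t) t := by
  rw [hasDerivWithinAt_iff_tendsto_slope' (by simp)]
  have h1 : Filter.Tendsto (fun s : ℝ => s - t) (𝓝[>] t) (𝓝[>] 0) := by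
    refine tendsto_nhdsWithin_iff.2 ⟨?_, ?_⟩
    · have : Filter.Tendsto (fun s : ℝ => s - t) (𝓝 t) (𝓝 (t - t)) :=
        (continuous_id.sub continuous_const).tendsto t
      rw [sub_self] at this
      exact this.mono_left nhdsWithin_le_nhds
    · filter_upwards [self_mem_nhdsWithin] with s hs
      exact sub_pos.2 (Set.mem_Ioi.1 hs)
  have h2 := ((T t).continuous.tendsto _).comp (Filter.Tendsto.comp hp h1)
  refine h2.congr' ?_
  filter_upwards [self_mem_nhdsWithin] with s hs
  have hs' : t < s := hs
  simp only [Function.comp_apply, slope, vsub_eq_sub]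
  rw [_root_.map_smul, map_sub, ← ContinuousLinearMap.comp_apply,
    ← h.map_add t (s - t) ht (by linarith), Complex.coe_smul]
  congr 4
  ring

/-- The mean value inequality for s ↦ T s p.1 - s p.2. Unlike the limit defining the generator, this
estimate is quantitative and survives limits of `p`, which is how the generator is shown to be
closed. -/
theorem norm_sub_sub_smul_le (h : IsBoundedSemigroup T M) (hM : 0 < M) {p : E × E}
    (hp : p ∈ generatorGraph T) {t c : ℝ} (ht : 0 ≤ t)
    (hc : ∀ s, 0 ≤ s → s ≤ t → ‖T s p.2 - p.2‖ ≤ c) :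
    ‖T t p.1 - p.1 - t • p.2‖ ≤ c * t := by
  have h1 := norm_image_sub_le_of_norm_deriv_right_le_segment
    (f := fun s => T s p.1 - s • p.2) (f' := fun s => T s p.2 - p.2) (a := 0) (b := t) (C := c)
    (((h.continuousOn hM p.1).mono fun s hs => hs.1).sub (by fun_prop))
    (fun s hs => by
      have h2 := ((h.hasDerivWithinAt hp hs.1).Ici_of_Ioi).sub
        (((hasDerivAt_id s).smul_const p.2).hasDerivWithinAt)
      rw [one_smul] at h2
      exact h2)
    (fun s hs => hc s hs.1 hs.2.le) t ⟨ht, le_rfl⟩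
  simp only [zero_smul, sub_zero, h.map_zero, ContinuousLinearMap.id_apply] at h1
  convert h1 using 2
  abel

theorem mem_generatorGraph_of_forall (p : E × E)
    (h : ∀ ε > 0, ∃ δ > 0, ∀ t, 0 < t → t ≤ δ → ‖T t p.1 - p.1 - t • p.2‖ ≤ ε * t) :
    p ∈ generatorGraph T := by
  rw [generatorGraph, Set.mem_ofPred_eq, Metric.tendsto_nhds]
  intro ε hε
  obtain ⟨δ, hδ, h1⟩ := h (ε / 2) (by positivity)
  filter_upwards [Ioc_mem_nhdsGT hδ] with t ht
  rw [dist_eq_norm, Complex.coe_smul]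
  have e : t⁻¹ • (T t p.1 - p.1) - p.2 = t⁻¹ • (T t p.1 - p.1 - t • p.2) := by
    rw [smul_sub t⁻¹ (T t p.1 - p.1), smul_smul, inv_mul_cancel₀ ht.1.ne', one_smul]
  rw [e, norm_smul, Real.norm_of_nonneg (inv_nonneg.2 ht.1.le), inv_mul_lt_iff₀ ht.1]
  have := h1 t ht.1 ht.2
  nlinarith [ht.1]

theorem isClosed_generatorGraph (h : IsBoundedSemigroup T M) (hM : 0 < M) :
    IsClosed (generatorGraph T) := by
  rw [← isSeqClosed_iff_isClosed]
  intro u p hu hup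
  apply mem_generatorGraph_of_forall
  intro ε hε
  obtain ⟨δ, hδ, h1⟩ := h.exists_norm_sub_le p.2 hε
  refine ⟨δ, hδ, fun t ht htδ => ?_⟩
  have hu1 := (continuous_fst.tendsto p).comp hup
  have hu2 := (continuous_snd.tendsto p).comp hup
  have hL : Filter.Tendsto (fun n => ‖T t (u n).1 - (u n).1 - t • (u n).2‖) Filter.atTop
      (𝓝 ‖T t p.1 - p.1 - t • p.2‖) :=
    (((((T t).continuous.tendsto _).comp hu1).sub hu1).sub (hu2.const_smul t)).norm
  have hR : Filter.Tendsto (fun n => (ε + (M + 1) * ‖(u n).2 - p.2‖) * t) Filter.atTop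
      (𝓝 (ε * t)) := by
    have h2 := (tendsto_iff_norm_sub_tendsto_zero.1 hu2)
    have := ((h2.const_mul (M + 1)).const_add ε).mul_const t
    simpa using this
  refine le_of_tendsto_of_tendsto' hL hR fun n => ?_
  refine h.norm_sub_sub_smul_le hM (hu n) ht.le fun s hs hst => ?_
  have e : T s (u n).2 - (u n).2 =
      T s ((u n).2 - p.2) + (T s p.2 - p.2) - ((u n).2 - p.2) := by
    rw [map_sub]; abel
  rw [e]
  refine (_root_.norm_sub_le _ _).trans ?_
  have h3 := norm_add_le (T s ((u n).2 - p.2)) (T s p.2 - p.2)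
  have h4 := h.norm_le s hs ((u n).2 - p.2)
  have h5 := h1 s hs (hst.trans htδ)
  linarith

/-- A dense subspace of the domain whose graph closure is invariant is a core. -/
theorem generatorGraph_subset_closure [CompleteSpace E] (h : IsBoundedSemigroup T M) (hM : 0 < M)
    {G : Submodule ℂ (E × E)} (hG : (G : Set (E × E)) ⊆ generatorGraph T)
    (hdense : Dense {x | ∃ y, (x, y) ∈ G})
    (hinv : ∀ p ∈ G, ∀ t, 0 ≤ t → (T t p.1, T t p.2) ∈ closure (G : Set (E × E))) :
    generatorGraph T ⊆ closure (G : Set (E × E)) := by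
  have hII : ∀ (x : E) {t : ℝ}, 0 ≤ t →
      IntervalIntegrable (fun s => T s x) MeasureTheory.volume 0 t := fun x t ht =>
    ((h.continuousOn hM x).mono (by rw [Set.uIcc_of_le ht]; exact fun s hs => hs.1)).intervalIntegrable
  -- The closure of `G` is closed and convex and contains the orbit of `p`, hence also its time
  -- averages; the average of the second component is the difference quotient.
  have step1 : ∀ p ∈ G, ∀ t, 0 < t →
      (t⁻¹ • ∫ s in (0 : ℝ)..t, T s p.1, t⁻¹ • (T t p.1 - p.1)) ∈ closure (G : Set (E × E)) := by
    intro p hp t ht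
    have hint : ∫ s in (0 : ℝ)..t, T s p.2 = T t p.1 - p.1 := by
      have := intervalIntegral.integral_eq_sub_of_hasDeriv_right (a := 0) (b := t)
        (f := fun s => T s p.1) (f' := fun s => T s p.2)
        ((h.continuousOn hM p.1).mono (by rw [Set.uIcc_of_le ht.le]; exact fun s hs => hs.1))
        (fun s hs => h.hasDerivWithinAt (hG hp) (by
          rw [min_eq_left ht.le] at hs; exact hs.1.le)) (hII p.2 ht.le)
      rw [this, h.map_zero]; rfl
    have hconv : Convex ℝ (closure (G : Set (E × E))) := by
      have : Convex ℝ (G : Set (E × E)) := (G.restrictScalars ℝ).convex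
      exact this.closure
    have hi1 := (intervalIntegrable_iff_integrableOn_Ioc_of_le ht.le).1 (hII p.1 ht.le)
    have hi2 := (intervalIntegrable_iff_integrableOn_Ioc_of_le ht.le).1 (hII p.2 ht.le)
    have hmem := hconv.set_average_mem (μ := MeasureTheory.volume) (t := Set.Ioc 0 t)
      (f := fun s => (T s p.1, T s p.2)) isClosed_closure (by simp [ht]) (by simp)
      ((MeasureTheory.ae_restrict_iff' measurableSet_Ioc).2
        (Filter.Eventually.of_forall fun s hs => hinv p hp s hs.1.le)) (hi1.prodMk hi2)
    rw [MeasureTheory.setAverage_eq, integral_pair hi1 hi2] at hmem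
    rw [← hint, intervalIntegral.integral_of_le ht.le, intervalIntegral.integral_of_le ht.le]
    simpa [MeasureTheory.measureReal_def, ht.le] using hmem
  intro p hp
  -- For fixed t > 0 both components depend continuously on the starting vector alone, so density
  -- extends `step1` to every vector; afterwards t → 0.
  have step2 : ∀ t, 0 < t →
      (t⁻¹ • ∫ s in (0 : ℝ)..t, T s p.1, t⁻¹ • (T t p.1 - p.1)) ∈ closure (G : Set (E × E)) := by
    intro t ht
    obtain ⟨u, hu, hup⟩ := mem_closure_iff_seq_limit.1 (hdense p.1)
    choose v hv using hu
    refine isClosed_closure.mem_of_tendsto (b := Filter.atTop)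
      (f := fun n => (t⁻¹ • ∫ s in (0 : ℝ)..t, T s (u n), t⁻¹ • (T t (u n) - u n)))
      (Filter.Tendsto.prodMk_nhds ?_ ?_) (Filter.Eventually.of_forall fun n => step1 _ (hv n) t ht)
    · refine Filter.Tendsto.const_smul ?_ _
      rw [tendsto_iff_norm_sub_tendsto_zero]
      have h2 : Filter.Tendsto (fun n => M * ‖u n - p.1‖ * |t - 0|) Filter.atTop (𝓝 0) := by
        have := ((tendsto_iff_norm_sub_tendsto_zero.1 hup).const_mul M).mul_const |t - 0|
        simpa using this
      refine squeeze_zero (fun _ => norm_nonneg _) (fun n => ?_) h2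
      rw [← intervalIntegral.integral_sub (hII _ ht.le) (hII _ ht.le)]
      refine intervalIntegral.norm_integral_le_of_norm_le_const fun s hs => ?_
      rw [Set.uIoc_of_le ht.le] at hs
      rw [← map_sub]
      exact h.norm_le s hs.1.le _
    · exact ((((T t).continuous.tendsto _).comp hup).sub hup).const_smul _
  refine isClosed_closure.mem_of_tendsto (b := 𝓝[>] (0 : ℝ))
    (f := fun t => (t⁻¹ • ∫ s in (0 : ℝ)..t, T s p.1, t⁻¹ • (T t p.1 - p.1)))
    (Filter.Tendsto.prodMk_nhds ?_ ?_) (by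
      filter_upwards [self_mem_nhdsWithin] with t ht
      exact step2 t ht)
  · rw [Metric.tendsto_nhds]
    intro ε hε
    obtain ⟨δ, hδ, h1⟩ := h.exists_norm_sub_le p.1 (ε := ε / 2) (by positivity)
    filter_upwards [Ioc_mem_nhdsGT hδ] with t ht
    rw [dist_eq_norm]
    have e : t⁻¹ • (∫ s in (0 : ℝ)..t, T s p.1) - p.1 =
        t⁻¹ • ∫ s in (0 : ℝ)..t, (T s p.1 - p.1) := by
      rw [intervalIntegral.integral_sub (hII _ ht.1.le) (by simp), intervalIntegral.integral_const,
        smul_sub, sub_zero, smul_smul, inv_mul_cancel₀ ht.1.ne', one_smul]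
    rw [e, norm_smul, Real.norm_of_nonneg (inv_nonneg.2 ht.1.le), inv_mul_lt_iff₀ ht.1]
    have h3 : ‖∫ s in (0 : ℝ)..t, (T s p.1 - p.1)‖ ≤ ε / 2 * |t - 0| := by
      refine intervalIntegral.norm_integral_le_of_norm_le_const fun s hs => ?_
      rw [Set.uIoc_of_le ht.1.le] at hs
      exact h1 s hs.1.le (hs.2.trans ht.2)
    rw [sub_zero, abs_of_pos ht.1] at h3
    nlinarith [ht.1]
  · refine Filter.Tendsto.congr (fun t => ?_) hp
    rw [Complex.coe_smul]

end IsBoundedSemigroup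

/-! ### Strong limits of semigroups and identification of a core -/

theorem cauchySeq_of_dense [CompleteSpace E] {S : ℕ → E →L[ℂ] E} {M : ℝ} (hM : 0 < M)
    (hS : ∀ N x, ‖S N x‖ ≤ M * ‖x‖) {D : Set E} (hD : Dense D)
    (h : ∀ x ∈ D, CauchySeq fun N => S N x) (x : E) : CauchySeq fun N => S N x := by
  rw [Metric.cauchySeq_iff']
  intro ε hε
  obtain ⟨y, hy, hxy⟩ := Metric.mem_closure_iff.1 (hD x) (ε / (4 * M)) (by positivity)
  obtain ⟨N, hN⟩ := Metric.cauchySeq_iff'.1 (h y hy) (ε / 4) (by positivity)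
  refine ⟨N, fun n hn => ?_⟩
  have h1 := hN n hn
  rw [dist_eq_norm] at h1 hxy ⊢
  have e : S n x - S N x = S n (x - y) + (S n y - S N y) - S N (x - y) := by
    simp only [map_sub]; abel
  rw [e]
  refine lt_of_le_of_lt (norm_sub_le _ _) ?_
  have h2 := norm_add_le (S n (x - y)) (S n y - S N y)
  have h3 := hS n (x - y)
  have h4 := hS N (x - y)
  have h5 : M * ‖x - y‖ < ε / 4 := by
    rw [lt_div_iff₀ (by positivity)] at hxy
    nlinarith
  linarith

theorem exists_limit_of_dense [CompleteSpace E] {S : ℕ → E →L[ℂ] E} {M : ℝ} (hM : 0 < M)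
    (hS : ∀ N x, ‖S N x‖ ≤ M * ‖x‖) {D : Set E} (hD : Dense D)
    (h : ∀ x ∈ D, CauchySeq fun N => S N x) :
    ∃ T : E →L[ℂ] E, ∀ x, Filter.Tendsto (fun N => S N x) Filter.atTop (𝓝 (T x)) := by
  have h1 : ∀ x, ∃ y, Filter.Tendsto (fun N => S N x) Filter.atTop (𝓝 y) := fun x =>
    cauchySeq_tendsto_of_complete (cauchySeq_of_dense hM hS hD h x)
  choose f hf using h1
  refine ⟨LinearMap.mkContinuous
    { toFun := f
      map_add' := fun x y => tendsto_nhds_unique (hf (x + y)) (by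
        simpa only [map_add] using (hf x).add (hf y))
      map_smul' := fun c x => tendsto_nhds_unique (hf (c • x)) (by
        simpa only [_root_.map_smul, RingHom.id_apply] using (hf x).const_smul c) } M fun x => ?_, hf⟩
  exact le_of_tendsto (hf x).norm (Filter.Eventually.of_forall fun N => hS N x)

/-- Convergence of semigroups of bounded operators whose generators eventually agree with a densely
defined operator with graph `G`, which is then a core for the generator of the limit. -/
theorem exists_semigroup_of_approximation [CompleteSpace E] {L : ℕ → E →L[ℂ] E} {M : ℝ}
    (hM : 0 < M) (hL : ∀ N t, 0 ≤ t → ∀ x, ‖expSG (L N) t x‖ ≤ M * ‖x‖)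
    {G : Submodule ℂ (E × E)} (hdense : Dense {x | ∃ y, (x, y) ∈ G})
    (heq : ∀ p ∈ G, ∀ᶠ N in Filter.atTop, L N p.1 = p.2)
    (hsnd : ∀ p ∈ G, ∃ y, (p.2, y) ∈ G)
    (hcauchy : ∀ p ∈ G, ∀ t, 0 ≤ t → CauchySeq fun N => expSG (L N) t p.1)
    (hcore : ∀ p ∈ G, ∀ t, 0 ≤ t → ∃ η : ℕ → E,
      (∀ᶠ N in Filter.atTop, (expSG (L N) t p.1, η N) ∈ G) ∧
      Filter.Tendsto (fun N => η N - L N (expSG (L N) t p.1)) Filter.atTop (𝓝 0)) :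
    ∃ T : ℝ → E →L[ℂ] E, IsBoundedSemigroup T M ∧
      (∀ t, 0 ≤ t → ∀ x, Filter.Tendsto (fun N => expSG (L N) t x) Filter.atTop (𝓝 (T t x))) ∧
      ClosureGenerates G T := by
  have hex : ∀ t, ∃ T : E →L[ℂ] E, 0 ≤ t →
      ∀ x, Filter.Tendsto (fun N => expSG (L N) t x) Filter.atTop (𝓝 (T x)) := fun t => by
    by_cases ht : 0 ≤ t
    · obtain ⟨T, hT⟩ := exists_limit_of_dense hM (fun N => hL N t ht) hdense
        (by rintro x ⟨y, hy⟩; exact hcauchy _ hy t ht)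
      exact ⟨T, fun _ => hT⟩
    · exact ⟨0, fun h => absurd h ht⟩
  choose T hT using hex
  have hTn : ∀ t, 0 ≤ t → ∀ x, ‖T t x‖ ≤ M * ‖x‖ := fun t ht x =>
    le_of_tendsto (hT t ht x).norm (Filter.Eventually.of_forall fun N => hL N t ht x)
  have hstep : ∀ N x t, 0 ≤ t → ‖expSG (L N) t x - x‖ ≤ M * ‖L N x‖ * t := by
    intro N x t ht
    have := norm_image_sub_le_of_norm_deriv_right_le_segment
      (f := fun s => expSG (L N) s x) (f' := fun s => expSG (L N) s (L N x)) (a := 0) (b := t)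
      (C := M * ‖L N x‖) (continuous_expSG _ _).continuousOn
      (fun s _ => (hasDerivAt_expSG (L N) x s).hasDerivWithinAt)
      (fun s hs => hL N s hs.1 _) t ⟨ht, le_rfl⟩
    simpa [expSG_zero] using this
  -- The operator maps its domain into itself, so p.2 can be differentiated once more. For large N
  -- the remainder is at most M‖z‖t², where z is the image of p.2; this is uniform in N and passes
  -- to the limit.
  have hquad : ∀ p ∈ G, ∃ C, 0 ≤ C ∧ ∀ t, 0 ≤ t → ‖T t p.1 - p.1 - t • p.2‖ ≤ C * t * t := by
    intro p hp
    obtain ⟨z, hz⟩ := hsnd p hp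
    refine ⟨M * ‖z‖, by positivity, fun t ht => ?_⟩
    refine le_of_tendsto (((hT t ht p.1).sub_const _).sub_const _).norm ?_
    filter_upwards [heq p hp, heq _ hz] with N h1 h2
    have := norm_image_sub_le_of_norm_deriv_right_le_segment
      (f := fun s => expSG (L N) s p.1 - s • p.2) (f' := fun s => expSG (L N) s (L N p.1) - p.2)
      (a := 0) (b := t) (C := M * ‖z‖ * t)
      ((continuous_expSG _ _).sub (by fun_prop)).continuousOn
      (fun s _ => by
        have h3 := (hasDerivAt_expSG (L N) p.1 s).sub ((hasDerivAt_id s).smul_const p.2)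
        rw [one_smul] at h3
        exact h3.hasDerivWithinAt)
      (fun s hs => by
        rw [h1]
        refine (hstep N p.2 s hs.1).trans ?_
        rw [h2]
        exact mul_le_mul_of_nonneg_left hs.2.le (by positivity)) t ⟨ht, le_rfl⟩
    simp only [zero_smul, sub_zero, expSG_zero, ContinuousLinearMap.id_apply] at this
    rwa [sub_right_comm] at this
  have hsg : IsBoundedSemigroup T M := by
    refine ⟨?_, ?_, hTn, ?_⟩
    · ext x
      refine tendsto_nhds_unique (hT 0 le_rfl x) ?_
      simp only [expSG_zero]
      exact tendsto_const_nhds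
    · intro s t hs ht
      ext x
      refine tendsto_nhds_unique (hT (s + t) (by positivity) x) ?_
      rw [ContinuousLinearMap.comp_apply]
      have h1 : Filter.Tendsto (fun N => expSG (L N) s (expSG (L N) t x - T t x)) Filter.atTop
          (𝓝 0) := by
        rw [tendsto_zero_iff_norm_tendsto_zero]
        have h2 := (tendsto_iff_norm_sub_tendsto_zero.1 (hT t ht x)).const_mul M
        rw [mul_zero] at h2
        exact squeeze_zero (fun _ => norm_nonneg _) (fun N => hL N s hs _) h2
      have h3 := h1.add (hT s hs (T t x))
      rw [zero_add] at h3
      refine h3.congr fun N => ?_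
      rw [expSG_add, ContinuousLinearMap.comp_apply, map_sub]
      abel
    · intro x
      rw [Metric.tendsto_nhds]
      intro ε hε
      obtain ⟨y, ⟨z, hyz⟩, hxy⟩ := Metric.mem_closure_iff.1 (hdense x) (ε / (4 * (M + 1)))
        (by positivity)
      obtain ⟨C, hC, h1⟩ := hquad _ hyz
      have h2 : Filter.Tendsto (fun t : ℝ => C * t * t + |t| * ‖z‖) (𝓝[>] 0) (𝓝 0) := by
        have : Continuous fun t : ℝ => C * t * t + |t| * ‖z‖ := by fun_prop
        simpa using (this.tendsto 0).mono_left nhdsWithin_le_nhds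
      filter_upwards [self_mem_nhdsWithin, h2.eventually (gt_mem_nhds (show 0 < ε / 4 by positivity))]
        with t ht ht2
      have ht0 : (0 : ℝ) ≤ t := le_of_lt ht
      rw [dist_eq_norm] at hxy ⊢
      have e : T t x - x = T t (x - y) + (T t y - y - t • z + t • z) - (x - y) := by
        rw [map_sub]; abel
      rw [e]
      have h3 := h1 t ht0
      simp only at h3
      have h4 := hTn t ht0 (x - y)
      have h5 : (M + 1) * ‖x - y‖ < ε / 4 := by
        rw [lt_div_iff₀ (by positivity)] at hxy
        nlinarith
      have h6 := norm_sub_le (T t (x - y) + (T t y - y - t • z + t • z)) (x - y)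
      have h7 := norm_add_le (T t (x - y)) (T t y - y - t • z + t • z)
      have h8 := norm_add_le (T t y - y - t • z) (t • z)
      rw [norm_smul, Real.norm_eq_abs] at h8
      linarith
  have hgen : (G : Set (E × E)) ⊆ generatorGraph T := by
    intro p hp
    obtain ⟨C, hC, h1⟩ := hquad p hp
    refine IsBoundedSemigroup.mem_generatorGraph_of_forall p fun ε hε =>
      ⟨ε / (C + 1), by positivity, fun t ht htδ => (h1 t ht.le).trans ?_⟩
    refine mul_le_mul_of_nonneg_right ?_ ht.le
    rw [le_div_iff₀ (by positivity)] at htδ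
    nlinarith
  refine ⟨T, hsg, hT, Set.Subset.antisymm ?_ ?_⟩
  · exact closure_minimal hgen (hsg.isClosed_generatorGraph hM)
  · refine hsg.generatorGraph_subset_closure hM hgen hdense fun p hp t ht => ?_
    -- The truncated orbits lie in the domain of `G` with images `η N`. These are close to L_N
    -- e^{tL_N} p.1 = e^{tL_N} p.2, hence converge to T t p.2.
    obtain ⟨η, hη, hη0⟩ := hcore p hp t ht
    refine mem_closure_of_tendsto (b := Filter.atTop)
      (f := fun N => (expSG (L N) t p.1, η N)) (Filter.Tendsto.prodMk_nhds (hT t ht p.1) ?_) hη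
    have h1 := hη0.add (hT t ht p.2)
    rw [zero_add] at h1
    refine h1.congr' ?_
    filter_upwards [heq p hp] with N hN
    have h2 : L N (expSG (L N) t p.1) = expSG (L N) t (L N p.1) :=
      (hasDerivAt_expSG' (L N) p.1 t).unique (hasDerivAt_expSG (L N) p.1 t)
    rw [h2, hN]
    abel

end Convergence


/-! ### Truncated Lindblad evolutions on Fock space -/

section Truncation

variable {V : Type*}

/-- The quadratic form of the diagonal operator `W` at a finite vector. -/
noncomputable def weight (W : (V → ℕ) → ℝ) (x : FiniteFock V) : ℝ :=
  ∑ n ∈ x.support, W n * ‖x n‖ ^ 2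

theorem weight_eq_sum (W : (V → ℕ) → ℝ) {x : FiniteFock V} {s : Finset (V → ℕ)}
    (hs : ∀ n, n ∉ s → x n = 0) : weight W x = ∑ n ∈ s, W n * ‖x n‖ ^ 2 := by
  refine Finset.sum_subset (fun n hn => ?_) fun n _ hn => ?_
  · by_contra h
    exact Finsupp.mem_support_iff.1 hn (hs n h)
  · rw [Finsupp.notMem_support_iff.1 hn]; simp

theorem weight_nonneg {W : (V → ℕ) → ℝ} (hW : ∀ n, 0 ≤ W n) (x : FiniteFock V) : 0 ≤ weight W x :=
  Finset.sum_nonneg fun n _ => mul_nonneg (hW n) (by positivity)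

theorem weight_mono {W Z : (V → ℕ) → ℝ} (h : ∀ n, W n ≤ Z n) (x : FiniteFock V) :
    weight W x ≤ weight Z x :=
  Finset.sum_le_sum fun n _ => mul_le_mul_of_nonneg_right (h n) (by positivity)

variable [DecidableEq V] [Fintype V]

theorem weight_eq_sum_box (W : (V → ℕ) → ℝ) {N : ℕ} {x : FiniteFock V} (hx : cut N x = x) :
    weight W x = ∑ n ∈ box V N, W n * ‖x n‖ ^ 2 :=
  weight_eq_sum W (cut_eq_self_iff.1 hx)

theorem FiniteFock.inner_incl_eq_sum {x y : FiniteFock V} {s : Finset (V → ℕ)}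
    (hs : ∀ n, n ∉ s → x n = 0) :
    ⟪x.incl, y.incl⟫_ℂ = ∑ n ∈ s, starRingEnd ℂ (x n) * y n := by
  rw [← (FockSpace.hasSum_inner_mul_inner x.incl y.incl).tsum_eq, tsum_eq_sum (s := s)]
  · refine Finset.sum_congr rfl fun n _ => ?_
    rw [← inner_conj_symm, inner_ket_incl, inner_ket_incl]
  · intro n hn
    rw [← inner_conj_symm, inner_ket_incl, hs n hn, map_zero, zero_mul]

theorem FiniteFock.inner_incl_cut (N : ℕ) (x y : FiniteFock V) :
    ⟪(cut N x).incl, y.incl⟫_ℂ = ⟪x.incl, (cut N y).incl⟫_ℂ := by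
  rw [inner_incl_eq_sum (s := box V N) fun n hn => by rw [cut_apply, if_neg hn],
    ← inner_conj_symm x.incl,
    inner_incl_eq_sum (s := box V N) fun n hn => by rw [cut_apply, if_neg hn], map_sum]
  refine Finset.sum_congr rfl fun n hn => ?_
  rw [cut_apply, if_pos hn, cut_apply, if_pos hn, map_mul, Complex.conj_conj, mul_comm]

theorem weight_one (x : FiniteFock V) : weight (fun _ => 1) x = ‖x.incl‖ ^ 2 := by
  have h := FiniteFock.inner_incl_eq_sum (x := x) (y := x) (s := x.support)
    fun n hn => Finsupp.notMem_support_iff.1 hn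
  rw [inner_self_eq_norm_sq_to_K] at h
  have h2 : ((‖x.incl‖ ^ 2 : ℝ) : ℂ) = ((weight (fun _ => 1) x : ℝ) : ℂ) := by
    rw [weight]
    push_cast
    refine Eq.trans ?_ (h.trans (Finset.sum_congr rfl fun n _ => ?_))
    · simp
    · rw [Complex.conj_mul', one_mul]
  exact_mod_cast h2.symm

theorem compress_incl_cut (N : ℕ) (M : Module.End ℂ (FiniteFock V)) (x : FiniteFock V) :
    compress N M x.incl = compress N M (cut N x).incl := by
  rw [compress_apply, compress_apply]
  refine Finset.sum_congr rfl fun n hn => ?_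
  rw [FiniteFock.inner_ket_incl, FiniteFock.inner_ket_incl, cut_apply, if_pos hn]

/-- The matrix element `X ↦ ⟪u, X v⟫` as a functional. -/
noncomputable def matrixElement (u v : FockSpace V) : TraceClass (FockSpace V) →L[ℂ] ℂ :=
  LinearMap.mkContinuous
    { toFun := fun X => ⟪u, X.toOp v⟫_ℂ
      map_add' := fun X Y => by rw [map_add, _root_.add_apply, inner_add_right]
      map_smul' := fun c X => by
        rw [TraceClass.toOp_smul, _root_.smul_apply, inner_smul_right]; rfl }
    (‖u‖ * ‖v‖) fun X => by
      have := X.norm_inner_le u v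
      simp only [LinearMap.coe_mk, AddHom.coe_mk]
      linarith

theorem matrixElement_apply (u v : FockSpace V) (X : TraceClass (FockSpace V)) :
    matrixElement u v X = ⟪u, X.toOp v⟫_ℂ := rfl

/-- The expectation of the diagonal operator `W`, compressed to the box of size `N`. -/
noncomputable def boxExpectation (N : ℕ) (W : (V → ℕ) → ℝ) : TraceClass (FockSpace V) →L[ℂ] ℂ :=
  ∑ n ∈ box V N, (W n : ℂ) • matrixElement (ket n) (ket n)

theorem boxExpectation_ketBra (N : ℕ) (W : (V → ℕ) → ℝ) (x y : FiniteFock V) :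
    boxExpectation N W (ketBra x.incl y.incl) =
      ∑ n ∈ box V N, (W n : ℂ) * (starRingEnd ℂ (y n) * x n) := by
  rw [boxExpectation, _root_.sum_apply]
  refine Finset.sum_congr rfl fun n _ => ?_
  rw [_root_.smul_apply, matrixElement_apply, toOp_ketBra, InnerProductSpace.rankOne_apply,
    inner_smul_right, FiniteFock.inner_ket_incl, ← inner_conj_symm, FiniteFock.inner_ket_incl,
    smul_eq_mul]

theorem boxExpectation_ketBra_self {N : ℕ} (W : (V → ℕ) → ℝ) {x : FiniteFock V} (hx : cut N x = x) :
    boxExpectation N W (ketBra x.incl x.incl) = (weight W x : ℂ) := by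
  rw [boxExpectation_ketBra, weight_eq_sum_box W hx]
  push_cast
  refine Finset.sum_congr rfl fun n _ => ?_
  rw [Complex.conj_mul']

/-- The value of the Lindblad operator with drift `G` and jumps `L` at `|x⟩⟨y|`. -/
noncomputable def driftLindblad {ι : Type*} [Fintype ι] (G : Module.End ℂ (FiniteFock V))
    (L : ι → Module.End ℂ (FiniteFock V)) (x y : FiniteFock V) : TraceClass (FockSpace V) :=
  ketBra (G x).incl y.incl + ketBra x.incl (G y).incl + ∑ j, ketBra (L j x).incl (L j y).incl

/-- The truncation of a Lindblad operator to the box of size `N`. -/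
noncomputable def truncLindblad {ι : Type*} [Fintype ι] (G : Module.End ℂ (FiniteFock V))
    (L : ι → Module.End ℂ (FiniteFock V)) (N : ℕ) :
    TraceClass (FockSpace V) →L[ℂ] TraceClass (FockSpace V) :=
  boundedLindblad (compress N G) fun j => compress N (L j)

/-- The rate of change of the expectation of `W` in the state `|x⟩⟨x|`. -/
noncomputable def momentRate {ι : Type*} [Fintype ι] (G : Module.End ℂ (FiniteFock V))
    (L : ι → Module.End ℂ (FiniteFock V)) (W : (V → ℕ) → ℝ) (x : FiniteFock V) : ℝ :=
  2 * (⟪(diagonal (fun n => (W n : ℂ)) x).incl, (G x).incl⟫_ℂ).re + ∑ j, weight W (L j x)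

/-- Trace preservation, and invariance of the boxes under the jump operators. -/
structure IsConservative {ι : Type*} [Fintype ι] (G : Module.End ℂ (FiniteFock V))
    (L : ι → Module.End ℂ (FiniteFock V)) : Prop where
  dissipative : ∀ x : FiniteFock V, ⟪x.incl, (G x).incl⟫_ℂ + ⟪(G x).incl, x.incl⟫_ℂ +
    ∑ j, ⟪(L j x).incl, (L j x).incl⟫_ℂ = 0
  cut_jump : ∀ N j (x : FiniteFock V), cut N x = x → cut N (L j x) = L j x

variable {ι : Type*} [Fintype ι] {G : Module.End ℂ (FiniteFock V)}
  {L : ι → Module.End ℂ (FiniteFock V)}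

theorem truncLindblad_ketBra (h : IsConservative G L) {N : ℕ} {x y : FiniteFock V}
    (hx : cut N x = x) (hy : cut N y = y) :
    truncLindblad G L N (ketBra x.incl y.incl) =
      ketBra (cut N (G x)).incl y.incl + ketBra x.incl (cut N (G y)).incl +
        ∑ j, ketBra (L j x).incl (L j y).incl := by
  rw [truncLindblad, boundedLindblad_ketBra]
  simp only [compress_incl _ hx, compress_incl _ hy, h.cut_jump N _ _ hx, h.cut_jump N _ _ hy]

theorem expSG_truncLindblad_isCompletelyPositive (N : ℕ) {t : ℝ} (ht : 0 ≤ t) :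
    IsCompletelyPositive (expSG (truncLindblad G L N) t) :=
  boundedLindblad_exp_isCompletelyPositive _ _ ht

/-- On box vectors, compression does not change the quadratic form of the drift, and the jumps stay
in the box; the dissipation identity is therefore inherited at `cut N x`. -/
theorem expSG_truncLindblad_tracePreserving (h : IsConservative G L) (N : ℕ) (t : ℝ)
    (X : TraceClass (FockSpace V)) :
    fockTrace (expSG (truncLindblad G L N) t X).toOp = fockTrace X.toOp := by
  refine boundedLindblad_exp_tracePreserving (fun x => ?_) t X
  simp only [compress_incl_cut N _ x, compress_incl _ (cut_cut N x), h.cut_jump N _ _ (cut_cut N x)]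
  rw [← FiniteFock.inner_incl_cut, ← inner_conj_symm _ (FiniteFock.incl x),
    ← FiniteFock.inner_incl_cut, inner_conj_symm]
  exact h.dissipative (cut N x)

theorem norm_expSG_truncLindblad_le (h : IsConservative G L) (N : ℕ) (t : ℝ) (ht : 0 ≤ t)
    (X : TraceClass (FockSpace V)) : ‖expSG (truncLindblad G L N) t X‖ ≤ 8 * ‖X‖ :=
  norm_le_of_positive_of_tracePreserving (expSG_truncLindblad_isCompletelyPositive N ht)
    (expSG_truncLindblad_tracePreserving h N t) X

theorem adjoint_compress_ket {N : ℕ} (M : Module.End ℂ (FiniteFock V)) {n : V → ℕ}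
    (hn : n ∉ box V N) : (compress N M).adjoint (ket n) = 0 :=
  ext_inner_right ℂ fun z => by
    rw [ContinuousLinearMap.adjoint_inner_left, inner_ket_compress M hn, inner_zero_left]

theorem isPositive_ketBra_self {H : Type*} [NormedAddCommGroup H] [InnerProductSpace ℂ H] (x : H) :
    (ketBra x x).toOp.IsPositive := by
  rw [toOp_ketBra]
  exact InnerProductSpace.isPositive_rankOne_self x

/-- The truncated evolution of a pure state in the box is a mixture of pure states in the box. -/
theorem exists_expSG_truncLindblad_eq_sum (h : IsConservative G L) {N : ℕ} {x : FiniteFock V}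
    (hx : cut N x = x) {t : ℝ} (ht : 0 ≤ t) :
    ∃ y : (V → ℕ) → FiniteFock V, (∀ n, cut N (y n) = y n) ∧
      expSG (truncLindblad G L N) t (ketBra x.incl x.incl) =
        ∑ n ∈ box V N, ketBra (y n).incl (y n).incl ∧
      ∑ n ∈ box V N, ‖(y n).incl‖ ^ 2 = ‖x.incl‖ ^ 2 := by
  have hpos := (expSG_truncLindblad_isCompletelyPositive (G := G) (L := L) N ht).map_isPositive
    (isPositive_ketBra_self x.incl)
  obtain ⟨y, hy, hyX⟩ := TraceClass.exists_eq_sum_ketBra hpos (N := N) fun n hn => by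
    -- The truncated generator has no diagonal entries outside the box, so those entries of the
    -- evolved operator keep their initial value 0. By positivity the whole operator then lives in
    -- the box.
    have h0 : ∀ X, matrixElement (ket n) (ket n) (truncLindblad G L N X) = 0 := fun X => by
      rw [matrixElement_apply, truncLindblad, inner_boundedLindblad, adjoint_compress_ket _ hn]
      simp only [adjoint_compress_ket _ hn, inner_zero_left, map_zero, inner_zero_right,
        Finset.sum_const_zero, add_zero]
    have := expSG_functional_eq h0 t (ketBra x.incl x.incl)
    rw [matrixElement_apply, matrixElement_apply] at this
    rw [this, toOp_ketBra, InnerProductSpace.rankOne_apply, inner_smul_right,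
      FiniteFock.inner_ket_incl, cut_eq_self_iff.1 hx n hn, mul_zero]
  refine ⟨y, hy, hyX, ?_⟩
  have h1 := expSG_truncLindblad_tracePreserving h N t (ketBra x.incl x.incl)
  rw [hyX, ← traceAgainst_id, map_sum] at h1
  simp only [traceAgainst_id, fockTrace_ketBra, inner_self_eq_norm_sq_to_K] at h1
  exact_mod_cast h1

theorem boxExpectation_truncLindblad (h : IsConservative G L) {N : ℕ} {x : FiniteFock V}
    (hx : cut N x = x) (W : (V → ℕ) → ℝ) :
    (boxExpectation N W (truncLindblad G L N (ketBra x.incl x.incl))).re = momentRate G L W x := by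
  rw [truncLindblad_ketBra h hx hx, map_add, map_add, map_sum, momentRate]
  have hd : ∀ n, n ∉ box V N → diagonal (fun n => (W n : ℂ)) x n = 0 := fun n hn => by
    rw [diagonal_apply, cut_eq_self_iff.1 hx n hn, mul_zero]
  simp only [boxExpectation_ketBra_self W (h.cut_jump N _ _ hx), Complex.add_re, Complex.re_sum,
    Complex.ofReal_re, boxExpectation_ketBra]
  congr 1
  rw [FiniteFock.inner_incl_eq_sum hd, Complex.re_sum, two_mul, ← Finset.sum_add_distrib,
    ← Finset.sum_add_distrib]
  refine Finset.sum_congr rfl fun n hn => ?_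
  rw [cut_apply, if_pos hn, diagonal_apply, map_mul, Complex.conj_ofReal]
  simp only [Complex.mul_re, Complex.mul_im, Complex.conj_re, Complex.conj_im, Complex.ofReal_re,
    Complex.ofReal_im]
  ring

/-- Differential inequality for the expectation of `W` along the truncated evolution. -/
theorem exists_hasDerivAt_boxExpectation (h : IsConservative G L) {N : ℕ} {x : FiniteFock V}
    (hx : cut N x = x) {W Z : (V → ℕ) → ℝ}
    (hWZ : ∀ x : FiniteFock V, momentRate G L W x ≤ weight Z x) {t : ℝ} (ht : 0 ≤ t) :
    ∃ e, HasDerivAt (fun s => (boxExpectation N W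
        (expSG (truncLindblad G L N) s (ketBra x.incl x.incl))).re) e t ∧
      e ≤ (boxExpectation N Z (expSG (truncLindblad G L N) t (ketBra x.incl x.incl))).re := by
  have hd := hasDerivAt_expSG' (truncLindblad G L N) (ketBra x.incl x.incl) t
  have h1 := (Complex.reCLM.hasFDerivAt.comp_hasDerivAt t
    (((boxExpectation N W).restrictScalars ℝ).hasFDerivAt.comp_hasDerivAt t hd))
  refine ⟨_, h1, ?_⟩
  obtain ⟨y, hy, hyX, -⟩ := exists_expSG_truncLindblad_eq_sum h hx ht
  change (boxExpectation N W _).re ≤ _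
  rw [hyX, map_sum, map_sum, map_sum, Complex.re_sum, Complex.re_sum]
  refine Finset.sum_le_sum fun n _ => ?_
  rw [boxExpectation_truncLindblad h (hy n), boxExpectation_ketBra_self Z (hy n), Complex.ofReal_re]
  exact hWZ (y n)

/-- Cauchy-Schwarz for mixtures of rank-one operators. -/
theorem sum_mul_norm_le_sqrt {κ : Type*} (s : Finset κ) {f g : κ → ℝ} {a b : ℝ}
    (ha : ∑ i ∈ s, f i ^ 2 ≤ a) (hb : ∑ i ∈ s, g i ^ 2 ≤ b) :
    ∑ i ∈ s, f i * g i ≤ √(a * b) := by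
  apply Real.le_sqrt_of_sq_le
  refine (Finset.sum_mul_sq_le_sq_mul_sq _ _ _).trans ?_
  exact mul_le_mul ha hb (Finset.sum_nonneg fun i _ => by positivity)
    ((Finset.sum_nonneg fun i _ => by positivity).trans ha)

end Truncation


/-! ### Generation of quantum Markov semigroups on Fock space -/

section Generation

/-- The rank-one operators as a sesquilinear map. -/
noncomputable def ketBraₛ (H : Type*) [NormedAddCommGroup H] [InnerProductSpace ℂ H] :
    H →ₗ[ℂ] H →ₛₗ[starRingEnd ℂ] TraceClass H :=
  LinearMap.mk₂'ₛₗ (RingHom.id ℂ) (starRingEnd ℂ) ketBra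
    (fun x x' y => TraceClass.toOp_injective <| by simp [toOp_ketBra])
    (fun c x y => TraceClass.toOp_injective <| by simp [toOp_ketBra])
    (fun x y y' => TraceClass.toOp_injective <| by simp [toOp_ketBra])
    (fun c x y => TraceClass.toOp_injective <| by simp [toOp_ketBra])

theorem ketBraₛ_apply {H : Type*} [NormedAddCommGroup H] [InnerProductSpace ℂ H] (x y : H) :
    ketBraₛ H x y = ketBra x y := rfl

theorem sesquilinear_polarization {M E : Type*} [AddCommGroup M] [Module ℂ M] [AddCommGroup E]
    [Module ℂ E] (B : M →ₗ[ℂ] M →ₛₗ[starRingEnd ℂ] E) (x y : M) :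
    B x y = (1 / 4 : ℂ) • (B (x + y) (x + y) - B (x - y) (x - y) +
      Complex.I • B (x + Complex.I • y) (x + Complex.I • y) -
      Complex.I • B (x - Complex.I • y) (x - Complex.I • y)) := by
  simp only [map_add, map_sub, LinearMap.add_apply, LinearMap.sub_apply, _root_.map_smul,
    LinearMap.map_smulₛₗ, LinearMap.smul_apply, Complex.conj_I, smul_add, smul_sub, smul_smul]
  have h : Complex.I * -Complex.I = 1 := by rw [mul_neg, Complex.I_mul_I, neg_neg]
  simp only [h, Complex.I_mul_I]
  module

/-- The sesquilinear map `(x, y) ↦ |f x⟩⟨g y|`. -/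
noncomputable def ketBraMap {M H : Type*} [AddCommGroup M] [Module ℂ M] [NormedAddCommGroup H]
    [InnerProductSpace ℂ H] (f g : M →ₗ[ℂ] H) : M →ₗ[ℂ] M →ₛₗ[starRingEnd ℂ] TraceClass H :=
  LinearMap.mk₂'ₛₗ (RingHom.id ℂ) (starRingEnd ℂ) (fun x y => ketBraₛ H (f x) (g y))
    (fun x x' y => by simp only [map_add, LinearMap.add_apply])
    (fun c x y => by simp only [_root_.map_smul, LinearMap.smul_apply, RingHom.id_apply])
    (fun x y y' => by simp only [map_add])
    (fun c x y => by simp only [_root_.map_smul, LinearMap.map_smulₛₗ])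

theorem ketBraMap_apply {M H : Type*} [AddCommGroup M] [Module ℂ M] [NormedAddCommGroup H]
    [InnerProductSpace ℂ H] (f g : M →ₗ[ℂ] H) (x y : M) :
    ketBraMap f g x y = ketBra (f x) (g y) := rfl

variable {V : Type*} [DecidableEq V] [Fintype V] {ι : Type*} [Fintype ι]

/-- The Lindblad operator as a sesquilinear map. -/
noncomputable def driftLindbladₛ (G : Module.End ℂ (FiniteFock V))
    (L : ι → Module.End ℂ (FiniteFock V)) :
    FiniteFock V →ₗ[ℂ] FiniteFock V →ₛₗ[starRingEnd ℂ] TraceClass (FockSpace V) :=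
  ketBraMap (FiniteFock.incl ∘ₗ G) FiniteFock.incl +
    ketBraMap FiniteFock.incl (FiniteFock.incl ∘ₗ G) +
    ∑ j, ketBraMap (FiniteFock.incl ∘ₗ L j) (FiniteFock.incl ∘ₗ L j)

theorem driftLindbladₛ_apply (G : Module.End ℂ (FiniteFock V))
    (L : ι → Module.End ℂ (FiniteFock V)) (x y : FiniteFock V) :
    driftLindbladₛ G L x y = driftLindblad G L x y := by
  simp [driftLindbladₛ, driftLindblad, ketBraMap_apply]

/-- The graph of the Lindblad operator with drift `G` and jumps `L` on finite-rank operators. -/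
noncomputable def driftGraph (G : Module.End ℂ (FiniteFock V))
    (L : ι → Module.End ℂ (FiniteFock V)) :
    Submodule ℂ (TraceClass (FockSpace V) × TraceClass (FockSpace V)) :=
  Submodule.span ℂ (Set.range fun p : FiniteFock V × FiniteFock V =>
    (ketBra p.1.incl p.2.incl, driftLindblad G L p.1 p.2))

/-- Polarization of a sesquilinear map. It reduces every later verification to |x⟩⟨x|, where
positivity and moments are available. -/
theorem driftGraph_eq_span (G : Module.End ℂ (FiniteFock V))
    (L : ι → Module.End ℂ (FiniteFock V)) :
    driftGraph G L = Submodule.span ℂ (Set.range fun x : FiniteFock V =>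
      (ketBra x.incl x.incl, driftLindblad G L x x)) := by
  apply le_antisymm
  · rw [driftGraph, Submodule.span_le]
    rintro _ ⟨⟨x, y⟩, rfl⟩
    have hp : ((ketBra x.incl y.incl, driftLindblad G L x y) :
        TraceClass (FockSpace V) × TraceClass (FockSpace V)) =
        (1 / 4 : ℂ) • ((ketBra (x + y).incl (x + y).incl, driftLindblad G L (x + y) (x + y)) -
          (ketBra (x - y).incl (x - y).incl, driftLindblad G L (x - y) (x - y)) +
          Complex.I • (ketBra (x + Complex.I • y).incl (x + Complex.I • y).incl,
            driftLindblad G L (x + Complex.I • y) (x + Complex.I • y)) -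
          Complex.I • (ketBra (x - Complex.I • y).incl (x - Complex.I • y).incl,
            driftLindblad G L (x - Complex.I • y) (x - Complex.I • y))) := by
      refine Prod.ext ?_ ?_
      · have := sesquilinear_polarization
          (ketBraMap FiniteFock.incl FiniteFock.incl) x y
        simp only [ketBraMap_apply] at this
        exact this
      · have := sesquilinear_polarization (driftLindbladₛ G L) x y
        simp only [driftLindbladₛ_apply] at this
        exact this
    have hm : ∀ z : FiniteFock V, ((ketBra z.incl z.incl, driftLindblad G L z z) :
        TraceClass (FockSpace V) × TraceClass (FockSpace V)) ∈
        Submodule.span ℂ (Set.range fun x : FiniteFock V =>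
          (ketBra x.incl x.incl, driftLindblad G L x x)) :=
      fun z => Submodule.subset_span ⟨z, rfl⟩
    simp only [SetLike.mem_coe]
    rw [hp]
    exact Submodule.smul_mem _ _ (Submodule.sub_mem _ (Submodule.add_mem _
      (Submodule.sub_mem _ (hm _) (hm _)) (Submodule.smul_mem _ _ (hm _)))
      (Submodule.smul_mem _ _ (hm _)))
  · rw [Submodule.span_le]
    rintro _ ⟨x, rfl⟩
    exact Submodule.subset_span ⟨(x, x), rfl⟩

/-- A weight `W` whose expectation grows at most exponentially, and which controls the part of the
drift that leaves the boxes. -/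
structure HasMomentBound (G : Module.End ℂ (FiniteFock V)) (L : ι → Module.End ℂ (FiniteFock V))
    (W : (V → ℕ) → ℝ) (ω C : ℝ) : Prop where
  growth_nonneg : 0 ≤ ω
  leak_nonneg : 0 ≤ C
  nonneg : ∀ n, 0 ≤ W n
  rate_le : ∀ x : FiniteFock V, momentRate G L W x ≤ weight (fun n => ω * W n) x
  leak_le : ∀ N (x : FiniteFock V), cut N x = x →
    ‖(G x - cut N (G x)).incl‖ ^ 2 ≤ C / (N + 1) * weight W x

variable {G : Module.End ℂ (FiniteFock V)} {L : ι → Module.End ℂ (FiniteFock V)}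
  {W : (V → ℕ) → ℝ} {ω C : ℝ}

/-- Gronwall: e^{-ωt} times the expectation is nonincreasing. The bound does not depend on the box.
-/
theorem boxExpectation_expSG_le (h : IsConservative G L) (hm : HasMomentBound G L W ω C) {N : ℕ}
    {x : FiniteFock V} (hx : cut N x = x) {t : ℝ} (ht : 0 ≤ t) :
    (boxExpectation N W (expSG (truncLindblad G L N) t (ketBra x.incl x.incl))).re ≤
      Real.exp (ω * t) * weight W x := by
  set E : ℝ → ℝ := fun s =>
    (boxExpectation N W (expSG (truncLindblad G L N) s (ketBra x.incl x.incl))).re with hE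
  have hZ : ∀ X, (boxExpectation N (fun n => ω * W n) X).re = ω * (boxExpectation N W X).re := by
    intro X
    simp only [boxExpectation, _root_.sum_apply, _root_.smul_apply, Complex.re_sum, Finset.mul_sum,
      smul_eq_mul, Complex.re_ofReal_mul, mul_assoc]
  have hd : ∀ s, 0 ≤ s → ∃ e, HasDerivAt E e s ∧ e ≤ ω * E s := fun s hs => by
    obtain ⟨e, he, hle⟩ := exists_hasDerivAt_boxExpectation h hx hm.rate_le hs
    exact ⟨e, he, by rwa [hZ] at hle⟩
  have hfd : ∀ s, 0 ≤ s → ∃ e, HasDerivAt (fun s => Real.exp (-ω * s) * E s) e s ∧ e ≤ 0 := by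
    intro s hs
    obtain ⟨e, he, hle⟩ := hd s hs
    have h1 : HasDerivAt (fun s => Real.exp (-ω * s)) (Real.exp (-ω * s) * (-ω)) s := by
      simpa using ((hasDerivAt_id s).const_mul (-ω)).exp
    refine ⟨_, h1.mul he, ?_⟩
    have : Real.exp (-ω * s) * -ω * E s + Real.exp (-ω * s) * e =
        Real.exp (-ω * s) * (e - ω * E s) := by ring
    rw [this]
    exact mul_nonpos_of_nonneg_of_nonpos (Real.exp_pos _).le (by linarith)
  have hanti : AntitoneOn (fun s => Real.exp (-ω * s) * E s) (Set.Ici 0) := by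
    refine antitoneOn_of_deriv_nonpos (convex_Ici 0) (fun s hs => ?_) (fun s hs => ?_) fun s hs => ?_
    · obtain ⟨e, he, -⟩ := hfd s hs
      exact he.continuousAt.continuousWithinAt
    · rw [interior_Ici] at hs
      obtain ⟨e, he, -⟩ := hfd s (le_of_lt hs)
      exact he.differentiableAt.differentiableWithinAt
    · rw [interior_Ici] at hs
      obtain ⟨e, he, hle⟩ := hfd s (le_of_lt hs)
      rw [he.deriv]
      exact hle
  have h2 := hanti (Set.mem_Ici.2 le_rfl) (Set.mem_Ici.2 ht) ht
  have h0 : E 0 = weight W x := by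
    simp only [hE, expSG_zero, ContinuousLinearMap.id_apply, boxExpectation_ketBra_self W hx,
      Complex.ofReal_re]
  simp only [mul_zero, Real.exp_zero, one_mul, h0] at h2
  have h3 : E t = Real.exp (ω * t) * (Real.exp (-ω * t) * E t) := by
    rw [← mul_assoc, ← Real.exp_add]
    simp
  change E t ≤ _
  rw [h3]
  exact mul_le_mul_of_nonneg_left h2 (Real.exp_pos _).le

/-- The size of the part of the drift that leaves the box, along the truncated evolution. -/
noncomputable def leakBound (W : (V → ℕ) → ℝ) (ω C : ℝ) (x : FiniteFock V) (t : ℝ) (N : ℕ) : ℝ :=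
  √(C / (N + 1) * (Real.exp (ω * t) * weight W x) * ‖x.incl‖ ^ 2)

theorem tendsto_leakBound (W : (V → ℕ) → ℝ) (ω C : ℝ) (x : FiniteFock V) (t : ℝ) :
    Filter.Tendsto (leakBound W ω C x t) Filter.atTop (𝓝 0) := by
  have h1 : Filter.Tendsto (fun N : ℕ => C / ((N : ℝ) + 1)) Filter.atTop (𝓝 0) := by
    have := (tendsto_one_div_add_atTop_nhds_zero_nat (𝕜 := ℝ)).const_mul C
    simpa only [mul_one_div, mul_zero] using this
  have h2 := (Real.continuous_sqrt.tendsto _).comp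
    ((h1.mul_const (Real.exp (ω * t) * weight W x)).mul_const (‖x.incl‖ ^ 2))
  rw [zero_mul, zero_mul, Real.sqrt_zero] at h2
  exact h2

theorem leakBound_mono (hm : HasMomentBound G L W ω C) (x : FiniteFock V) {s t : ℝ} (hst : s ≤ t)
    (N : ℕ) : leakBound W ω C x s N ≤ leakBound W ω C x t N := by
  have h1 := hm.leak_nonneg
  have h2 := weight_nonneg hm.nonneg x
  have h3 := mul_le_mul_of_nonneg_left hst hm.growth_nonneg
  unfold leakBound
  gcongr

/-- Cauchy-Schwarz over the mixture: the squared leaks sum to at most C/(N + 1) times the moment,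
and the squared norms sum to the conserved trace. -/
theorem sum_leak_le (h : IsConservative G L) (hm : HasMomentBound G L W ω C) {N : ℕ}
    {x : FiniteFock V} (hx : cut N x = x) {t : ℝ} (ht : 0 ≤ t)
    {y : (V → ℕ) → FiniteFock V} (hy : ∀ n, cut N (y n) = y n)
    (hyX : expSG (truncLindblad G L N) t (ketBra x.incl x.incl) =
        ∑ n ∈ box V N, ketBra (y n).incl (y n).incl)
    (hyn : ∑ n ∈ box V N, ‖(y n).incl‖ ^ 2 = ‖x.incl‖ ^ 2) :
    ∑ n ∈ box V N, ‖(G (y n) - cut N (G (y n))).incl‖ * ‖(y n).incl‖ ≤ leakBound W ω C x t N := by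
  have h1 := boxExpectation_expSG_le h hm hx ht
  rw [hyX, map_sum, Complex.re_sum] at h1
  simp only [boxExpectation_ketBra_self W (hy _), Complex.ofReal_re] at h1
  refine sum_mul_norm_le_sqrt _ ?_ hyn.le
  refine (Finset.sum_le_sum fun n _ => hm.leak_le N (y n) (hy n)).trans ?_
  rw [← Finset.mul_sum]
  exact mul_le_mul_of_nonneg_left h1 (div_nonneg hm.leak_nonneg (by positivity))

theorem norm_incl_cut_le (N : ℕ) (x : FiniteFock V) : ‖(cut N x).incl‖ ≤ ‖x.incl‖ := by
  have h1 := weight_one (cut N x)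
  rw [weight_eq_sum_box _ (cut_cut N x)] at h1
  refine le_of_sq_le_sq ?_ (norm_nonneg _)
  rw [← h1, ← weight_one x]
  obtain ⟨M, hM⟩ := exists_cut_eq_self x
  rw [weight_eq_sum_box _ (cut_eq_self_mono (le_max_right N M) hM)]
  refine le_trans (Finset.sum_le_sum fun n hn => ?_)
    (Finset.sum_le_sum_of_subset_of_nonneg (box_mono (le_max_left N M)) fun _ _ _ => by positivity)
  rw [cut_apply, if_pos hn]

theorem norm_ketBra_add_le (u y : FockSpace V) : ‖ketBra u y + ketBra y u‖ ≤ 2 * (‖u‖ * ‖y‖) := by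
  have h1 := norm_ketBra_le u y
  have h2 := norm_ketBra_le y u
  have h3 := norm_add_le (ketBra u y) (ketBra y u)
  linarith

/-- On vectors in the smaller box the jump terms coincide. Only the drift differs, by the part that
leaves the smaller box but not the larger one. -/
theorem truncLindblad_sub (h : IsConservative G L) {N M : ℕ} (hNM : N ≤ M) {y : FiniteFock V}
    (hy : cut N y = y) :
    ‖(truncLindblad G L N - truncLindblad G L M) (ketBra y.incl y.incl)‖ ≤
      2 * (‖(G y - cut N (G y)).incl‖ * ‖y.incl‖) := by
  have e : (truncLindblad G L N - truncLindblad G L M) (ketBra y.incl y.incl) =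
      -(ketBra (cut M (G y - cut N (G y))).incl y.incl +
        ketBra y.incl (cut M (G y - cut N (G y))).incl) := by
    rw [_root_.sub_apply, truncLindblad_ketBra h hy hy, truncLindblad_ketBra h
      (cut_eq_self_mono hNM hy) (cut_eq_self_mono hNM hy), map_sub (cut M),
      cut_eq_self_mono hNM (cut_cut N _), map_sub]
    simp only [← ketBraₛ_apply, map_sub, LinearMap.sub_apply]
    abel
  rw [e, norm_neg]
  refine (norm_ketBra_add_le _ _).trans ?_
  gcongr
  exact norm_incl_cut_le M _

theorem norm_driftLindblad_sub_le (h : IsConservative G L) {N : ℕ} {y : FiniteFock V}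
    (hy : cut N y = y) :
    ‖driftLindblad G L y y - truncLindblad G L N (ketBra y.incl y.incl)‖ ≤
      2 * (‖(G y - cut N (G y)).incl‖ * ‖y.incl‖) := by
  have e : driftLindblad G L y y - truncLindblad G L N (ketBra y.incl y.incl) =
      ketBra (G y - cut N (G y)).incl y.incl + ketBra y.incl (G y - cut N (G y)).incl := by
    rw [truncLindblad_ketBra h hy hy, driftLindblad, map_sub]
    simp only [← ketBraₛ_apply, map_sub, LinearMap.sub_apply]
    abel
  rw [e]
  exact norm_ketBra_add_le _ _

/-- Duhamel's formula between the two truncations: 8 bounds the outer semigroup and 2 comes from the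
two drift terms. The orbit at time s is a mixture of vectors in the smaller box, so the leak
estimate applies to it. -/
theorem norm_expSG_trunc_sub_le (h : IsConservative G L) (hm : HasMomentBound G L W ω C)
    {N M : ℕ} (hNM : N ≤ M) {x : FiniteFock V} (hx : cut N x = x) {t : ℝ} (ht : 0 ≤ t) :
    ‖expSG (truncLindblad G L N) t (ketBra x.incl x.incl) -
      expSG (truncLindblad G L M) t (ketBra x.incl x.incl)‖ ≤ 16 * leakBound W ω C x t N * t := by
  have := norm_image_sub_le_of_norm_deriv_right_le_segment
    (f := fun s => expSG (truncLindblad G L M) (t - s)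
      (expSG (truncLindblad G L N) s (ketBra x.incl x.incl))) (a := 0) (b := t)
    (C := 16 * leakBound W ω C x t N)
    (fun s _ => (hasDerivAt_expSG_comp _ _ _ t s).continuousAt.continuousWithinAt)
    (fun s _ => (hasDerivAt_expSG_comp _ _ _ t s).hasDerivWithinAt)
    (fun s hs => by
      refine (norm_expSG_truncLindblad_le h M (t - s) (by linarith [hs.2]) _).trans ?_
      obtain ⟨y, hy, hyX, hyn⟩ := exists_expSG_truncLindblad_eq_sum h hx hs.1
      have h1 := sum_leak_le h hm hx hs.1 hy hyX hyn
      have h2 := leakBound_mono hm x hs.2.le N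
      rw [hyX, map_sum]
      have h3 : ‖∑ n ∈ box V N, (truncLindblad G L N - truncLindblad G L M)
          (ketBra (y n).incl (y n).incl)‖ ≤ 2 * ∑ n ∈ box V N,
            ‖(G (y n) - cut N (G (y n))).incl‖ * ‖(y n).incl‖ := by
        rw [Finset.mul_sum]
        exact norm_sum_le_of_le _ fun n _ => truncLindblad_sub h hNM (hy n)
      linarith) t ⟨ht, le_rfl⟩
  simpa [expSG_zero] using this

theorem cauchySeq_expSG_trunc (h : IsConservative G L) (hm : HasMomentBound G L W ω C)
    (x : FiniteFock V) {t : ℝ} (ht : 0 ≤ t) :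
    CauchySeq fun N => expSG (truncLindblad G L N) t (ketBra x.incl x.incl) := by
  obtain ⟨N₀, hN₀⟩ := exists_cut_eq_self x
  rw [Metric.cauchySeq_iff']
  intro ε hε
  have h1 : Filter.Tendsto (fun N => 16 * leakBound W ω C x t N * t) Filter.atTop (𝓝 0) := by
    simpa using ((tendsto_leakBound W ω C x t).const_mul 16).mul_const t
  obtain ⟨N, hN1, hN2⟩ := ((h1.eventually (gt_mem_nhds hε)).and
    (Filter.eventually_ge_atTop N₀)).exists
  refine ⟨N, fun M hM => ?_⟩
  rw [dist_eq_norm, norm_sub_rev]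
  exact lt_of_le_of_lt (norm_expSG_trunc_sub_le h hm hM (cut_eq_self_mono hN2 hN₀) ht) hN1

/-- Approximate invariance of a graph under a sequence of operators may be checked on a spanning
set. -/
theorem exists_approximation_of_mem_span {E : Type*} [NormedAddCommGroup E] [NormedSpace ℂ E]
    (K F : ℕ → E →L[ℂ] E) (G : Submodule ℂ (E × E)) {s : Set (E × E)}
    (h : ∀ p ∈ s, ∃ η : ℕ → E, (∀ᶠ N in Filter.atTop, (F N p.1, η N) ∈ G) ∧
      Filter.Tendsto (fun N => η N - K N (F N p.1)) Filter.atTop (𝓝 0)) :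
    ∀ p ∈ Submodule.span ℂ s, ∃ η : ℕ → E, (∀ᶠ N in Filter.atTop, (F N p.1, η N) ∈ G) ∧
      Filter.Tendsto (fun N => η N - K N (F N p.1)) Filter.atTop (𝓝 0) := by
  intro p hp
  induction hp using Submodule.span_induction with
  | mem p hp => exact h p hp
  | zero =>
    refine ⟨fun _ => 0, Filter.Eventually.of_forall fun N => ?_, ?_⟩
    · simp only [Prod.fst_zero, map_zero]
      exact Submodule.zero_mem _
    · simp
  | add p q _ _ hp hq =>
    obtain ⟨z, hz1, hz2⟩ := hp
    obtain ⟨w, hw1, hw2⟩ := hq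
    refine ⟨fun N => z N + w N, ?_, ?_⟩
    · filter_upwards [hz1, hw1] with N h1 h2
      rw [Prod.fst_add, map_add]
      exact Submodule.add_mem _ h1 h2
    · have := hz2.add hw2
      rw [add_zero] at this
      refine this.congr fun N => ?_
      rw [Prod.fst_add, map_add, map_add, add_sub_add_comm]
  | smul c p _ hp =>
    obtain ⟨z, hz1, hz2⟩ := hp
    refine ⟨fun N => c • z N, ?_, ?_⟩
    · filter_upwards [hz1] with N h1
      rw [Prod.smul_fst, _root_.map_smul]
      exact Submodule.smul_mem _ c h1
    · have := hz2.const_smul c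
      rw [smul_zero] at this
      refine this.congr fun N => ?_
      rw [Prod.smul_fst, _root_.map_smul, _root_.map_smul, smul_sub]

/-- Generation theorem: under a moment bound, the closure of the Lindblad operator on the finite-rank
operators generates a quantum Markov semigroup, the limit of the truncated evolutions. -/
theorem exists_isQMS_of_hasMomentBound (h : IsConservative G L) (hm : HasMomentBound G L W ω C) :
    ∃ T : ℝ → TraceClass (FockSpace V) →L[ℂ] TraceClass (FockSpace V), IsQMS T ∧
      ClosureGenerates (driftGraph G L) T ∧
      ∀ t, 0 ≤ t → ∀ X, Filter.Tendsto (fun N => expSG (truncLindblad G L N) t X) Filter.atTop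
        (𝓝 (T t X)) := by
  have hfst : ∀ x y : FiniteFock V, ∃ z, (ketBra x.incl y.incl, z) ∈ driftGraph G L :=
    fun x y => ⟨_, Submodule.subset_span ⟨(x, y), rfl⟩⟩
  have hfin : ∀ X ∈ finiteRank V, ∃ z, (X, z) ∈ driftGraph G L := by
    intro X hX
    induction hX using Submodule.span_induction with
    | mem X hX => obtain ⟨x, rfl⟩ := hX; exact hfst x x
    | zero => exact ⟨0, Submodule.zero_mem _⟩
    | add X Y _ _ hX hY =>
      obtain ⟨z, hz⟩ := hX
      obtain ⟨w, hw⟩ := hY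
      exact ⟨z + w, Submodule.add_mem _ hz hw⟩
    | smul c X _ hX =>
      obtain ⟨z, hz⟩ := hX
      exact ⟨c • z, Submodule.smul_mem _ c hz⟩
  have hspan : ∀ {Q : TraceClass (FockSpace V) × TraceClass (FockSpace V) → Prop},
      (∀ x : FiniteFock V, Q (ketBra x.incl x.incl, driftLindblad G L x x)) → Q 0 →
      (∀ p q, Q p → Q q → Q (p + q)) → (∀ (c : ℂ) p, Q p → Q (c • p)) →
      ∀ p ∈ driftGraph G L, Q p := by
    intro Q h1 h2 h3 h4 p hp
    rw [driftGraph_eq_span] at hp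
    induction hp using Submodule.span_induction with
    | mem X hX => obtain ⟨x, rfl⟩ := hX; exact h1 x
    | zero => exact h2
    | add X Y _ _ hX hY => exact h3 _ _ hX hY
    | smul c X _ hX => exact h4 c _ hX
  -- Once the box contains both x and G x, the truncation acts on |x⟩⟨x| exactly.
  have heq : ∀ p ∈ driftGraph G L, ∀ᶠ N in Filter.atTop, truncLindblad G L N p.1 = p.2 := by
    refine hspan (fun x => ?_) ?_ ?_ ?_
    · obtain ⟨N₀, hN₀⟩ := exists_cut_eq_self x
      obtain ⟨N₁, hN₁⟩ := exists_cut_eq_self (G x)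
      filter_upwards [Filter.eventually_ge_atTop N₀, Filter.eventually_ge_atTop N₁] with N h0 h1
      have hx := cut_eq_self_mono h0 hN₀
      rw [truncLindblad_ketBra h hx hx, cut_eq_self_mono h1 hN₁, driftLindblad]
    · exact Filter.Eventually.of_forall fun N => map_zero _
    · intro p q hp hq
      filter_upwards [hp, hq] with N h0 h1
      rw [Prod.fst_add, map_add, h0, h1, Prod.snd_add]
    · intro c p hp
      filter_upwards [hp] with N h0
      rw [Prod.smul_fst, _root_.map_smul, h0, Prod.smul_snd]
  have hsnd : ∀ p ∈ driftGraph G L, ∃ y, (p.2, y) ∈ driftGraph G L := by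
    refine hspan (fun x => ?_) ⟨0, Submodule.zero_mem _⟩ ?_ ?_
    · obtain ⟨z1, h1⟩ := hfst (G x) x
      obtain ⟨z2, h2⟩ := hfst x (G x)
      choose z3 h3 using fun j => hfst (L j x) (L j x)
      refine ⟨z1 + z2 + ∑ j, z3 j, ?_⟩
      have h4 := Submodule.add_mem _ (Submodule.add_mem _ h1 h2)
        (Submodule.sum_mem (t := Finset.univ) _ fun j _ => h3 j)
      have h5 : ∑ j, ((ketBra (L j x).incl (L j x).incl, z3 j) :
          TraceClass (FockSpace V) × TraceClass (FockSpace V)) =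
          (∑ j, ketBra (L j x).incl (L j x).incl, ∑ j, z3 j) := by
        rw [Prod.ext_iff, Prod.fst_sum, Prod.snd_sum]
        exact ⟨rfl, rfl⟩
      rw [h5] at h4
      exact h4
    · rintro p q ⟨z, hz⟩ ⟨w, hw⟩
      exact ⟨z + w, Submodule.add_mem _ hz hw⟩
    · rintro c p ⟨z, hz⟩
      exact ⟨c • z, Submodule.smul_mem _ c hz⟩
  have hcauchy : ∀ p ∈ driftGraph G L, ∀ t, 0 ≤ t →
      CauchySeq fun N => expSG (truncLindblad G L N) t p.1 := by
    intro p hp t ht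
    suffices ∃ z, Filter.Tendsto (fun N => expSG (truncLindblad G L N) t p.1) Filter.atTop (𝓝 z) by
      obtain ⟨z, hz⟩ := this
      exact hz.cauchySeq
    revert p
    refine hspan (fun x => cauchySeq_tendsto_of_complete (cauchySeq_expSG_trunc h hm x ht))
      ⟨0, by simp⟩ ?_ ?_
    · rintro p q ⟨z, hz⟩ ⟨w, hw⟩
      exact ⟨z + w, (hz.add hw).congr fun N => by rw [Prod.fst_add, map_add]⟩
    · rintro c p ⟨z, hz⟩
      exact ⟨c • z, (hz.const_smul c).congr fun N => by rw [Prod.smul_fst, _root_.map_smul]⟩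
  -- A truncated orbit is a finite mixture of box vectors, hence lies in the domain. Applying the
  -- untruncated operator to it costs only the leak, which tends to 0.
  have hcore : ∀ p ∈ driftGraph G L, ∀ t, 0 ≤ t → ∃ η : ℕ → TraceClass (FockSpace V),
      (∀ᶠ N in Filter.atTop, (expSG (truncLindblad G L N) t p.1, η N) ∈ driftGraph G L) ∧
      Filter.Tendsto (fun N => η N - truncLindblad G L N (expSG (truncLindblad G L N) t p.1))
        Filter.atTop (𝓝 0) := by
    intro p hp t ht
    rw [driftGraph_eq_span] at hp
    refine exists_approximation_of_mem_span (truncLindblad G L) (fun N => expSG (truncLindblad G L N) t)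
      (driftGraph G L) ?_ p hp
    rintro _ ⟨x, rfl⟩
    obtain ⟨N₀, hN₀⟩ := exists_cut_eq_self x
    have hex : ∀ N, ∃ η, N₀ ≤ N →
        (expSG (truncLindblad G L N) t (ketBra x.incl x.incl), η) ∈ driftGraph G L ∧
        ‖η - truncLindblad G L N (expSG (truncLindblad G L N) t (ketBra x.incl x.incl))‖ ≤
          2 * leakBound W ω C x t N := by
      intro N
      by_cases hN : N₀ ≤ N
      · have hx := cut_eq_self_mono hN hN₀
        obtain ⟨y, hy, hyX, hyn⟩ := exists_expSG_truncLindblad_eq_sum h hx ht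
        refine ⟨∑ n ∈ box V N, driftLindblad G L (y n) (y n), fun _ => ⟨?_, ?_⟩⟩
        · have h4 := Submodule.sum_mem (t := box V N) (driftGraph G L) fun n _ =>
            Submodule.subset_span (s := Set.range fun p : FiniteFock V × FiniteFock V =>
              (ketBra p.1.incl p.2.incl, driftLindblad G L p.1 p.2)) ⟨(y n, y n), rfl⟩
          rw [hyX]
          convert h4 using 1
          rw [Prod.ext_iff, Prod.fst_sum, Prod.snd_sum]
          exact ⟨rfl, rfl⟩
        · rw [hyX, map_sum, ← Finset.sum_sub_distrib]
          have h1 := sum_leak_le h hm hx ht hy hyX hyn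
          refine (norm_sum_le_of_le _ fun n _ => norm_driftLindblad_sub_le h (hy n)).trans ?_
          rw [← Finset.mul_sum]
          linarith
      · exact ⟨0, fun h => absurd h hN⟩
    choose η hη using hex
    refine ⟨η, ?_, ?_⟩
    · filter_upwards [Filter.eventually_ge_atTop N₀] with N hN
      exact (hη N hN).1
    · have h2 := (tendsto_leakBound W ω C x t).const_mul 2
      rw [mul_zero] at h2
      refine squeeze_zero_norm' ?_ h2
      filter_upwards [Filter.eventually_ge_atTop N₀] with N hN
      exact (hη N hN).2
  obtain ⟨T, hT, hlim, hgen⟩ := exists_semigroup_of_approximation (L := truncLindblad G L) (M := 8)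
    (by norm_num) (norm_expSG_truncLindblad_le h) (G := driftGraph G L)
    (dense_finiteRank.mono hfin) heq hsnd hcauchy hcore
  refine ⟨T, ⟨hT.map_zero, hT.map_add, hT.continuous_zero, fun t ht => ?_, fun t ht X => ?_⟩,
    hgen, hlim⟩
  · exact IsCompletelyPositive.of_tendsto (Filter.Eventually.of_forall fun N =>
      expSG_truncLindblad_isCompletelyPositive (G := G) (L := L) N ht) (hlim t ht)
  · have h1 := ((traceAgainst (ContinuousLinearMap.id ℂ (FockSpace V))).continuous.tendsto _).comp
      (hlim t ht X)
    rw [← traceAgainst_id]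
    refine tendsto_nhds_unique h1 (tendsto_const_nhds.congr fun N => ?_)
    rw [Function.comp_apply, traceAgainst_id, expSG_truncLindblad_tracePreserving h]

end Generation


/-! ### Weighted shifts on the finite vectors of Fock space -/

section WeightedShifts

variable {V : Type*} [DecidableEq V] [Fintype V]

theorem diagonal_single (g : (V → ℕ) → ℂ) (n : V → ℕ) :
    diagonal g (Finsupp.single n 1) = g n • Finsupp.single n 1 := by
  ext m
  rw [diagonal_apply, Finsupp.smul_apply, Finsupp.single_apply, smul_eq_mul]
  split_ifs with h
  · rw [h]
  · simp

theorem FiniteFock.end_ext {M K : Module.End ℂ (FiniteFock V)}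
    (h : ∀ n, M (Finsupp.single n 1) = K (Finsupp.single n 1)) : M = K :=
  Finsupp.lhom_ext fun n c => by
    rw [← mul_one c, ← smul_eq_mul, ← Finsupp.smul_single, _root_.map_smul, _root_.map_smul, h]

theorem FiniteFock.apply_eq_sum (M : Module.End ℂ (FiniteFock V)) {x : FiniteFock V}
    {s : Finset (V → ℕ)} (hs : ∀ n, n ∉ s → x n = 0) :
    M x = ∑ n ∈ s, x n • M (Finsupp.single n 1) := by
  have hx : x = ∑ n ∈ s, x n • Finsupp.single n 1 := by
    conv_lhs => rw [← Finsupp.sum_single x]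
    rw [Finsupp.sum]
    refine (Finset.sum_subset (fun n hn => ?_) fun n _ hn => ?_).trans
      (Finset.sum_congr rfl fun n _ => by rw [Finsupp.smul_single, smul_eq_mul, mul_one])
    · by_contra h
      exact Finsupp.mem_support_iff.1 hn (hs n h)
    · rw [Finsupp.notMem_support_iff.1 hn, Finsupp.single_zero]
  conv_lhs => rw [hx]
  rw [map_sum]
  exact Finset.sum_congr rfl fun n _ => by rw [_root_.map_smul]

theorem inner_apply_eq_sum_of_apply_single {M K : Module.End ℂ (FiniteFock V)}
    {g f : (V → ℕ) → ℂ} {τ : (V → ℕ) → V → ℕ}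
    (hM : ∀ n, M (Finsupp.single n 1) = g n • Finsupp.single (τ n) 1)
    (hK : ∀ n, K (Finsupp.single n 1) = f n • Finsupp.single (τ n) 1)
    (hτ : ∀ n m, g n ≠ 0 → f m ≠ 0 → τ n = τ m → n = m)
    {x y : FiniteFock V} {s : Finset (V → ℕ)} (hx : ∀ n, n ∉ s → x n = 0)
    (hy : ∀ n, n ∉ s → y n = 0) :
    ⟪(M x).incl, (K y).incl⟫_ℂ =
      ∑ n ∈ s, starRingEnd ℂ (g n) * f n * (starRingEnd ℂ (x n) * y n) := by
  rw [FiniteFock.apply_eq_sum M hx, FiniteFock.apply_eq_sum K hy, map_sum, map_sum, sum_inner]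
  refine Finset.sum_congr rfl fun n hn => ?_
  rw [inner_sum, Finset.sum_eq_single n]
  · rw [hM, hK]
    simp only [_root_.map_smul, FiniteFock.incl_single, one_smul, inner_smul_left, inner_smul_right,
      inner_ket_ket, if_true]
    ring
  · intro m _ hmn
    rw [hM, hK]
    simp only [_root_.map_smul, FiniteFock.incl_single, one_smul, inner_smul_left, inner_smul_right,
      inner_ket_ket]
    by_cases hg : g n = 0
    · simp [hg]
    by_cases hf : f m = 0
    · simp [hf]
    rw [if_neg fun h => hmn (hτ n m hg hf h).symm]
    ring
  · exact fun h => absurd hn h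

theorem coe_weight (W : (V → ℕ) → ℝ) (x : FiniteFock V) :
    (weight W x : ℂ) = ⟪(diagonal (fun n => (W n : ℂ)) x).incl, x.incl⟫_ℂ := by
  rw [FiniteFock.inner_incl_eq_sum (s := x.support) fun n hn => by
    rw [diagonal_apply, Finsupp.notMem_support_iff.1 hn, mul_zero], weight]
  push_cast
  refine Finset.sum_congr rfl fun n _ => ?_
  rw [diagonal_apply, map_mul, Complex.conj_ofReal, mul_assoc, Complex.conj_mul']

/-- `M` maps `|n⟩` to `g n • |τ n⟩`, where `τ` is injective where `g` does not vanish. -/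
structure IsShift (M : Module.End ℂ (FiniteFock V)) (g : (V → ℕ) → ℝ) (τ : (V → ℕ) → V → ℕ) :
    Prop where
  apply_single : ∀ n, M (Finsupp.single n 1) = (g n : ℂ) • Finsupp.single (τ n) 1
  inj : ∀ n m, g n ≠ 0 → g m ≠ 0 → τ n = τ m → n = m

variable {M K : Module.End ℂ (FiniteFock V)} {g f : (V → ℕ) → ℝ} {τ σ : (V → ℕ) → V → ℕ}

theorem IsShift.mul (hM : IsShift M g τ) (hK : IsShift K f σ) :
    IsShift (M * K) (fun n => f n * g (σ n)) (fun n => τ (σ n)) where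
  apply_single n := by
    rw [Module.End.mul_apply, hK.apply_single, _root_.map_smul, hM.apply_single, smul_smul,
      Complex.ofReal_mul]
  inj n m hn hm h := hK.inj n m (left_ne_zero_of_mul hn) (left_ne_zero_of_mul hm)
    (hM.inj _ _ (right_ne_zero_of_mul hn) (right_ne_zero_of_mul hm) h)

theorem IsShift.commutator (hM : IsShift M g τ) (W : (V → ℕ) → ℝ) :
    IsShift (diagonal (fun n => (W n : ℂ)) * M - M * diagonal fun n => (W n : ℂ))
      (fun n => (W (τ n) - W n) * g n) τ where
  apply_single n := by
    rw [LinearMap.sub_apply, Module.End.mul_apply, Module.End.mul_apply, hM.apply_single,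
      diagonal_single, _root_.map_smul, _root_.map_smul, diagonal_single, hM.apply_single]
    push_cast
    module
  inj n m hn hm h := hM.inj n m (right_ne_zero_of_mul hn) (right_ne_zero_of_mul hm) h

theorem IsShift.leak (hM : IsShift M g τ) (N : ℕ) :
    IsShift (M - cut N * M) (fun n => if τ n ∈ box V N then 0 else g n) τ where
  apply_single n := by
    rw [LinearMap.sub_apply, Module.End.mul_apply, hM.apply_single, _root_.map_smul]
    ext m
    simp only [Finsupp.sub_apply, Finsupp.smul_apply, cut_apply, Finsupp.single_apply]
    by_cases h : τ n = m
    · subst h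
      split_ifs <;> simp
    · simp [h]
  inj n m hn hm h := hM.inj n m (fun h0 => hn (by simp [h0])) (fun h0 => hm (by simp [h0])) h

theorem IsShift.norm_sq_apply (hM : IsShift M g τ) (x : FiniteFock V) :
    ‖(M x).incl‖ ^ 2 = weight (fun n => g n ^ 2) x := by
  have h := inner_apply_eq_sum_of_apply_single hM.apply_single hM.apply_single
    (fun n m hn hm => hM.inj n m (fun h => hn (by simp [h])) (fun h => hm (by simp [h])))
    (x := x) (y := x) (s := x.support) (fun n hn => Finsupp.notMem_support_iff.1 hn)
    (fun n hn => Finsupp.notMem_support_iff.1 hn)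
  rw [inner_self_eq_norm_sq_to_K] at h
  have h2 : ((‖(M x).incl‖ ^ 2 : ℝ) : ℂ) = ((weight (fun n => g n ^ 2) x : ℝ) : ℂ) := by
    rw [weight]
    push_cast
    refine Eq.trans ?_ (h.trans (Finset.sum_congr rfl fun n _ => ?_))
    · simp
    · rw [Complex.conj_mul' (x n), Complex.conj_ofReal]
      ring
  exact_mod_cast h2

/-- The commutator of a shift with a diagonal operator, tested against the shift. -/
theorem IsShift.inner_commutator (hM : IsShift M g τ) (W : (V → ℕ) → ℝ) (x : FiniteFock V) :
    ⟪((diagonal (fun n => (W n : ℂ)) * M - M * diagonal fun n => (W n : ℂ)) x).incl,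
      (M x).incl⟫_ℂ = (weight (fun n => (W (τ n) - W n) * g n ^ 2) x : ℂ) := by
  rw [inner_apply_eq_sum_of_apply_single (hM.commutator W).apply_single hM.apply_single
    (fun n m hn hm => hM.inj n m (fun h => hn (by simp [h])) (fun h => hm (by simp [h])))
    (x := x) (y := x) (s := x.support) (fun n hn => Finsupp.notMem_support_iff.1 hn)
    (fun n hn => Finsupp.notMem_support_iff.1 hn), weight]
  push_cast
  refine Finset.sum_congr rfl fun n _ => ?_
  rw [Complex.conj_mul', map_mul, map_sub]
  simp only [Complex.conj_ofReal]
  ring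

/-- The quadratic form of a shift is controlled by a weight dominating its coefficients at both
ends. -/
theorem IsShift.norm_inner_le (hM : IsShift M g τ) {b : (V → ℕ) → ℝ} (hb : ∀ n, 0 ≤ b n)
    (h1 : ∀ n, |g n| ≤ b n) (h2 : ∀ n, |g n| ≤ b (τ n)) (x : FiniteFock V) :
    ‖⟪x.incl, (M x).incl⟫_ℂ‖ ≤ weight b x := by
  have hsup : ∀ n, n ∉ x.support → x n = 0 := fun n hn => Finsupp.notMem_support_iff.1 hn
  rw [FiniteFock.apply_eq_sum M hsup, map_sum, inner_sum]
  set s := x.support.filter fun n => g n ≠ 0 with hs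
  have hterm : ∀ n, ‖⟪x.incl, (x n • M (Finsupp.single n 1)).incl⟫_ℂ‖ = |g n| * (‖x n‖ * ‖x (τ n)‖) := by
    intro n
    rw [hM.apply_single, _root_.map_smul, _root_.map_smul, FiniteFock.incl_single, one_smul,
      inner_smul_right, inner_smul_right, ← inner_conj_symm, FiniteFock.inner_ket_incl]
    simp only [norm_mul, Complex.norm_real, Real.norm_eq_abs, RCLike.norm_conj]
    ring
  -- Where `g` does not vanish `τ` is injective, so the sum over the images is part of the sum
  -- defining the weight. Cauchy-Schwarz then reduces to the arithmetic-geometric mean inequality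
  -- termwise.
  have hsum : ∑ n ∈ s, b (τ n) * ‖x (τ n)‖ ^ 2 ≤ weight b x := by
    rw [← Finset.sum_image (f := fun n => b n * ‖x n‖ ^ 2) (g := τ) fun n hn m hm h =>
      hM.inj n m (Finset.mem_filter.1 hn).2 (Finset.mem_filter.1 hm).2 h]
    rw [weight_eq_sum b (s := x.support ∪ s.image τ) fun n hn =>
      hsup n fun h => hn (Finset.mem_union_left _ h)]
    exact Finset.sum_le_sum_of_subset_of_nonneg Finset.subset_union_right fun n _ _ =>
      mul_nonneg (hb n) (by positivity)
  have hsum' : ∑ n ∈ s, b n * ‖x n‖ ^ 2 ≤ weight b x :=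
    Finset.sum_le_sum_of_subset_of_nonneg (Finset.filter_subset _ _) fun n _ _ =>
      mul_nonneg (hb n) (by positivity)
  calc ‖∑ n ∈ x.support, ⟪x.incl, (x n • M (Finsupp.single n 1)).incl⟫_ℂ‖
      ≤ ∑ n ∈ x.support, |g n| * (‖x n‖ * ‖x (τ n)‖) :=
        norm_sum_le_of_le _ fun n _ => (hterm n).le
    _ = ∑ n ∈ s, |g n| * (‖x n‖ * ‖x (τ n)‖) := by
        refine (Finset.sum_filter_of_ne (p := fun n => g n ≠ 0) fun n _ hn h0 => hn ?_).symm
        rw [h0, abs_zero, zero_mul]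
    _ ≤ ∑ n ∈ s, (b n * ‖x n‖ ^ 2 + b (τ n) * ‖x (τ n)‖ ^ 2) / 2 := by
        refine Finset.sum_le_sum fun n _ => ?_
        have h3 := mul_le_mul_of_nonneg_right (h1 n) (sq_nonneg ‖x n‖)
        have h4 := mul_le_mul_of_nonneg_right (h2 n) (sq_nonneg ‖x (τ n)‖)
        have h5 := mul_nonneg (abs_nonneg (g n)) (sq_nonneg (‖x n‖ - ‖x (τ n)‖))
        nlinarith
    _ ≤ weight b x := by
        rw [← Finset.sum_div, Finset.sum_add_distrib]
        linarith

/-! ### Shifts of bounded degree -/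

/-- `M` is a shift changing the occupation numbers of the sites in `S` by at most `p`, whose
coefficients grow at most like the power `p / 2` of these occupation numbers. -/
def IsLocalShift (S : Finset V) (p : ℕ) (M : Module.End ℂ (FiniteFock V)) (g : (V → ℕ) → ℝ)
    (τ : (V → ℕ) → V → ℕ) : Prop :=
  IsShift M g τ ∧ (∀ n, ∀ i ∉ S, τ n i = n i) ∧ (∀ n i, τ n i ≤ n i + p ∧ n i ≤ τ n i + p) ∧
    ∀ n (s : ℕ), (∀ i ∈ S, n i + p ≤ s) → g n ^ 2 ≤ (s : ℝ) ^ p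

theorem isLocalShift_one (S : Finset V) : IsLocalShift S 0 1 (fun _ => 1) id :=
  ⟨⟨fun n => by simp, fun n m _ _ h => h⟩, fun _ _ _ => rfl, fun _ _ => by simp,
    fun _ _ _ => by simp⟩

/-- The slack n i + p ≤ s in the coefficient bound is what makes it multiplicative: the intermediate
configuration exceeds the initial one by at most q, so the threshold s for the product serves both
factors. -/
theorem IsLocalShift.mul {S : Finset V} {p q : ℕ} (hM : IsLocalShift S p M g τ)
    (hK : IsLocalShift S q K f σ) :
    IsLocalShift S (p + q) (M * K) (fun n => f n * g (σ n)) (fun n => τ (σ n)) := by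
  refine ⟨hM.1.mul hK.1, fun n i hi => ?_, fun n i => ?_, fun n s hs => ?_⟩
  · exact (hM.2.1 _ i hi).trans (hK.2.1 _ i hi)
  · have h1 := hM.2.2.1 (σ n) i
    have h2 := hK.2.2.1 n i
    dsimp only
    omega
  · rw [mul_pow, pow_add, mul_comm ((s : ℝ) ^ p)]
    refine mul_le_mul (hK.2.2.2 n s fun i hi => ?_) (hM.2.2.2 (σ n) s fun i hi => ?_)
      (sq_nonneg _) (by positivity)
    · have := hs i hi
      omega
    · have := hs i hi
      have h2 := hK.2.2.1 n i
      omega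

theorem annih_single (i : V) (n : V → ℕ) :
    annih i (Finsupp.single n 1) =
      ((√(n i : ℝ) : ℝ) : ℂ) • Finsupp.single (Function.update n i (n i - 1)) 1 := by
  simp [annih]

theorem creat_single (i : V) (n : V → ℕ) :
    creat i (Finsupp.single n 1) =
      ((√((n i : ℝ) + 1) : ℝ) : ℂ) • Finsupp.single (Function.update n i (n i + 1)) 1 := by
  simp [creat]

theorem isLocalShift_creat {S : Finset V} {i : V} (hi : i ∈ S) :
    IsLocalShift S 1 (creat i) (fun n => √((n i : ℝ) + 1))
      (fun n => Function.update n i (n i + 1)) := by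
  refine ⟨⟨creat_single i, fun n m hn hm h => ?_⟩, fun n j hj => ?_, fun n j => ?_, fun n s hs => ?_⟩
  · funext j
    have hj := congrFun h j
    by_cases hji : j = i
    · subst hji
      simp only [Function.update_self] at hj
      omega
    · simpa only [Function.update_of_ne hji] using hj
  · refine Function.update_of_ne ?_ _ _
    rintro rfl
    exact hj hi
  · by_cases hji : j = i
    · subst hji
      simp only [Function.update_self]
      omega
    · simp [Function.update_of_ne hji]
  · have := hs i hi
    rw [Real.sq_sqrt (by positivity), pow_one]
    exact_mod_cast this

theorem IsLocalShift.exists_pow {S : Finset V} {p : ℕ} (hM : IsLocalShift S p M g τ) (k : ℕ) :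
    ∃ f σ, IsLocalShift S (k * p) (M ^ k) f σ := by
  induction k with
  | zero => exact ⟨_, _, by simpa using isLocalShift_one S⟩
  | succ k ih =>
    obtain ⟨f, σ, h⟩ := ih
    rw [pow_succ, add_mul, one_mul]
    exact ⟨_, _, h.mul hM⟩

/-! ### Adjoint pairs -/

/-- `K` is the formal adjoint of `M` on the finite vectors. -/
def IsAdjoint (M K : Module.End ℂ (FiniteFock V)) : Prop :=
  ∀ x y : FiniteFock V, ⟪(M x).incl, y.incl⟫_ℂ = ⟪x.incl, (K y).incl⟫_ℂ

theorem IsAdjoint.symm (h : IsAdjoint M K) : IsAdjoint K M := fun x y => by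
  rw [← inner_conj_symm, ← h, inner_conj_symm]

theorem IsAdjoint.mul {M' K' : Module.End ℂ (FiniteFock V)} (h : IsAdjoint M K)
    (h' : IsAdjoint M' K') : IsAdjoint (M * M') (K' * K) := fun x y => by
  rw [Module.End.mul_apply, Module.End.mul_apply, h, h']

theorem isAdjoint_one : IsAdjoint (1 : Module.End ℂ (FiniteFock V)) 1 := fun _ _ => rfl

theorem isAdjoint_zero : IsAdjoint (0 : Module.End ℂ (FiniteFock V)) 0 := fun x y => by simp

theorem IsAdjoint.pow (h : IsAdjoint M K) (k : ℕ) : IsAdjoint (M ^ k) (K ^ k) := by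
  induction k with
  | zero => simpa using isAdjoint_one
  | succ k ih =>
    rw [pow_succ, pow_succ']
    exact ih.mul h

theorem IsAdjoint.add {M' K' : Module.End ℂ (FiniteFock V)} (h : IsAdjoint M K)
    (h' : IsAdjoint M' K') : IsAdjoint (M + M') (K + K') := fun x y => by
  rw [LinearMap.add_apply, LinearMap.add_apply, map_add, map_add, inner_add_left, inner_add_right,
    h, h']

theorem IsAdjoint.smul (h : IsAdjoint M K) (c : ℂ) :
    IsAdjoint (c • M) (starRingEnd ℂ c • K) := fun x y => by
  rw [LinearMap.smul_apply, LinearMap.smul_apply, _root_.map_smul, _root_.map_smul,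
    inner_smul_left, inner_smul_right, h]

theorem IsAdjoint.sub {M' K' : Module.End ℂ (FiniteFock V)} (h : IsAdjoint M K)
    (h' : IsAdjoint M' K') : IsAdjoint (M - M') (K - K') := fun x y => by
  rw [LinearMap.sub_apply, LinearMap.sub_apply, map_sub, map_sub, inner_sub_left, inner_sub_right,
    h, h']

theorem IsAdjoint.sum {κ : Type*} {s : Finset κ} {A B : κ → Module.End ℂ (FiniteFock V)}
    (h : ∀ i ∈ s, IsAdjoint (A i) (B i)) : IsAdjoint (∑ i ∈ s, A i) (∑ i ∈ s, B i) := by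
  classical
  induction s using Finset.induction_on with
  | empty => exact isAdjoint_zero
  | insert i s hi ih =>
    rw [Finset.sum_insert hi, Finset.sum_insert hi]
    exact (h i (Finset.mem_insert_self i s)).add
      (ih fun j hj => h j (Finset.mem_insert_of_mem hj))

theorem isAdjoint_diagonal (W : (V → ℕ) → ℝ) :
    IsAdjoint (diagonal fun n => (W n : ℂ)) (diagonal fun n => (W n : ℂ)) := fun x y => by
  have hx : ∀ n, n ∉ x.support → x n = 0 := fun n hn => Finsupp.notMem_support_iff.1 hn
  rw [FiniteFock.inner_incl_eq_sum (s := x.support) fun n hn => by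
    rw [diagonal_apply, hx n hn, mul_zero], FiniteFock.inner_incl_eq_sum hx]
  refine Finset.sum_congr rfl fun n _ => ?_
  rw [diagonal_apply, diagonal_apply, map_mul, Complex.conj_ofReal]
  ring

theorem isAdjoint_of_single (h : ∀ n m, ⟪(M (Finsupp.single n 1)).incl, ket m⟫_ℂ =
    ⟪ket n, (K (Finsupp.single m 1)).incl⟫_ℂ) : IsAdjoint M K := fun x y => by
  induction x using Finsupp.induction_linear with
  | zero => simp
  | add x x' hx hx' => rw [map_add, map_add, map_add, inner_add_left, inner_add_left, hx, hx']
  | single n c =>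
    induction y using Finsupp.induction_linear with
    | zero => simp
    | add y y' hy hy' => rw [map_add, map_add, map_add, inner_add_right, inner_add_right, hy, hy']
    | single m c' =>
      have e : ∀ (n : V → ℕ) (c : ℂ), (Finsupp.single n c : FiniteFock V) =
        c • Finsupp.single n 1 := fun n c => by simp
      rw [e n, e m]
      simp only [_root_.map_smul, inner_smul_left, inner_smul_right, ← ket_eq_incl, h]

theorem isAdjoint_annih_creat (i : V) : IsAdjoint (annih i) (creat i) := by
  refine isAdjoint_of_single fun n m => ?_
  rw [annih_single, creat_single]
  simp only [_root_.map_smul, FiniteFock.incl_single, one_smul, inner_smul_left, inner_smul_right,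
    inner_ket_ket, Complex.conj_ofReal]
  by_cases h : n = Function.update m i (m i + 1)
  · subst h
    simp
  · rw [if_neg h, mul_zero]
    -- Truncated subtraction leaves an empty site unchanged, but there the coefficient √0 vanishes.
    by_cases hn : n i = 0
    · simp [hn]
    · rw [if_neg, mul_zero]
      rintro rfl
      apply h
      rw [Function.update_self, Function.update_idem, Nat.sub_add_cancel (by omega),
        Function.update_eq_self]

/-- If `K` is adjoint to the shift `M`, then `K * M` is diagonal. -/
theorem IsShift.adjoint_mul_self (hM : IsShift M g τ) (h : IsAdjoint M K) :
    K * M = diagonal fun n => ((g n ^ 2 : ℝ) : ℂ) := by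
  refine FiniteFock.end_ext fun n => ?_
  ext m
  rw [diagonal_single, ← FiniteFock.inner_ket_incl, ket_eq_incl, Module.End.mul_apply, ← h,
    hM.apply_single, hM.apply_single]
  simp only [_root_.map_smul, FiniteFock.incl_single, one_smul, inner_smul_left, inner_smul_right,
    inner_ket_ket, Complex.conj_ofReal, Finsupp.smul_apply, Finsupp.single_apply, smul_eq_mul]
  by_cases hnm : n = m
  · subst hnm
    simp only [if_true]
    push_cast
    ring
  · rw [if_neg hnm]
    by_cases hn : g n = 0
    · simp [hn]
    by_cases hm : g m = 0
    · simp [hm]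
    rw [if_neg fun h => hnm (hM.inj n m hn hm h.symm)]
    simp

theorem annih_pow_single (j : V) (k : ℕ) (n : V → ℕ) :
    (annih j ^ k) (Finsupp.single n 1) =
      ((√((n j).descFactorial k : ℝ) : ℝ) : ℂ) •
        Finsupp.single (Function.update n j (n j - k)) 1 := by
  induction k with
  | zero => simp
  | succ k ih =>
    rw [pow_succ', Module.End.mul_apply, ih, _root_.map_smul, annih_single, smul_smul,
      ← Complex.ofReal_mul, Function.update_self, Function.update_idem, Nat.sub_sub,
      Nat.descFactorial_succ, mul_comm (n j - k), Nat.cast_mul, Real.sqrt_mul (by positivity)]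

/-- The `k`-th power of an annihilation operator, with explicit coefficients. -/
theorem isLocalShift_annih_pow {S : Finset V} {j : V} (hj : j ∈ S) (k : ℕ) :
    IsLocalShift S k (annih j ^ k) (fun n => √((n j).descFactorial k : ℝ))
      (fun n => Function.update n j (n j - k)) := by
  refine ⟨⟨annih_pow_single j k, fun n m hn hm h => ?_⟩, fun n i hi => ?_, fun n i => ?_,
    fun n s hs => ?_⟩
  · have hn' : k ≤ n j := by
      by_contra h0
      exact hn (by simp [Nat.descFactorial_of_lt (not_le.1 h0)])
    have hm' : k ≤ m j := by
      by_contra h0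
      exact hm (by simp [Nat.descFactorial_of_lt (not_le.1 h0)])
    funext i
    have hi := congrFun h i
    by_cases hij : i = j
    · subst hij
      simp only [Function.update_self] at hi
      omega
    · simpa only [Function.update_of_ne hij] using hi
  · refine Function.update_of_ne ?_ _ _
    rintro rfl
    exact hi hj
  · by_cases hij : i = j
    · subst hij
      simp only [Function.update_self]
      omega
    · simp [Function.update_of_ne hij]
  · have := hs j hj
    rw [Real.sq_sqrt (by positivity)]
    exact_mod_cast (Nat.descFactorial_le_pow _ _).trans (Nat.pow_le_pow_left (by omega) k)

end WeightedShifts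


/-! ### Moment estimates -/

section Moments

theorem weight_add {V : Type*} (W Z : (V → ℕ) → ℝ) (x : FiniteFock V) :
    weight (fun n => W n + Z n) x = weight W x + weight Z x := by
  simp only [weight, add_mul, Finset.sum_add_distrib]

theorem weight_const_mul {V : Type*} (c : ℝ) (W : (V → ℕ) → ℝ) (x : FiniteFock V) :
    weight (fun n => c * W n) x = c * weight W x := by
  simp only [weight, mul_assoc, Finset.mul_sum]

theorem weight_sum {V κ : Type*} (s : Finset κ) (W : κ → (V → ℕ) → ℝ) (x : FiniteFock V) :
    weight (fun n => ∑ j ∈ s, W j n) x = ∑ j ∈ s, weight (W j) x := by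
  simp only [weight, Finset.sum_mul]
  exact Finset.sum_comm

variable {V : Type*} [DecidableEq V] [Fintype V]

/-- The weighted sum of powers of the number operators. -/
def powerWeight (w : V → ℝ) (k : ℕ) (n : V → ℕ) : ℝ := ∑ j, w j * ((n j : ℝ) + 1) ^ k

theorem powerWeight_nonneg {w : V → ℝ} (hw : ∀ j, 0 ≤ w j) (k : ℕ) (n : V → ℕ) :
    0 ≤ powerWeight w k n :=
  Finset.sum_nonneg fun j _ => mul_nonneg (hw j) (by positivity)

/-- The reference point `c` is kept separate from `a` and `b` so that the same bound can be used at
both ends of a shift, as `IsShift.norm_inner_le` requires. -/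
theorem abs_pow_sub_pow_le_of_near {a b c q k : ℕ} (hab : a ≤ b + 2 * q) (hba : b ≤ a + 2 * q)
    (hac : a ≤ c + 2 * q) (hbc : b ≤ c + 2 * q) :
    |((a : ℝ) + 1) ^ k - ((b : ℝ) + 1) ^ k| ≤
      2 * q * k * (2 * q + 1) ^ (k - 1) * ((c : ℝ) + 1) ^ (k - 1) := by
  have hab' : (a : ℝ) ≤ b + 2 * q := by exact_mod_cast hab
  have hba' : (b : ℝ) ≤ a + 2 * q := by exact_mod_cast hba
  have hac' : (a : ℝ) ≤ c + 2 * q := by exact_mod_cast hac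
  have hbc' : (b : ℝ) ≤ c + 2 * q := by exact_mod_cast hbc
  refine (abs_pow_sub_pow_le _ _ _).trans ?_
  rw [mul_assoc (2 * (q : ℝ) * k), ← mul_pow]
  have h1 : |(a : ℝ) + 1 - (b + 1)| ≤ 2 * q := abs_le.2 ⟨by linarith, by linarith⟩
  have h2 : max |(a : ℝ) + 1| |(b : ℝ) + 1| ≤ (2 * q + 1) * ((c : ℝ) + 1) := by
    rw [abs_of_nonneg (by positivity), abs_of_nonneg (by positivity)]
    have : (0 : ℝ) ≤ 2 * q * c := by positivity
    exact max_le (by nlinarith) (by nlinarith)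
  gcongr

/-- The constant in the commutator estimate. -/
noncomputable def commConst (k q : ℕ) : ℝ := 2 * q * k * (2 * q + 1) ^ (k - 1) * (2 * q + 1) ^ (2 * q)

theorem commConst_nonneg (k q : ℕ) : 0 ≤ commConst k q := by
  unfold commConst
  positivity

variable {M K : Module.End ℂ (FiniteFock V)} {g : (V → ℕ) → ℝ} {τ : (V → ℕ) → V → ℕ}

theorem IsLocalShift.abs_coeff_le {i j : V} {p q : ℕ} (hM : IsLocalShift {i, j} p M g τ)
    (hpq : p ≤ 2 * q) {n m : V → ℕ} (hm : ∀ l, n l ≤ m l + 2 * q) :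
    |g n| ≤ (2 * q + 1) ^ (2 * q) * (max ((m i : ℝ) + 1) (m j + 1)) ^ q := by
  -- The extra 1 makes the threshold at least 1, so the exponent p may be raised to 2q.
  have h1 := hM.2.2.2 n (max (n i) (n j) + 2 * q + 1) fun l hl => by
    simp only [Finset.mem_insert, Finset.mem_singleton] at hl
    rcases hl with rfl | rfl
    · have := le_max_left (n l) (n j)
      omega
    · have := le_max_right (n i) (n l)
      omega
  have h2 : ((max (n i) (n j) + 2 * q + 1 : ℕ) : ℝ) ≤
      (2 * q + 1) ^ 2 * max ((m i : ℝ) + 1) (m j + 1) := by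
    have h3 : ((max (n i) (n j) : ℕ) : ℝ) ≤ max ((m i : ℝ) + 1) (m j + 1) - 1 + 2 * q := by
      rw [Nat.cast_max]
      have hi : (n i : ℝ) ≤ m i + 2 * q := by exact_mod_cast hm i
      have hj : (n j : ℝ) ≤ m j + 2 * q := by exact_mod_cast hm j
      have h4 := le_max_left ((m i : ℝ) + 1) (m j + 1)
      have h5 := le_max_right ((m i : ℝ) + 1) (m j + 1)
      exact max_le (by linarith) (by linarith)
    have h6 : 1 ≤ max ((m i : ℝ) + 1) (m j + 1) :=
      le_max_of_le_left (le_add_of_nonneg_left (Nat.cast_nonneg _))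
    have hq : (0 : ℝ) ≤ q := Nat.cast_nonneg q
    push_cast at h3 ⊢
    nlinarith [mul_nonneg hq (sub_nonneg.2 h6), mul_nonneg (mul_nonneg hq hq) (by linarith : 0 ≤ max ((m i : ℝ) + 1) (m j + 1))]
  refine abs_le_of_sq_le_sq (h1.trans ?_) (by positivity)
  refine (pow_le_pow_right₀ (by push_cast; exact le_add_of_nonneg_left (by positivity)) hpq).trans ?_
  rw [pow_mul (2 * (q : ℝ) + 1), ← mul_pow, ← pow_mul, mul_comm q 2]
  exact pow_le_pow_left₀ (by positivity) h2 _

/-- Only the sites i and j change. The difference of k-th powers loses one power and the coefficient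
of the shift contributes q, whence the order k - 1 + q. The point `m` stands for either end of the
shift. -/
theorem IsLocalShift.abs_commutator_coeff_le {i j : V} {p q : ℕ}
    (hM : IsLocalShift {i, j} p M g τ) (hpq : p ≤ 2 * q) {w : V → ℝ} (hw : ∀ l, 0 ≤ w l) (k : ℕ)
    {n m : V → ℕ} (hm : ∀ l, n l ≤ m l + 2 * q) (hm' : ∀ l, τ n l ≤ m l + 2 * q) :
    |(powerWeight w k (τ n) - powerWeight w k n) * g n| ≤
      commConst k q * ((w i + w j) *
        (((m i : ℝ) + 1) ^ (k - 1 + q) + ((m j : ℝ) + 1) ^ (k - 1 + q))) := by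
  set u : ℝ := max ((m i : ℝ) + 1) (m j + 1) with hu
  have hu0 : 0 ≤ u := le_max_of_le_left (by positivity)
  set c : ℝ := 2 * q * k * (2 * q + 1) ^ (k - 1) with hc
  have hc0 : 0 ≤ c := by positivity
  have hterm : ∀ l ∈ ({i, j} : Finset V),
      |w l * ((τ n l : ℝ) + 1) ^ k - w l * ((n l : ℝ) + 1) ^ k| ≤ w l * (c * u ^ (k - 1)) := by
    intro l hl
    have hml : (m l : ℝ) + 1 ≤ u := by
      simp only [Finset.mem_insert, Finset.mem_singleton] at hl
      rcases hl with rfl | rfl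
      · exact le_max_left _ _
      · exact le_max_right _ _
    have h1 := hM.2.2.1 n l
    rw [← mul_sub, abs_mul, abs_of_nonneg (hw l)]
    refine mul_le_mul_of_nonneg_left ?_ (hw l)
    refine (abs_pow_sub_pow_le_of_near (by omega) (by omega) (hm' l) (hm l)).trans ?_
    gcongr
  have hdiff : |powerWeight w k (τ n) - powerWeight w k n| ≤ (w i + w j) * (c * u ^ (k - 1)) := by
    rw [powerWeight, powerWeight, ← Finset.sum_sub_distrib,
      ← Finset.sum_subset (Finset.subset_univ ({i, j} : Finset V)) fun l _ hl => by
        rw [hM.2.1 n l hl, sub_self]]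
    refine (Finset.abs_sum_le_sum_abs _ _).trans ((Finset.sum_le_sum hterm).trans ?_)
    rw [← Finset.sum_mul]
    refine mul_le_mul_of_nonneg_right ?_ (by positivity)
    by_cases hij : i = j
    · subst hij
      simpa using hw i
    · rw [Finset.sum_pair hij]
  have hg := hM.abs_coeff_le hpq hm
  have hue : u ^ (k - 1 + q) ≤ ((m i : ℝ) + 1) ^ (k - 1 + q) + ((m j : ℝ) + 1) ^ (k - 1 + q) := by
    rcases max_choice ((m i : ℝ) + 1) (m j + 1) with h | h
    · rw [hu, h]
      exact le_add_of_nonneg_right (by positivity)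
    · rw [hu, h]
      exact le_add_of_nonneg_left (by positivity)
  have hw2 : 0 ≤ w i + w j := add_nonneg (hw i) (hw j)
  calc |(powerWeight w k (τ n) - powerWeight w k n) * g n|
      ≤ (w i + w j) * (c * u ^ (k - 1)) * ((2 * q + 1) ^ (2 * q) * u ^ q) := by
        rw [abs_mul]
        exact mul_le_mul hdiff hg (abs_nonneg _) (by positivity)
    _ = commConst k q * ((w i + w j) * u ^ (k - 1 + q)) := by
        rw [commConst, pow_add]
        ring
    _ ≤ _ := by
        have := commConst_nonneg k q
        gcongr

/-- The commutator estimate. -/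
theorem IsLocalShift.norm_inner_commutator_le {i j : V} {p q : ℕ}
    (hM : IsLocalShift {i, j} p M g τ) (hpq : p ≤ 2 * q) {w : V → ℝ} (hw : ∀ l, 0 ≤ w l) (k : ℕ)
    (x : FiniteFock V) :
    ‖⟪x.incl, ((diagonal (fun n => (powerWeight w k n : ℂ)) * M -
      M * diagonal fun n => (powerWeight w k n : ℂ)) x).incl⟫_ℂ‖ ≤
      commConst k q * weight (fun n => (w i + w j) *
        (((n i : ℝ) + 1) ^ (k - 1 + q) + ((n j : ℝ) + 1) ^ (k - 1 + q))) x := by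
  rw [← weight_const_mul]
  refine (hM.1.commutator (powerWeight w k)).norm_inner_le (fun n => ?_) (fun n => ?_)
    (fun n => ?_) x
  · have := commConst_nonneg k q
    have := hw i
    have := hw j
    positivity
  · exact hM.abs_commutator_coeff_le hpq hw k (fun l => by omega) fun l => by
      have := hM.2.2.1 n l
      omega
  · exact hM.abs_commutator_coeff_le hpq hw k (fun l => by
      have := hM.2.2.1 n l
      omega) fun l => by omega

/-- If n + 1 < 2ℓ, the left side is nonpositive and the constant dominates the remaining term.
Otherwise the falling factorial is at least ((n + 1)/2)^ℓ, and removing ℓ photons lowers the k-th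
power by at least (n + 1)^(k-1). -/
theorem descFactorial_mul_pow_sub_le {k ℓ : ℕ} (hk : 1 ≤ k) (hℓ : 1 ≤ ℓ) (n : ℕ) :
    (((n - ℓ : ℕ) : ℝ) + 1) ^ k * n.descFactorial ℓ - ((n : ℝ) + 1) ^ k * n.descFactorial ℓ ≤
      (2 * ℓ : ℝ) ^ (k + ℓ - 1) - (1 / 2) ^ ℓ * ((n : ℝ) + 1) ^ (k + ℓ - 1) := by
  have hmono : (((n - ℓ : ℕ) : ℝ) + 1) ^ k ≤ ((n : ℝ) + 1) ^ k := by
    have : ((n - ℓ : ℕ) : ℝ) ≤ n := by exact_mod_cast Nat.sub_le n ℓ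
    gcongr
  have hd0 : (0 : ℝ) ≤ n.descFactorial ℓ := Nat.cast_nonneg _
  by_cases h : n + 1 < 2 * ℓ
  · have h1 : (1 / 2 : ℝ) ^ ℓ * ((n : ℝ) + 1) ^ (k + ℓ - 1) ≤ (2 * ℓ : ℝ) ^ (k + ℓ - 1) := by
      refine (mul_le_of_le_one_left (by positivity)
        (pow_le_one₀ (by norm_num) (by norm_num))).trans ?_
      have : (n : ℝ) + 1 ≤ 2 * ℓ := by exact_mod_cast h.le
      gcongr
    nlinarith
  · have hle : ℓ ≤ n := by omega
    have h2 : (1 / 2 : ℝ) ^ ℓ * ((n : ℝ) + 1) ^ ℓ ≤ n.descFactorial ℓ := by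
      have h3 : ((n + 1 - ℓ : ℕ) : ℝ) ^ ℓ ≤ n.descFactorial ℓ := by
        exact_mod_cast Nat.pow_sub_le_descFactorial n ℓ
      refine le_trans ?_ h3
      rw [← mul_pow, Nat.cast_sub (by omega)]
      have : (2 : ℝ) * ℓ ≤ n + 1 := by exact_mod_cast (not_lt.1 h)
      push_cast
      exact pow_le_pow_left₀ (by positivity) (by linarith) _
    have h4 : ((n : ℝ) + 1) ^ (k - 1) ≤ ((n : ℝ) + 1) ^ k - (((n - ℓ : ℕ) : ℝ) + 1) ^ k := by
      obtain ⟨k, rfl⟩ : ∃ k', k = k' + 1 := ⟨k - 1, by omega⟩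
      have hℓ' : (1 : ℝ) ≤ ℓ := by exact_mod_cast hℓ
      have h5 : ((n : ℝ) - ℓ + 1) ^ k ≤ ((n : ℝ) + 1) ^ k :=
        pow_le_pow_left₀ (by
          have : (ℓ : ℝ) ≤ n := by exact_mod_cast hle
          linarith) (by linarith) _
      have h6 : (0 : ℝ) ≤ (n : ℝ) - ℓ + 1 := by
        have : (ℓ : ℝ) ≤ n := by exact_mod_cast hle
        linarith
      have h7 : (0 : ℝ) ≤ ((n : ℝ) + 1) ^ k := by positivity
      rw [Nat.cast_sub hle, Nat.add_sub_cancel, pow_succ, pow_succ]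
      nlinarith [mul_le_mul_of_nonneg_right h5 h6]
    have h8 : (1 / 2 : ℝ) ^ ℓ * ((n : ℝ) + 1) ^ (k + ℓ - 1) ≤
        (((n : ℝ) + 1) ^ k - (((n - ℓ : ℕ) : ℝ) + 1) ^ k) * n.descFactorial ℓ := by
      rw [show k + ℓ - 1 = (k - 1) + ℓ by omega, pow_add, mul_left_comm]
      exact mul_le_mul h4 h2 (by positivity) (le_trans (by positivity) h4)
    have h9 : (0 : ℝ) ≤ (2 * ℓ : ℝ) ^ (k + ℓ - 1) := by positivity
    linarith

/-- Absorption of a lower power: either c ≤ μv and the higher power wins, or v ≤ c/μ and the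
constant does. -/
theorem mul_pow_le_mul_pow_succ_add {c μ v : ℝ} (hc : 0 ≤ c) (hμ : 0 < μ) (hv : 0 ≤ v) (e : ℕ) :
    c * v ^ e ≤ μ * v ^ (e + 1) + c * (c / μ) ^ e := by
  by_cases h : c ≤ μ * v
  · have h1 : c * v ^ e ≤ μ * v * v ^ e := by gcongr
    have h2 : 0 ≤ c * (c / μ) ^ e := by positivity
    rw [pow_succ']
    linarith
  · have h1 : v ≤ c / μ := (le_div_iff₀' hμ).2 (not_le.1 h).le
    have h2 : c * v ^ e ≤ c * (c / μ) ^ e := by gcongr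
    have h3 : 0 ≤ μ * v ^ (e + 1) := by positivity
    linarith

/-! ### The rate of change of the moments -/

/-- The contribution of the Hamiltonian `h` to the rate of change of the expectation of `W`. -/
noncomputable def hamRate (h : Module.End ℂ (FiniteFock V)) (W : (V → ℕ) → ℝ) (x : FiniteFock V) :
    ℝ :=
  2 * (⟪(diagonal (fun n => (W n : ℂ)) x).incl, (((-Complex.I) • h) x).incl⟫_ℂ).re

theorem hamRate_sum {κ : Type*} (s : Finset κ) (h : κ → Module.End ℂ (FiniteFock V))
    (W : (V → ℕ) → ℝ) (x : FiniteFock V) :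
    hamRate (∑ i ∈ s, h i) W x = ∑ i ∈ s, hamRate (h i) W x := by
  simp only [hamRate, Finset.smul_sum, LinearMap.sum_apply, map_sum, inner_sum, Complex.re_sum,
    Finset.mul_sum]

/-- The rate is an expectation of the commutator of h with W. For a monomial plus its adjoint the
two contributions are conjugate, so a single commutator controls both. -/
theorem hamRate_symmetrized_le (hMK : IsAdjoint M K) (c : ℂ) (W : (V → ℕ) → ℝ) (x : FiniteFock V) :
    hamRate (c • M + starRingEnd ℂ c • K) W x ≤ 2 * (‖c‖ *
      ‖⟪x.incl, ((diagonal (fun n => (W n : ℂ)) * M - M * diagonal fun n => (W n : ℂ)) x).incl⟫_ℂ‖) := by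
  set y := diagonal (fun n => (W n : ℂ)) x with hy
  have e1 : ⟪x.incl, (diagonal (fun n => (W n : ℂ)) (M x)).incl⟫_ℂ = ⟪y.incl, (M x).incl⟫_ℂ :=
    (isAdjoint_diagonal W x (M x)).symm
  have e2 : ⟪y.incl, (K x).incl⟫_ℂ = starRingEnd ℂ ⟪x.incl, (M y).incl⟫_ℂ := by
    rw [← hMK, inner_conj_symm]
  have key : (⟪y.incl, (((-Complex.I) • (c • M + starRingEnd ℂ c • K)) x).incl⟫_ℂ).re =
      (-Complex.I * (c * ⟪x.incl, ((diagonal (fun n => (W n : ℂ)) * M -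
        M * diagonal fun n => (W n : ℂ)) x).incl⟫_ℂ)).re := by
    rw [LinearMap.sub_apply, Module.End.mul_apply, Module.End.mul_apply, map_sub, inner_sub_right, e1,
      LinearMap.smul_apply, LinearMap.add_apply, LinearMap.smul_apply, LinearMap.smul_apply,
      _root_.map_smul, map_add, _root_.map_smul, _root_.map_smul, inner_smul_right, inner_add_right,
      inner_smul_right, inner_smul_right, e2, ← hy]
    simp only [Complex.mul_re, Complex.mul_im, Complex.neg_re, Complex.neg_im, Complex.I_re,
      Complex.I_im, Complex.add_re, Complex.add_im, Complex.sub_re, Complex.sub_im, Complex.conj_re,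
      Complex.conj_im]
    ring
  rw [hamRate, key]
  refine mul_le_mul_of_nonneg_left ((Complex.re_le_norm _).trans ?_) zero_le_two
  simp

/-- The drift of the Lindblad operator with Hamiltonian `h` and photon jumps. -/
noncomputable def photonDrift (ℓ : ℕ) (α : V → ℂ) (h : Module.End ℂ (FiniteFock V)) :
    Module.End ℂ (FiniteFock V) :=
  (-Complex.I) • h - (1 / 2 : ℂ) • ∑ j, photonJumpDag ℓ α j * photonJump ℓ α j

theorem isAdjoint_photonJump (ℓ : ℕ) (α : V → ℂ) (j : V) :
    IsAdjoint (photonJump ℓ α j) (photonJumpDag ℓ α j) := by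
  have := ((isAdjoint_annih_creat j).pow ℓ).sub ((isAdjoint_one (V := V)).smul (α j ^ ℓ))
  rwa [map_pow] at this

/-- For L = a^ℓ - α^ℓ, a jump and half of its anticommutator contribute Re⟨[W, L]x, Lx⟩. The
constant drops out of the commutator, and splitting Lx = a^ℓ x - α^ℓ x separates pure loss from the
drive. -/
theorem momentRate_photonDrift (ℓ : ℕ) (α : V → ℂ) (h : Module.End ℂ (FiniteFock V))
    (W : (V → ℕ) → ℝ) (x : FiniteFock V) :
    momentRate (photonDrift ℓ α h) (photonJump ℓ α) W x = hamRate h W x +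
      ∑ j, (weight (fun n => (W (Function.update n j (n j - ℓ)) - W n) * (n j).descFactorial ℓ) x -
        (α j ^ ℓ * ⟪((diagonal (fun n => (W n : ℂ)) * annih j ^ ℓ -
          annih j ^ ℓ * diagonal fun n => (W n : ℂ)) x).incl, x.incl⟫_ℂ).re) := by
  set y := diagonal (fun n => (W n : ℂ)) x with hy
  have hjump : ∀ j, weight W (photonJump ℓ α j x) -
      (⟪y.incl, ((photonJumpDag ℓ α j * photonJump ℓ α j) x).incl⟫_ℂ).re =
      weight (fun n => (W (Function.update n j (n j - ℓ)) - W n) * (n j).descFactorial ℓ) x -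
        (α j ^ ℓ * ⟪((diagonal (fun n => (W n : ℂ)) * annih j ^ ℓ -
          annih j ^ ℓ * diagonal fun n => (W n : ℂ)) x).incl, x.incl⟫_ℂ).re := by
    intro j
    have h1 := (isLocalShift_annih_pow (Finset.mem_univ j) ℓ).1.inner_commutator W x
    simp only [Real.sq_sqrt (Nat.cast_nonneg (α := ℝ) _)] at h1
    have h2 : ((diagonal (fun n => (W n : ℂ)) * annih j ^ ℓ -
        annih j ^ ℓ * diagonal fun n => (W n : ℂ)) x) =
        diagonal (fun n => (W n : ℂ)) (photonJump ℓ α j x) - photonJump ℓ α j y := by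
      rw [photonJump, LinearMap.sub_apply, LinearMap.sub_apply, LinearMap.sub_apply, map_sub]
      simp only [Module.End.mul_apply, LinearMap.smul_apply, Module.End.one_apply, _root_.map_smul]
      rw [← hy]
      abel
    have h3 : (annih j ^ ℓ) x = photonJump ℓ α j x + α j ^ ℓ • x := by
      rw [photonJump, LinearMap.sub_apply, LinearMap.smul_apply, Module.End.one_apply, sub_add_cancel]
    rw [← Complex.ofReal_re (weight _ x), ← h1, ← Complex.ofReal_re (weight W _), coe_weight, h2,
      Module.End.mul_apply, ← isAdjoint_photonJump, h3, map_add, _root_.map_smul, inner_add_right, inner_smul_right, map_sub,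
      inner_sub_left, Complex.add_re, Complex.sub_re, add_sub_cancel_right]
  rw [← Finset.sum_congr rfl fun j _ => hjump j, momentRate, photonDrift, hamRate,
    LinearMap.sub_apply, map_sub, inner_sub_right, Complex.sub_re, LinearMap.smul_apply (1 / 2 : ℂ),
    _root_.map_smul, inner_smul_right, LinearMap.sum_apply, map_sum, inner_sum,
    Finset.sum_sub_distrib, ← hy, ← Complex.re_sum]
  have h5 : ∀ z : ℂ, ((1 / 2 : ℂ) * z).re = z.re / 2 := fun z => by
    rw [show (1 / 2 : ℂ) = ((1 / 2 : ℝ) : ℂ) by norm_num, Complex.re_ofReal_mul]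
    ring
  rw [h5]
  ring

end Moments


/-! ### Photon dissipation: conservativity and moment bounds -/

section PhotonDissipation

variable {V : Type*} [DecidableEq V] [Fintype V]

theorem cut_annih_pow {N : ℕ} {x : FiniteFock V} (hx : cut N x = x) (j : V) (k : ℕ) :
    cut N ((annih j ^ k) x) = (annih j ^ k) x := by
  rw [FiniteFock.apply_eq_sum _ (cut_eq_self_iff.1 hx), map_sum]
  refine Finset.sum_congr rfl fun n hn => ?_
  rw [annih_pow_single, _root_.map_smul, _root_.map_smul, cut_single]
  rw [mem_box] at hn ⊢
  intro i
  by_cases hij : i = j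
  · subst hij
    rw [Function.update_self]
    exact (Nat.sub_le _ _).trans (hn i)
  · rw [Function.update_of_ne hij]
    exact hn i

theorem isConservative_photonDrift (ℓ : ℕ) (α : V → ℂ) {h : Module.End ℂ (FiniteFock V)}
    (hh : IsAdjoint h h) : IsConservative (photonDrift ℓ α h) (photonJump ℓ α) where
  dissipative x := by
    have h1 : ∑ j, ⟪(photonJump ℓ α j x).incl, (photonJump ℓ α j x).incl⟫_ℂ =
        ⟪x.incl, ((∑ j, photonJumpDag ℓ α j * photonJump ℓ α j) x).incl⟫_ℂ := by
      rw [LinearMap.sum_apply, map_sum, inner_sum]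
      exact Finset.sum_congr rfl fun j _ => isAdjoint_photonJump ℓ α j _ _
    have h2 : ⟪((∑ j, photonJumpDag ℓ α j * photonJump ℓ α j) x).incl, x.incl⟫_ℂ =
        ⟪x.incl, ((∑ j, photonJumpDag ℓ α j * photonJump ℓ α j) x).incl⟫_ℂ :=
      IsAdjoint.sum (fun j _ => (isAdjoint_photonJump ℓ α j).symm.mul (isAdjoint_photonJump ℓ α j)) x x
    rw [h1, photonDrift, LinearMap.sub_apply, LinearMap.smul_apply, LinearMap.smul_apply, map_sub,
      _root_.map_smul, _root_.map_smul, inner_sub_right, inner_sub_left, inner_smul_right,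
      inner_smul_right, inner_smul_left, inner_smul_left, h2, hh x x]
    have h3 : starRingEnd ℂ (1 / 2 : ℂ) = 1 / 2 := by
      rw [show (1 / 2 : ℂ) = ((1 / 2 : ℝ) : ℂ) by norm_num, Complex.conj_ofReal]
    rw [h3, map_neg, Complex.conj_I]
    ring
  cut_jump N j x hx := by
    rw [photonJump, LinearMap.sub_apply, map_sub, cut_annih_pow hx, LinearMap.smul_apply,
      Module.End.one_apply, _root_.map_smul, hx]

theorem lindbladKetBra_photonJump (ℓ : ℕ) (α : V → ℂ) (h : Module.End ℂ (FiniteFock V))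
    (x y : FiniteFock V) :
    lindbladKetBra h (photonJump ℓ α) (photonJumpDag ℓ α) x y =
      driftLindblad (photonDrift ℓ α h) (photonJump ℓ α) x y := by
  have h3 : starRingEnd ℂ (1 / 2 : ℂ) = 1 / 2 := by
    rw [show (1 / 2 : ℂ) = ((1 / 2 : ℝ) : ℂ) by norm_num, Complex.conj_ofReal]
  simp only [lindbladKetBra, driftLindblad, photonDrift, LinearMap.sub_apply, LinearMap.smul_apply,
    LinearMap.sum_apply, map_sub, map_sum, _root_.map_smul, ← ketBraₛ_apply,
    LinearMap.map_smulₛₗ, h3, Finset.sum_sub_distrib, map_neg, Complex.conj_I, smul_add,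
    Finset.sum_add_distrib, Finset.smul_sum]
  module

theorem photonDissipation_eq_driftGraph (ℓ : ℕ) (α : V → ℂ) (h : Module.End ℂ (FiniteFock V)) :
    photonDissipation ℓ α h = driftGraph (photonDrift ℓ α h) (photonJump ℓ α) := by
  rw [photonDissipation, lindbladGraph, driftGraph]
  simp only [lindbladKetBra_photonJump]

/-- The constant in the moment estimate for photon dissipation with a Hamiltonian of strength `H`. -/
noncomputable def momentConst (ℓ k : ℕ) (R H : ℝ) : ℝ :=
  (2 * ℓ : ℝ) ^ (k + ℓ - 1) + (R ^ ℓ * (commConst k (ℓ - 1) * 4) + H) *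
    ((R ^ ℓ * (commConst k (ℓ - 1) * 4) + H) / (1 / 2) ^ (ℓ + 1)) ^ (k - 1 + (ℓ - 1))

theorem momentConst_nonneg (ℓ k : ℕ) {R H : ℝ} (hR : 0 ≤ R) (hH : 0 ≤ H) :
    0 ≤ momentConst ℓ k R H := by
  have := commConst_nonneg k (ℓ - 1)
  unfold momentConst
  positivity

/-- Loss contributes -2^(-ℓ)(n + 1)^(k+ℓ-1) at each site, up to a constant. Drive and Hamiltonian
are one order lower, so half of the loss absorbs them, site by site and with the weights `w`
untouched. -/
theorem momentRate_photonDrift_le {ℓ k : ℕ} (hℓ : 2 ≤ ℓ) (hk : 1 ≤ k) {R H : ℝ} (hR : 0 ≤ R)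
    (hH : 0 ≤ H) {α : V → ℂ} (hα : ∀ j, ‖α j‖ ≤ R) {h : Module.End ℂ (FiniteFock V)} {w : V → ℝ}
    (hw : ∀ j, 0 ≤ w j)
    (hh : ∀ x, hamRate h (powerWeight w k) x ≤ H * weight (powerWeight w (k - 1 + (ℓ - 1))) x)
    (x : FiniteFock V) :
    momentRate (photonDrift ℓ α h) (photonJump ℓ α) (powerWeight w k) x ≤
      weight (fun n => ∑ j, w j *
        (momentConst ℓ k R H - (1 / 2) ^ (ℓ + 1) * ((n j : ℝ) + 1) ^ (k + ℓ - 1))) x := by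
  set e := k - 1 + (ℓ - 1) with he
  have hjump : ∀ j, weight (fun n => (powerWeight w k (Function.update n j (n j - ℓ)) -
      powerWeight w k n) * (n j).descFactorial ℓ) x ≤
      weight (fun n => w j * ((2 * ℓ : ℝ) ^ (k + ℓ - 1) -
        (1 / 2) ^ ℓ * ((n j : ℝ) + 1) ^ (k + ℓ - 1))) x := by
    intro j
    refine weight_mono (fun n => ?_) x
    rw [powerWeight, powerWeight, ← Finset.sum_sub_distrib, Finset.sum_eq_single j]
    · rw [Function.update_self, ← mul_sub, mul_assoc, sub_mul]
      exact mul_le_mul_of_nonneg_left (descFactorial_mul_pow_sub_le hk (by omega) (n j)) (hw j)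
    · intro i _ hij
      rw [Function.update_of_ne hij, sub_self]
    · exact fun h => absurd (Finset.mem_univ j) h
  have hdrive : ∀ j, -(α j ^ ℓ * ⟪((diagonal (fun n => (powerWeight w k n : ℂ)) * annih j ^ ℓ -
      annih j ^ ℓ * diagonal fun n => (powerWeight w k n : ℂ)) x).incl, x.incl⟫_ℂ).re ≤
      R ^ ℓ * (commConst k (ℓ - 1) * weight (fun n => (w j + w j) *
        (((n j : ℝ) + 1) ^ e + ((n j : ℝ) + 1) ^ e)) x) := by
    intro j
    refine (neg_le_abs _).trans ((Complex.abs_re_le_norm _).trans ?_)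
    rw [norm_mul, norm_pow, norm_inner_symm]
    refine mul_le_mul (pow_le_pow_left₀ (norm_nonneg _) (hα j) _) ?_ (norm_nonneg _) (by positivity)
    exact (isLocalShift_annih_pow (S := {j, j}) (by simp) ℓ).norm_inner_commutator_le (by omega) hw k x
  rw [momentRate_photonDrift]
  have h1 : ∑ j, (weight (fun n => (powerWeight w k (Function.update n j (n j - ℓ)) -
      powerWeight w k n) * (n j).descFactorial ℓ) x -
        (α j ^ ℓ * ⟪((diagonal (fun n => (powerWeight w k n : ℂ)) * annih j ^ ℓ -
          annih j ^ ℓ * diagonal fun n => (powerWeight w k n : ℂ)) x).incl, x.incl⟫_ℂ).re) ≤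
      ∑ j, (weight (fun n => w j * ((2 * ℓ : ℝ) ^ (k + ℓ - 1) -
        (1 / 2) ^ ℓ * ((n j : ℝ) + 1) ^ (k + ℓ - 1))) x +
        R ^ ℓ * (commConst k (ℓ - 1) * weight (fun n => (w j + w j) *
        (((n j : ℝ) + 1) ^ e + ((n j : ℝ) + 1) ^ e)) x)) :=
    Finset.sum_le_sum fun j _ => by linarith [hjump j, hdrive j]
  refine (add_le_add (hh x) h1).trans ?_
  simp only [← weight_const_mul, ← weight_add, ← weight_sum]
  refine weight_mono (fun n => ?_) x
  rw [powerWeight, Finset.mul_sum, ← Finset.sum_add_distrib]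
  refine Finset.sum_le_sum fun j _ => ?_
  have hc := commConst_nonneg k (ℓ - 1)
  -- The 4 comes from the two doublings in the drive term, where both sites of the pair are j;
  -- 2^(-(ℓ+1)) is the half of the loss that is spent.
  have h2 := mul_pow_le_mul_pow_succ_add (c := R ^ ℓ * (commConst k (ℓ - 1) * 4) + H)
    (μ := (1 / 2) ^ (ℓ + 1)) (v := (n j : ℝ) + 1) (by positivity) (by positivity) (by positivity) e
  have h3 : e + 1 = k + ℓ - 1 := by omega
  rw [h3] at h2
  have h4 := mul_le_mul_of_nonneg_left h2 (hw j)
  have h5 : (1 / 2 : ℝ) ^ ℓ = 2 * (1 / 2) ^ (ℓ + 1) := by rw [pow_succ]; ring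
  rw [h5, momentConst, ← he]
  linear_combination h4

/-! ### Leakage out of the boxes -/

/-- The part of `M` leaving the boxes is controlled by `W`. -/
def HasLeakBound (W : (V → ℕ) → ℝ) (M : Module.End ℂ (FiniteFock V)) : Prop :=
  ∃ C : ℝ, 0 ≤ C ∧ ∀ N (x : FiniteFock V), cut N x = x →
    ‖(M x - cut N (M x)).incl‖ ≤ C * √(weight W x / (N + 1))

variable {W : (V → ℕ) → ℝ} {M K : Module.End ℂ (FiniteFock V)}

theorem HasLeakBound.add (hM : HasLeakBound W M) (hK : HasLeakBound W K) :
    HasLeakBound W (M + K) := by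
  obtain ⟨C, hC, h1⟩ := hM
  obtain ⟨C', hC', h2⟩ := hK
  refine ⟨C + C', by positivity, fun N x hx => ?_⟩
  rw [LinearMap.add_apply, map_add, add_sub_add_comm, map_add, add_mul]
  exact (norm_add_le _ _).trans (add_le_add (h1 N x hx) (h2 N x hx))

theorem HasLeakBound.smul (hM : HasLeakBound W M) (c : ℂ) : HasLeakBound W (c • M) := by
  obtain ⟨C, hC, h1⟩ := hM
  refine ⟨‖c‖ * C, by positivity, fun N x hx => ?_⟩
  rw [LinearMap.smul_apply, _root_.map_smul, ← smul_sub, _root_.map_smul, norm_smul, mul_assoc]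
  exact mul_le_mul_of_nonneg_left (h1 N x hx) (norm_nonneg _)

theorem HasLeakBound.sub (hM : HasLeakBound W M) (hK : HasLeakBound W K) :
    HasLeakBound W (M - K) := by
  obtain ⟨C, hC, h1⟩ := hM
  obtain ⟨C', hC', h2⟩ := hK
  refine ⟨C + C', by positivity, fun N x hx => ?_⟩
  rw [LinearMap.sub_apply, map_sub (cut N), sub_sub_sub_comm, map_sub, add_mul]
  exact (norm_sub_le _ _).trans (add_le_add (h1 N x hx) (h2 N x hx))

theorem hasLeakBound_diagonal (W : (V → ℕ) → ℝ) (f : (V → ℕ) → ℂ) :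
    HasLeakBound W (diagonal f) := by
  refine ⟨0, le_rfl, fun N x hx => ?_⟩
  have : cut N (diagonal f x) = diagonal f x := cut_eq_self_iff.2 fun n hn => by
    rw [diagonal_apply, cut_eq_self_iff.1 hx n hn, mul_zero]
  rw [this, sub_self, map_zero, norm_zero, zero_mul]

theorem hasLeakBound_annih_pow (W : (V → ℕ) → ℝ) (j : V) (k : ℕ) :
    HasLeakBound W (annih j ^ k) := by
  refine ⟨0, le_rfl, fun N x hx => ?_⟩
  rw [cut_annih_pow hx, sub_self, map_zero, norm_zero, zero_mul]

theorem HasLeakBound.sum {κ : Type*} {s : Finset κ} {A : κ → Module.End ℂ (FiniteFock V)}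
    (h : ∀ i ∈ s, HasLeakBound W (A i)) : HasLeakBound W (∑ i ∈ s, A i) := by
  classical
  induction s using Finset.induction_on with
  | empty => exact ⟨0, le_rfl, fun N x hx => by simp⟩
  | insert i s hi ih =>
    rw [Finset.sum_insert hi]
    exact (h i (Finset.mem_insert_self i s)).add
      (ih fun j hj => h j (Finset.mem_insert_of_mem hj))

/-- A shift of range p leaves the box only if n_l + p + 1 ≥ N + 1 at the most occupied site l. This
gains one factor N + 1 at the price of one more power of n_l, hence the requirement p + 1 ≤ k. -/
theorem IsLocalShift.hasLeakBound {p k : ℕ} {g : (V → ℕ) → ℝ} {τ : (V → ℕ) → V → ℕ} {S : Finset V}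
    (hM : IsLocalShift S p M g τ) (hpk : p + 1 ≤ k) :
    HasLeakBound (powerWeight (fun _ => 1) k) M := by
  refine ⟨√((p + 1 : ℝ) ^ (p + 1)), Real.sqrt_nonneg _, fun N x hx => ?_⟩
  rw [← Real.sqrt_mul (by positivity)]
  refine Real.le_sqrt_of_sq_le ?_
  rw [mul_div_left_comm, mul_comm (weight _ x), ← weight_const_mul]
  have h1 := (hM.1.leak N).norm_sq_apply x
  rw [LinearMap.sub_apply, Module.End.mul_apply] at h1
  rw [h1, weight_eq_sum_box _ hx, weight_eq_sum_box _ hx]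
  refine Finset.sum_le_sum fun n hn => mul_le_mul_of_nonneg_right ?_ (by positivity)
  have h0 : 0 ≤ powerWeight (fun _ => 1) k n := powerWeight_nonneg (fun _ => zero_le_one) k n
  split_ifs with hτ
  · rw [zero_pow two_ne_zero]
    positivity
  · rw [mem_box] at hτ
    push Not at hτ
    obtain ⟨i, hi⟩ := hτ
    have : Nonempty V := ⟨i⟩
    obtain ⟨l, hl⟩ := Finite.exists_max n
    have h2 : g n ^ 2 ≤ ((n l + p + 1 : ℕ) : ℝ) ^ p := hM.2.2.2 n _ fun j _ => by
      have := hl j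
      omega
    have h3 : (N : ℝ) + 1 ≤ ((n l + p + 1 : ℕ) : ℝ) := by
      have h4 := hl i
      have h5 := (hM.2.2.1 n i).1
      exact_mod_cast (by omega : N + 1 ≤ n l + p + 1)
    have h4 : ((n l + p + 1 : ℕ) : ℝ) ≤ (p + 1) * ((n l : ℝ) + 1) := by
      push_cast
      have : (0 : ℝ) ≤ p * n l := by positivity
      linarith
    have h5 : ((n l : ℝ) + 1) ^ k ≤ powerWeight (fun _ => 1) k n := by
      rw [powerWeight, ← one_mul (((n l : ℝ) + 1) ^ k)]
      exact Finset.single_le_sum (f := fun j => 1 * ((n j : ℝ) + 1) ^ k)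
        (fun j _ => by positivity) (Finset.mem_univ l)
    rw [div_mul_eq_mul_div, le_div_iff₀ (by positivity)]
    calc g n ^ 2 * ((N : ℝ) + 1) ≤ ((n l + p + 1 : ℕ) : ℝ) ^ p * ((n l + p + 1 : ℕ) : ℝ) := by
          gcongr
      _ = ((n l + p + 1 : ℕ) : ℝ) ^ (p + 1) := (pow_succ _ _).symm
      _ ≤ ((p + 1) * ((n l : ℝ) + 1)) ^ (p + 1) := by gcongr
      _ = (p + 1) ^ (p + 1) * ((n l : ℝ) + 1) ^ (p + 1) := mul_pow _ _ _
      _ ≤ (p + 1) ^ (p + 1) * ((n l : ℝ) + 1) ^ k := by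
          gcongr
          exact le_add_of_nonneg_left (Nat.cast_nonneg _)
      _ ≤ _ := by gcongr

/-- The term (a†)^ℓ a^ℓ of L†L has too high a degree for `IsLocalShift.hasLeakBound`, but it is
diagonal and does not leak. Powers of a do not leak either, so (a†)^ℓ is the only leaking term in
L†L. -/
theorem hasLeakBound_photonDrift {ℓ : ℕ} (hℓ : 1 ≤ ℓ) (α : V → ℂ)
    {h : Module.End ℂ (FiniteFock V)} (hh : HasLeakBound (powerWeight (fun _ => 1) (2 * ℓ)) h) :
    HasLeakBound (powerWeight (fun _ => 1) (2 * ℓ)) (photonDrift ℓ α h) := by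
  have h1 : ∀ j, HasLeakBound (powerWeight (fun _ => 1) (2 * ℓ))
      (photonJumpDag ℓ α j * photonJump ℓ α j) := by
    intro j
    obtain ⟨g, τ, hc⟩ := (isLocalShift_creat (Finset.mem_univ j)).exists_pow ℓ
    have hA := isLocalShift_annih_pow (Finset.mem_univ j) ℓ
    have h2 : photonJumpDag ℓ α j * photonJump ℓ α j = creat j ^ ℓ * annih j ^ ℓ +
        (-(α j ^ ℓ)) • creat j ^ ℓ + (-((starRingEnd ℂ (α j)) ^ ℓ)) • annih j ^ ℓ +
        ((starRingEnd ℂ (α j)) ^ ℓ * α j ^ ℓ) • annih j ^ 0 := by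
      refine LinearMap.ext fun x => ?_
      simp only [photonJumpDag, photonJump, Module.End.mul_apply, LinearMap.sub_apply,
        LinearMap.add_apply, LinearMap.smul_apply, Module.End.one_apply, map_sub, _root_.map_smul,
        pow_zero]
      module
    rw [h2]
    refine HasLeakBound.add (HasLeakBound.add (HasLeakBound.add ?_ ?_) ?_) ?_
    · rw [hA.1.adjoint_mul_self ((isAdjoint_annih_creat j).pow ℓ)]
      exact hasLeakBound_diagonal _ _
    · exact (hc.hasLeakBound (by omega)).smul _
    · exact (hasLeakBound_annih_pow _ j ℓ).smul _
    · exact (hasLeakBound_annih_pow _ j 0).smul _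
  exact (hh.smul _).sub ((HasLeakBound.sum fun j _ => h1 j).smul _)

/-- Generation theorem for photon dissipation with a Hamiltonian of relative strength `H`. -/
theorem exists_isQMS_photonDissipation {ℓ : ℕ} (hℓ : 2 ≤ ℓ) (α : V → ℂ)
    {h : Module.End ℂ (FiniteFock V)} (hadj : IsAdjoint h h) {H : ℝ} (hH : 0 ≤ H)
    (hham : ∀ x, hamRate h (powerWeight (fun _ => 1) (2 * ℓ)) x ≤
      H * weight (powerWeight (fun _ => 1) (2 * ℓ - 1 + (ℓ - 1))) x)
    (hleak : HasLeakBound (powerWeight (fun _ => 1) (2 * ℓ)) h) :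
    ∃ T : ℝ → TraceClass (FockSpace V) →L[ℂ] TraceClass (FockSpace V), IsQMS T ∧
      ClosureGenerates (photonDissipation ℓ α h) T ∧ ∀ t, 0 ≤ t → ∀ X,
        Filter.Tendsto (fun N => expSG (truncLindblad (photonDrift ℓ α h) (photonJump ℓ α) N) t X)
          Filter.atTop (𝓝 (T t X)) := by
  obtain ⟨C, hC, hCl⟩ := hasLeakBound_photonDrift (by omega) α hleak
  -- For generation alone the constants may depend on the number of modes, so a crude bound on the
  -- drives suffices.
  set R := ∑ j, ‖α j‖ with hR
  have hR0 : 0 ≤ R := Finset.sum_nonneg fun _ _ => norm_nonneg _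
  have hw : ∀ j : V, (0 : ℝ) ≤ (fun _ => 1) j := fun _ => zero_le_one
  have hb := momentRate_photonDrift_le hℓ (k := 2 * ℓ) (by omega) hR0 hH (α := α)
    (fun j => Finset.single_le_sum (f := fun j => ‖α j‖) (fun _ _ => norm_nonneg _)
      (Finset.mem_univ j)) hw hham
  have hmc := momentConst_nonneg ℓ (2 * ℓ) hR0 hH
  rw [photonDissipation_eq_driftGraph]
  refine exists_isQMS_of_hasMomentBound (W := powerWeight (fun _ => 1) (2 * ℓ))
    (ω := momentConst ℓ (2 * ℓ) R H) (C := C ^ 2) (isConservative_photonDrift ℓ α hadj)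
    ⟨hmc, sq_nonneg C, powerWeight_nonneg hw _, fun x => (hb x).trans (weight_mono (fun n => ?_) x),
      fun N x hx => ?_⟩
  -- Dropping the loss term and using (n + 1)^(2ℓ) ≥ 1 turns the constant into a multiple of the
  -- moment itself.
  · rw [powerWeight, Finset.mul_sum]
    refine Finset.sum_le_sum fun j _ => ?_
    have h1 : (1 : ℝ) ≤ ((n j : ℝ) + 1) ^ (2 * ℓ) :=
      one_le_pow₀ (le_add_of_nonneg_left (Nat.cast_nonneg _))
    have h2 : (0 : ℝ) ≤ (1 / 2) ^ (ℓ + 1) * ((n j : ℝ) + 1) ^ (2 * ℓ + ℓ - 1) := by positivity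
    have h3 := mul_le_mul_of_nonneg_left h1 hmc
    linarith
  · have h1 := pow_le_pow_left₀ (norm_nonneg _) (hCl N x hx) 2
    have h2 := weight_nonneg (powerWeight_nonneg hw (2 * ℓ)) x
    rw [mul_pow, Real.sq_sqrt (by positivity)] at h1
    rwa [div_mul_eq_mul_div, ← mul_div_assoc] at *

end PhotonDissipation


/-! ### Two-body Hamiltonians -/

section PairHamiltonian

variable {V : Type*} [DecidableEq V]

theorem sum_le_of_mem_degreeLE {d : ℕ} {u : Fin 4 → ℕ} (hu : u ∈ degreeLE d) :
    u 0 + u 2 + u 1 + u 3 ≤ d := by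
  have := (Finset.mem_filter.1 hu).2
  rw [Fin.sum_univ_four] at this
  omega

variable [Fintype V]

theorem exists_isLocalShift_monomial {S : Finset V} {i j : V} (hi : i ∈ S) (hj : j ∈ S)
    (a b c e : ℕ) : ∃ g τ, IsLocalShift S (a + b + c + e)
      (annih i ^ a * annih j ^ b * creat i ^ c * creat j ^ e) g τ := by
  obtain ⟨_, _, h3⟩ := (isLocalShift_creat hi).exists_pow c
  obtain ⟨_, _, h4⟩ := (isLocalShift_creat hj).exists_pow e
  rw [mul_one] at h3 h4
  exact ⟨_, _, (((isLocalShift_annih_pow hi a).mul (isLocalShift_annih_pow hj b)).mul h3).mul h4⟩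

theorem isAdjoint_monomial (i j : V) (a b c e : ℕ) :
    IsAdjoint (annih i ^ a * annih j ^ b * creat i ^ c * creat j ^ e)
      (annih j ^ e * annih i ^ c * creat j ^ b * creat i ^ a) := by
  have h := ((((isAdjoint_annih_creat i).pow a).mul ((isAdjoint_annih_creat j).pow b)).mul
    ((isAdjoint_annih_creat i).symm.pow c)).mul ((isAdjoint_annih_creat j).symm.pow e)
  simpa only [mul_assoc] using h

theorem isAdjoint_pairHamiltonian (d : ℕ) (c : (Fin 4 → ℕ) → ℂ) (i j : V) :
    IsAdjoint (pairHamiltonian d c i j) (pairHamiltonian d c i j) := by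
  refine IsAdjoint.sum fun u _ => ?_
  have h := isAdjoint_monomial i j (u 0) (u 2) (u 1) (u 3)
  have h2 := (h.smul (c u)).add (h.symm.smul (starRingEnd ℂ (c u)))
  rw [Complex.conj_conj] at h2
  rwa [add_comm (starRingEnd ℂ (c u) • _) (c u • _)] at h2

theorem hamRate_pairHamiltonian_le {d q : ℕ} (hdq : d ≤ 2 * q) {Λ : ℝ} {c : (Fin 4 → ℕ) → ℂ}
    (hc : ∀ u, ‖c u‖ ≤ Λ) (i j : V) {w : V → ℝ} (hw : ∀ l, 0 ≤ w l) (k : ℕ) (x : FiniteFock V) :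
    hamRate (pairHamiltonian d c i j) (powerWeight w k) x ≤
      (degreeLE d).card * (2 * (Λ * commConst k q)) * weight (fun n => (w i + w j) *
        (((n i : ℝ) + 1) ^ (k - 1 + q) + ((n j : ℝ) + 1) ^ (k - 1 + q))) x := by
  rw [pairHamiltonian, hamRate_sum, mul_assoc, ← nsmul_eq_mul]
  refine Finset.sum_le_card_nsmul _ _ _ fun u hu => ?_
  refine (hamRate_symmetrized_le (isAdjoint_monomial i j (u 0) (u 2) (u 1) (u 3)) _ _ _).trans ?_
  obtain ⟨g, τ, h⟩ := exists_isLocalShift_monomial (S := {i, j}) (i := i) (j := j) (by simp) (by simp)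
    (u 0) (u 2) (u 1) (u 3)
  have h1 := h.norm_inner_commutator_le ((sum_le_of_mem_degreeLE hu).trans hdq) hw k x
  rw [mul_assoc 2 (Λ * _), mul_assoc Λ]
  refine mul_le_mul_of_nonneg_left ?_ zero_le_two
  exact mul_le_mul (hc u) h1 (norm_nonneg _) ((norm_nonneg _).trans (hc u))

/-- The squared coefficient is governed by the more occupied of the two sites, which is one of the
sites summed over in `B`; the dependence on all other modes disappears. -/
theorem IsLocalShift.norm_apply_le {B : Finset V} {i j : V} (hi : i ∈ B) (hj : j ∈ B) {p d : ℕ}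
    (hpd : p ≤ d) {M : Module.End ℂ (FiniteFock V)} {g : (V → ℕ) → ℝ} {τ : (V → ℕ) → V → ℕ}
    (hM : IsLocalShift {i, j} p M g τ) (x : FiniteFock V) :
    ‖(M x).incl‖ ≤ √((d + 1) ^ d) * √(weight (fun n => ∑ b ∈ B, ((n b : ℝ) + 1) ^ d) x) := by
  rw [← Real.sqrt_mul (by positivity)]
  refine Real.le_sqrt_of_sq_le ?_
  rw [hM.1.norm_sq_apply, ← weight_const_mul]
  refine weight_mono (fun n => ?_) x
  have key : ∀ l ∈ B, (∀ i' ∈ ({i, j} : Finset V), n i' ≤ n l) →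
      g n ^ 2 ≤ (d + 1) ^ d * ∑ b ∈ B, ((n b : ℝ) + 1) ^ d := by
    intro l hl hmax
    have h1 := hM.2.2.2 n (n l + d + 1) fun i' hi' => by
      have := hmax i' hi'
      omega
    have h2 : ((n l + d + 1 : ℕ) : ℝ) ≤ (d + 1) * ((n l : ℝ) + 1) := by
      push_cast
      have : (0 : ℝ) ≤ d * n l := by positivity
      linarith
    have h3 : (1 : ℝ) ≤ ((n l + d + 1 : ℕ) : ℝ) := by
      push_cast
      exact le_add_of_nonneg_left (by positivity)
    calc g n ^ 2 ≤ ((n l + d + 1 : ℕ) : ℝ) ^ p := h1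
      _ ≤ ((n l + d + 1 : ℕ) : ℝ) ^ d := pow_le_pow_right₀ h3 hpd
      _ ≤ ((d + 1) * ((n l : ℝ) + 1)) ^ d := by gcongr
      _ = (d + 1) ^ d * ((n l : ℝ) + 1) ^ d := mul_pow _ _ _
      _ ≤ _ := by
        gcongr
        exact Finset.single_le_sum (f := fun b => ((n b : ℝ) + 1) ^ d) (fun _ _ => by positivity) hl
  rcases le_total (n i) (n j) with h | h
  · exact key j hj fun i' hi' => by
      simp only [Finset.mem_insert, Finset.mem_singleton] at hi'
      rcases hi' with rfl | rfl
      · exact h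
      · exact le_rfl
  · exact key i hi fun i' hi' => by
      simp only [Finset.mem_insert, Finset.mem_singleton] at hi'
      rcases hi' with rfl | rfl
      · exact le_rfl
      · exact h

theorem norm_pairHamiltonian_le {B : Finset V} {i j : V} (hi : i ∈ B) (hj : j ∈ B) (d : ℕ) {Λ : ℝ}
    {c : (Fin 4 → ℕ) → ℂ} (hc : ∀ u, ‖c u‖ ≤ Λ) (x : FiniteFock V) :
    ‖(pairHamiltonian d c i j x).incl‖ ≤ (degreeLE d).card *
      (2 * Λ * (√((d + 1) ^ d) * √(weight (fun n => ∑ b ∈ B, ((n b : ℝ) + 1) ^ d) x))) := by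
  rw [pairHamiltonian, LinearMap.sum_apply, map_sum, ← nsmul_eq_mul]
  refine (norm_sum_le _ _).trans (Finset.sum_le_card_nsmul _ _ _ fun u hu => ?_)
  have hd := sum_le_of_mem_degreeLE hu
  obtain ⟨g, τ, h⟩ := exists_isLocalShift_monomial (S := {i, j}) (i := i) (j := j) (by simp) (by simp)
    (u 0) (u 2) (u 1) (u 3)
  obtain ⟨f, σ, h'⟩ := exists_isLocalShift_monomial (S := {i, j}) (i := j) (j := i) (by simp) (by simp)
    (u 3) (u 1) (u 2) (u 0)
  have h1 := h.norm_apply_le hi hj hd x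
  have h2 := h'.norm_apply_le hi hj (d := d) (by omega) x
  rw [LinearMap.add_apply, LinearMap.smul_apply, LinearMap.smul_apply, map_add, _root_.map_smul,
    _root_.map_smul]
  refine (norm_add_le _ _).trans ?_
  rw [norm_smul, norm_smul, RCLike.norm_conj, two_mul, add_mul]
  exact add_le_add (mul_le_mul (hc u) h1 (norm_nonneg _) ((norm_nonneg _).trans (hc u)))
    (mul_le_mul (hc u) h2 (norm_nonneg _) ((norm_nonneg _).trans (hc u)))

theorem hasLeakBound_pairHamiltonian {d k : ℕ} (hdk : d + 1 ≤ k) (c : (Fin 4 → ℕ) → ℂ) (i j : V) :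
    HasLeakBound (powerWeight (fun _ => 1) k) (pairHamiltonian d c i j) := by
  refine HasLeakBound.sum fun u hu => ?_
  have hd := sum_le_of_mem_degreeLE hu
  obtain ⟨g, τ, h⟩ := exists_isLocalShift_monomial (S := Finset.univ) (Finset.mem_univ i)
    (Finset.mem_univ j) (u 0) (u 2) (u 1) (u 3)
  obtain ⟨f, σ, h'⟩ := exists_isLocalShift_monomial (S := Finset.univ) (Finset.mem_univ j)
    (Finset.mem_univ i) (u 3) (u 1) (u 2) (u 0)
  exact ((h.hasLeakBound (by omega)).smul _).add ((h'.hasLeakBound (by omega)).smul _)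

end PairHamiltonian

/-! ### Two-body Hamiltonians on the lattice, with bounds uniform in the number of modes -/

section LatticeHamiltonian

variable {D : ℕ} {V : Finset (Fin D → ℤ)}

theorem LatticeEdge.symm {i j : Fin D → ℤ} (h : LatticeEdge i j) : LatticeEdge j i := by
  rcases h with h | h
  · exact Or.inl h.symm
  · exact Or.inr (by simpa only [abs_sub_comm] using h)

theorem LatticeEdge.sum_abs_sub_le {i j : Fin D → ℤ} (h : LatticeEdge i j) :
    ∑ s, |i s - j s| ≤ 1 := by
  rcases h with rfl | h
  · simp
  · exact h.le

-- A neighbour lies in the cube of side 3 around the site.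
open Classical in
theorem card_latticeEdge_le (i : V) :
    (Finset.univ.filter fun j : V => LatticeEdge i.1 j.1).card ≤ 3 ^ D := by
  have h1 : (Finset.univ.filter fun j : V => LatticeEdge i.1 j.1).card ≤
      (Fintype.piFinset fun s => Finset.Icc (i.1 s - 1) (i.1 s + 1)).card := by
    refine Finset.card_le_card_of_injOn Subtype.val (fun j hj => ?_) Subtype.val_injective.injOn
    rw [Finset.mem_coe, Finset.mem_filter] at hj
    rw [Finset.mem_coe, Fintype.mem_piFinset]
    intro s
    have h2 := (Finset.single_le_sum (f := fun s => |i.1 s - j.1 s|) (fun _ _ => abs_nonneg _)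
      (Finset.mem_univ s)).trans hj.2.sum_abs_sub_le
    have h3 := abs_le.1 h2
    rw [Finset.mem_Icc]
    constructor <;> linarith [h3.1, h3.2]
  refine h1.trans (le_of_eq ?_)
  rw [Fintype.card_piFinset]
  have h4 : ∀ a : ℤ, (Finset.Icc (a - 1) (a + 1)).card = 3 := fun a => by
    rw [Int.card_Icc]
    omega
  simp [h4]

theorem isAdjoint_latticeHamiltonian (B : Finset V) (d : ℕ) (c : V → V → (Fin 4 → ℕ) → ℂ) :
    IsAdjoint (latticeHamiltonian B d c) (latticeHamiltonian B d c) :=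
  IsAdjoint.sum fun i _ => IsAdjoint.sum fun j _ => isAdjoint_pairHamiltonian d (c i j) i j

theorem hasLeakBound_latticeHamiltonian (B : Finset V) {d k : ℕ} (hdk : d + 1 ≤ k)
    (c : V → V → (Fin 4 → ℕ) → ℂ) :
    HasLeakBound (powerWeight (fun _ => 1) k) (latticeHamiltonian B d c) :=
  HasLeakBound.sum fun i _ => HasLeakBound.sum fun j _ =>
    hasLeakBound_pairHamiltonian hdk (c i j) i j

theorem norm_latticeHamiltonian_le (B : Finset V) (d : ℕ) {Λ : ℝ} (hΛ : 0 ≤ Λ)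
    {c : V → V → (Fin 4 → ℕ) → ℂ} (hc : ∀ i j u, ‖c i j u‖ ≤ Λ) (x : FiniteFock V) :
    ‖(latticeHamiltonian B d c x).incl‖ ≤ B.card * (B.card * ((degreeLE d).card *
      (2 * Λ * (√((d + 1) ^ d) * √(weight (fun n => ∑ b ∈ B, ((n b : ℝ) + 1) ^ d) x))))) := by
  classical
  rw [latticeHamiltonian, LinearMap.sum_apply, map_sum, ← nsmul_eq_mul B.card]
  refine (norm_sum_le _ _).trans (Finset.sum_le_card_nsmul _ _ _ fun i hi => ?_)
  rw [LinearMap.sum_apply, map_sum, ← nsmul_eq_mul B.card]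
  refine (norm_sum_le _ _).trans ((Finset.sum_le_card_nsmul _ _ _ fun j hj =>
    norm_pairHamiltonian_le hi (Finset.mem_filter.1 hj).1 d (hc i j) x).trans ?_)
  exact nsmul_le_nsmul_left (by positivity) (Finset.card_filter_le _ _)

/-- The relative strength of a lattice Hamiltonian. -/
noncomputable def hamConst (D d q k : ℕ) (Λ K : ℝ) : ℝ :=
  (degreeLE d).card * (2 * (Λ * commConst k q)) * ((1 + K) * (2 * 3 ^ D))

theorem hamConst_nonneg (D d q k : ℕ) {Λ K : ℝ} (hΛ : 0 ≤ Λ) (hK : 0 ≤ K) :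
    0 ≤ hamConst D d q k Λ K := by
  have := commConst_nonneg k q
  unfold hamConst
  positivity

-- Comparability of neighbouring weights lets each edge be charged to its two endpoints with their
-- own weights, and each site has at most 3^D neighbours. So the weighted sum over edges is a
-- multiple of the weighted sum over sites, however many sites there are.
open Classical in
theorem hamRate_latticeHamiltonian_le (B : Finset V) {d q : ℕ} (hdq : d ≤ 2 * q) {Λ K : ℝ}
    (hΛ : 0 ≤ Λ) (hK : 0 ≤ K) {c : V → V → (Fin 4 → ℕ) → ℂ} (hc : ∀ i j u, ‖c i j u‖ ≤ Λ)
    {w : V → ℝ} (hw : ∀ l, 0 ≤ w l) (hwK : ∀ i j : V, LatticeEdge i.1 j.1 → w i ≤ K * w j) (k : ℕ)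
    (x : FiniteFock V) :
    hamRate (latticeHamiltonian B d c) (powerWeight w k) x ≤
      hamConst D d q k Λ K * weight (powerWeight w (k - 1 + q)) x := by
  set e := k - 1 + q with he
  set C : ℝ := (degreeLE d).card * (2 * (Λ * commConst k q)) with hC
  have hC0 : 0 ≤ C := by
    have := commConst_nonneg k q
    positivity
  have hpair : ∀ i j, LatticeEdge i.1 j.1 → hamRate (pairHamiltonian d (c i j) i j) (powerWeight w k) x ≤
      C * ((1 + K) * (w i * weight (fun n => ((n i : ℝ) + 1) ^ e) x +
        w j * weight (fun n => ((n j : ℝ) + 1) ^ e) x)) := by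
    intro i j hij
    refine (hamRate_pairHamiltonian_le hdq (hc i j) i j hw k x).trans ?_
    refine mul_le_mul_of_nonneg_left ?_ hC0
    rw [← weight_const_mul, ← weight_const_mul, ← weight_add, ← weight_const_mul]
    refine weight_mono (fun n => ?_) x
    have h1 : (0 : ℝ) ≤ ((n i : ℝ) + 1) ^ e := by positivity
    have h2 : (0 : ℝ) ≤ ((n j : ℝ) + 1) ^ e := by positivity
    have h3 := mul_le_mul_of_nonneg_right (hwK i j hij) h2
    have h4 := mul_le_mul_of_nonneg_right (hwK j i hij.symm) h1
    linear_combination h3 + h4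
  have hnn : ∀ i, 0 ≤ w i * weight (fun n => ((n i : ℝ) + 1) ^ e) x := fun i =>
    mul_nonneg (hw i) (weight_nonneg (fun n => by positivity) x)
  set f : V → ℝ := fun i => w i * weight (fun n => ((n i : ℝ) + 1) ^ e) x with hf
  have hdeg : ∑ i, ∑ j ∈ Finset.univ.filter (fun j : V => LatticeEdge i.1 j.1), f i ≤ 3 ^ D * ∑ i, f i := by
    rw [Finset.mul_sum]
    refine Finset.sum_le_sum fun i _ => ?_
    rw [Finset.sum_const, nsmul_eq_mul]
    refine mul_le_mul_of_nonneg_right ?_ (hnn i)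
    exact_mod_cast card_latticeEdge_le i
  have hswap : ∑ i : V, ∑ j ∈ Finset.univ.filter (fun j : V => LatticeEdge i.1 j.1), f j =
      ∑ i, ∑ j ∈ Finset.univ.filter (fun j : V => LatticeEdge i.1 j.1), f i :=
    Finset.sum_comm' fun i j => by
      simp only [Finset.mem_univ, Finset.mem_filter, true_and, and_true]
      exact ⟨fun h => h.symm, fun h => h.symm⟩
  have hweight : weight (powerWeight w e) x = ∑ i, f i := by
    have h1 : powerWeight w e = fun n => ∑ j, w j * ((n j : ℝ) + 1) ^ e := rfl
    rw [h1, weight_sum]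
    exact Finset.sum_congr rfl fun i _ => weight_const_mul _ _ _
  calc hamRate (latticeHamiltonian B d c) (powerWeight w k) x
      ≤ ∑ i ∈ B, ∑ j ∈ B.filter (fun j => LatticeEdge i.1 j.1), C * ((1 + K) * (f i + f j)) := by
        rw [latticeHamiltonian, hamRate_sum]
        refine Finset.sum_le_sum fun i _ => ?_
        rw [hamRate_sum]
        exact Finset.sum_le_sum fun j hj => hpair i j (Finset.mem_filter.1 hj).2
    _ ≤ ∑ i, ∑ j ∈ Finset.univ.filter (fun j : V => LatticeEdge i.1 j.1), C * ((1 + K) * (f i + f j)) := by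
        have h0 : ∀ i j, 0 ≤ C * ((1 + K) * (f i + f j)) := fun i j => by
          have := hnn i
          have := hnn j
          positivity
        refine (Finset.sum_le_sum fun i _ => Finset.sum_le_sum_of_subset_of_nonneg
          (Finset.filter_subset_filter _ (Finset.subset_univ B)) fun j _ _ => h0 i j).trans ?_
        exact Finset.sum_le_sum_of_subset_of_nonneg (Finset.subset_univ B) fun i _ _ =>
          Finset.sum_nonneg fun j _ => h0 i j
    _ = C * ((1 + K) * (2 * ∑ i, ∑ j ∈ Finset.univ.filter (fun j : V => LatticeEdge i.1 j.1), f i)) := by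
        simp only [← Finset.mul_sum, Finset.sum_add_distrib, hswap]
        rw [two_mul]
    _ ≤ C * ((1 + K) * (2 * (3 ^ D * ∑ i, f i))) := by gcongr
    _ = _ := by
        rw [hweight, hamConst]
        ring

end LatticeHamiltonian


/-! ### Instantaneous moment bounds -/

section InstantaneousMoments

/-- Functions satisfying the Riccati inequality `E' ≤ q c - (a / q) E²` are bounded at positive
times, independently of the initial value. -/
theorem le_of_riccati {E : ℝ → ℝ} {a c q κ : ℝ} (hq : 0 < q) (ha : 0 < a) (hκ : 0 < κ)
    (hc : c ≤ a * κ ^ 2)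
    (hE : ∀ s, 0 ≤ s → ∃ e, HasDerivAt E e s ∧ e ≤ q * c - a / q * E s ^ 2) {t : ℝ} (ht : 0 < t) :
    E t ≤ q * (κ + 1 / (a * t)) := by
  choose e he hle using hE
  have hcont : ∀ s, 0 ≤ s → ContinuousAt E s := fun s hs => (he s hs).continuousAt
  -- The barrier κ + 1/(as), times q, blows up at 0, so it exceeds E at some small time whatever E 0
  -- is.
  obtain ⟨s₀, hs₀, hs₀t, hEs₀⟩ : ∃ s, 0 < s ∧ s < t ∧ E s ≤ q * (κ + 1 / (a * s)) := by
    have h1 : Filter.Tendsto (fun s : ℝ => q * (κ + 1 / (a * s))) (𝓝[>] 0) Filter.atTop := by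
      refine Filter.Tendsto.const_mul_atTop hq (Filter.tendsto_atTop_add_const_left _ _ ?_)
      have h2 : Filter.Tendsto (fun s : ℝ => a⁻¹ * s⁻¹) (𝓝[>] 0) Filter.atTop :=
        tendsto_inv_nhdsGT_zero.const_mul_atTop (inv_pos.2 ha)
      refine h2.congr fun s => ?_
      rw [one_div, mul_inv]
    have h3 : ∀ᶠ s in 𝓝[>] (0 : ℝ), E s < E 0 + 1 :=
      ((hcont 0 le_rfl).tendsto.mono_left nhdsWithin_le_nhds).eventually
        (gt_mem_nhds (by linarith))
    have h4 : ∀ᶠ s in 𝓝[>] (0 : ℝ), s < t := nhdsWithin_le_nhds (gt_mem_nhds ht)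
    obtain ⟨s, hs1, hs2, hs3, hs4⟩ := (h3.and (h4.and
      ((h1.eventually_ge_atTop (E 0 + 1)).and self_mem_nhdsWithin))).exists
    exact ⟨s, hs4, hs2, hs1.le.trans hs3⟩
  have hBd : ∀ s, 0 < s → HasDerivAt (fun s : ℝ => q * (κ + 1 / (a * s))) (-(q / (a * s ^ 2))) s := by
    intro s hs
    have h1 := (((hasDerivAt_inv hs.ne').const_mul a⁻¹).const_add κ).const_mul q
    have h2 : (fun s : ℝ => q * (κ + 1 / (a * s))) = fun s => q * (κ + a⁻¹ * s⁻¹) := by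
      funext s
      rw [one_div, mul_inv]
    rw [h2]
    refine h1.congr_deriv ?_
    field_simp
  refine image_le_of_deriv_right_lt_deriv_boundary' (f := E) (f' := fun s => if h : 0 ≤ s then e s h else 0)
    (a := s₀) (b := t) (B := fun s => q * (κ + 1 / (a * s))) (B' := fun s => -(q / (a * s ^ 2)))
    (fun s hs => (hcont s (hs₀.le.trans hs.1)).continuousWithinAt) (fun s hs => ?_) hEs₀
    (fun s hs => (hBd s (hs₀.trans_le hs.1)).continuousAt.continuousWithinAt)
    (fun s hs => (hBd s (hs₀.trans_le hs.1)).hasDerivWithinAt) (fun s hs h => ?_) ⟨hs₀t.le, le_rfl⟩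
  · rw [dif_pos (hs₀.le.trans hs.1)]
    exact (he s _).hasDerivWithinAt
  · have hs0 : 0 < s := hs₀.trans_le hs.1
    rw [dif_pos hs0.le]
    refine (hle s hs0.le).trans_lt ?_
    rw [h]
    -- On the barrier the square produces three terms: the first cancels qc, the last is the
    -- derivative of the barrier, and the cross term makes the inequality strict.
    have h1 : a / q * (q * (κ + 1 / (a * s))) ^ 2 = q * (a * κ ^ 2) + q * (2 * κ / s) +
        q / (a * s ^ 2) := by
      field_simp
      ring
    have h2 : 0 < q * (2 * κ / s) := by positivity
    have h3 := mul_le_mul_of_nonneg_left hc hq.le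
    linarith

variable {V : Type*} [DecidableEq V] [Fintype V] {ι : Type*} [Fintype ι]
  {G : Module.End ℂ (FiniteFock V)} {L : ι → Module.End ℂ (FiniteFock V)}

theorem re_boxExpectation_affine (N : ℕ) (a b : ℝ) (W : (V → ℕ) → ℝ) (X : TraceClass (FockSpace V)) :
    (boxExpectation N (fun n => a + b * W n) X).re =
      a * (boxExpectation N (fun _ => 1) X).re + b * (boxExpectation N W X).re := by
  simp only [boxExpectation, _root_.sum_apply, _root_.smul_apply, Complex.re_sum, Finset.mul_sum,
    smul_eq_mul, Complex.re_ofReal_mul, ← Finset.sum_add_distrib]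
  exact Finset.sum_congr rfl fun n _ => by ring

theorem re_boxExpectation_mono {N : ℕ} {x : FiniteFock V} (h : IsConservative G L)
    (hx : cut N x = x) {t : ℝ} (ht : 0 ≤ t) {W Z : (V → ℕ) → ℝ} (hWZ : ∀ n, W n ≤ Z n) :
    (boxExpectation N W (expSG (truncLindblad G L N) t (ketBra x.incl x.incl))).re ≤
      (boxExpectation N Z (expSG (truncLindblad G L N) t (ketBra x.incl x.incl))).re := by
  obtain ⟨y, hy, hyX, -⟩ := exists_expSG_truncLindblad_eq_sum h hx ht
  rw [hyX, map_sum, map_sum, Complex.re_sum, Complex.re_sum]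
  refine Finset.sum_le_sum fun n _ => ?_
  rw [boxExpectation_ketBra_self W (hy n), boxExpectation_ketBra_self Z (hy n), Complex.ofReal_re,
    Complex.ofReal_re]
  exact weight_mono hWZ _

theorem re_boxExpectation_one {N : ℕ} {x : FiniteFock V} (h : IsConservative G L)
    (hx : cut N x = x) {t : ℝ} (ht : 0 ≤ t) :
    (boxExpectation N (fun _ => 1) (expSG (truncLindblad G L N) t (ketBra x.incl x.incl))).re =
      ‖x.incl‖ ^ 2 := by
  obtain ⟨y, hy, hyX, hyn⟩ := exists_expSG_truncLindblad_eq_sum h hx ht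
  rw [hyX, map_sum, Complex.re_sum, ← hyn]
  refine Finset.sum_congr rfl fun n _ => ?_
  rw [boxExpectation_ketBra_self _ (hy n), Complex.ofReal_re, weight_one]

/-- Strong dissipation bounds the moments at positive times, independently of the initial state. -/
theorem boxExpectation_powerWeight_le (h : IsConservative G L) {w : V → ℝ} (hw : ∀ j, 0 ≤ w j)
    {k : ℕ} {C μ Q κ : ℝ} (hC : 0 ≤ C) (hμ : 0 < μ) (hQ : 0 < Q) (hwQ : ∑ j, w j ≤ Q)
    (hrate : ∀ x, momentRate G L (powerWeight w k) x ≤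
      weight (fun n => ∑ j, w j * (C - μ * ((n j : ℝ) + 1) ^ (2 * k))) x)
    (hκ : 0 < κ) (hCκ : Q * C ≤ μ / Q * κ ^ 2) {N : ℕ} {x : FiniteFock V} (hx : cut N x = x)
    (hx0 : 0 < ‖x.incl‖) {t : ℝ} (ht : 0 < t) :
    (boxExpectation N (powerWeight w k) (expSG (truncLindblad G L N) t (ketBra x.incl x.incl))).re ≤
      ‖x.incl‖ ^ 2 * (κ + 1 / (μ / Q * t)) := by
  refine le_of_riccati (E := fun s => (boxExpectation N (powerWeight w k)
    (expSG (truncLindblad G L N) s (ketBra x.incl x.incl))).re) (by positivity) (by positivity) hκ hCκ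
    (fun s hs => ?_) ht
  set E := (boxExpectation N (powerWeight w k)
    (expSG (truncLindblad G L N) s (ketBra x.incl x.incl))).re with hE
  set q := ‖x.incl‖ ^ 2 with hq
  have hq0 : 0 < q := by positivity
  -- Jensen's inequality in tangent form: v^(2k) ≥ 2r v^k - r² for every r. This choice of r is
  -- optimal and turns the loss term into -(μ/Q) E²/q.
  set r := E / (q * Q) with hr
  have hpt : ∀ n : V → ℕ, ∑ j, w j * (C - μ * ((n j : ℝ) + 1) ^ (2 * k)) ≤
      Q * (C + μ * r ^ 2) + -(2 * μ * r) * powerWeight w k n := by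
    intro n
    have h1 : ∑ j, w j * (C - μ * ((n j : ℝ) + 1) ^ (2 * k)) ≤
        ∑ j, (w j * (C + μ * r ^ 2) + -(2 * μ * r) * (w j * ((n j : ℝ) + 1) ^ k)) := by
      refine Finset.sum_le_sum fun j _ => ?_
      have h2 := mul_nonneg (mul_nonneg (hw j) hμ.le) (sq_nonneg (((n j : ℝ) + 1) ^ k - r))
      rw [mul_comm 2 k, pow_mul]
      linear_combination h2
    rw [Finset.sum_add_distrib, ← Finset.mul_sum, ← Finset.sum_mul] at h1
    have h3 := mul_le_mul_of_nonneg_right hwQ (by positivity : 0 ≤ C + μ * r ^ 2)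
    rw [powerWeight]
    linarith
  obtain ⟨e, he, hle⟩ := exists_hasDerivAt_boxExpectation h hx (W := powerWeight w k)
    (Z := fun n => Q * (C + μ * r ^ 2) + -(2 * μ * r) * powerWeight w k n)
    (fun x => (hrate x).trans (weight_mono hpt x)) hs
  refine ⟨e, he, hle.trans (le_of_eq ?_)⟩
  rw [re_boxExpectation_affine, re_boxExpectation_one h hx hs, ← hE, ← hq, hr]
  field_simp
  ring

/-- Interpolation between moments. -/
theorem pow_le_rpow_mul_one_add {m k : ℕ} (hk : 0 < k) (hmk : m ≤ k) {A v : ℝ} (hA : 0 < A)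
    (hv : 0 ≤ v) : v ^ m ≤ A ^ ((m : ℝ) / k) * (1 + 1 / A * v ^ k) := by
  have hk' : (0 : ℝ) < k := Nat.cast_pos.2 hk
  have hx0 : (0 : ℝ) ≤ (m : ℝ) / k := by positivity
  have hx1 : (m : ℝ) / k ≤ 1 := (div_le_one hk').2 (by exact_mod_cast hmk)
  have h1 : v ^ m = A ^ ((m : ℝ) / k) * (1 / A * v ^ k) ^ ((m : ℝ) / k) := by
    rw [← Real.mul_rpow hA.le (by positivity), ← mul_assoc, mul_one_div_cancel hA.ne', one_mul,
      ← Real.rpow_natCast v k, ← Real.rpow_mul hv, mul_div_cancel₀ _ hk'.ne', Real.rpow_natCast]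
  rw [h1]
  refine mul_le_mul_of_nonneg_left ?_ (by positivity)
  have h2 : 0 ≤ 1 / A * v ^ k := by positivity
  rcases le_total (1 / A * v ^ k) 1 with h | h
  · exact (Real.rpow_le_one h2 h hx0).trans (by linarith)
  · exact (Real.rpow_le_self_of_one_le h hx1).trans (by linarith)

end InstantaneousMoments

/-! ### Perturbation of the drift -/

section Perturbation

variable {V : Type*} [DecidableEq V] [Fintype V] {ι : Type*} [Fintype ι]
  {G G' : Module.End ℂ (FiniteFock V)} {L : ι → Module.End ℂ (FiniteFock V)}

theorem norm_truncLindblad_sub_drift_le (h : IsConservative G L) (h' : IsConservative G' L) {N : ℕ}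
    {y : FiniteFock V} (hy : cut N y = y) :
    ‖(truncLindblad G L N - truncLindblad G' L N) (ketBra y.incl y.incl)‖ ≤
      2 * (‖(G y - G' y).incl‖ * ‖y.incl‖) := by
  have e : (truncLindblad G L N - truncLindblad G' L N) (ketBra y.incl y.incl) =
      ketBra (cut N (G y - G' y)).incl y.incl + ketBra y.incl (cut N (G y - G' y)).incl := by
    rw [_root_.sub_apply, truncLindblad_ketBra h hy hy, truncLindblad_ketBra h' hy hy,
      map_sub (cut N), map_sub]
    simp only [← ketBraₛ_apply, map_sub, LinearMap.sub_apply]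
    abel
  rw [e]
  refine (norm_ketBra_add_le _ _).trans ?_
  gcongr
  exact norm_incl_cut_le N _

/-- The constant in the perturbation estimate. -/
noncomputable def perturbConst (b : ℕ) (P κ a ξ : ℝ) : ℝ :=
  16 * P * (1 + 2 * b) * (κ ^ ξ + (1 / a) ^ ξ)

/-- Perturbation of the truncated evolution by a drift of lower order near the sites in `B`. -/
theorem norm_expSG_truncLindblad_sub_le (h : IsConservative G L) (h' : IsConservative G' L)
    {B : Finset V} {w : V → V → ℝ} (hw : ∀ b j, 0 ≤ w b j) (hwb : ∀ b, w b b = 1) {m k : ℕ}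
    (hmk : m < k) {C μ Q κ P ε : ℝ} (hC : 0 ≤ C) (hμ : 0 < μ) (hQ : 0 < Q)
    (hwQ : ∀ b, ∑ j, w b j ≤ Q)
    (hrate : ∀ b x, momentRate G L (powerWeight (w b) k) x ≤
      weight (fun n => ∑ j, w b j * (C - μ * ((n j : ℝ) + 1) ^ (2 * k))) x)
    (hκ : 1 ≤ κ) (hCκ : Q * C ≤ μ / Q * κ ^ 2) (hP : 0 ≤ P) (hε : 0 ≤ ε)
    (hdiff : ∀ x : FiniteFock V, ‖(G x - G' x).incl‖ ≤
      ε * P * √(weight (fun n => ∑ b ∈ B, ((n b : ℝ) + 1) ^ m) x)) {N : ℕ} {x : FiniteFock V}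
    (hx : cut N x = x) {t : ℝ} (ht : 0 ≤ t) :
    ‖expSG (truncLindblad G L N) t (ketBra x.incl x.incl) -
      expSG (truncLindblad G' L N) t (ketBra x.incl x.incl)‖ ≤
      ε * perturbConst B.card P κ (μ / Q) ((m : ℝ) / k) *
        (t + t ^ (1 - (m : ℝ) / k) / (1 - (m : ℝ) / k)) * ‖x.incl‖ ^ 2 := by
  have hk : 0 < k := by omega
  have hk' : (0 : ℝ) < k := Nat.cast_pos.2 hk
  set ξ : ℝ := (m : ℝ) / k with hξ
  have hξ0 : 0 ≤ ξ := by positivity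
  have hξ1 : ξ < 1 := (div_lt_one hk').2 (by exact_mod_cast hmk)
  set a := μ / Q with ha
  have ha0 : 0 < a := by positivity
  set K := perturbConst B.card P κ a ξ with hK
  have hK0 : 0 ≤ K := by
    rw [hK, perturbConst]
    positivity
  have h1ξ : 0 < 1 - ξ := by linarith
  -- The Riccati bound requires a nonzero trace.
  by_cases hx0 : x.incl = 0
  · have : ketBra x.incl x.incl = 0 := by rw [← ketBraₛ_apply, hx0, map_zero]
    rw [this, map_zero, map_zero, sub_zero, norm_zero]
    positivity
  have hxn : 0 < ‖x.incl‖ := norm_pos_iff.2 hx0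
  set q := ‖x.incl‖ ^ 2 with hq
  have hq0 : 0 < q := by positivity
  -- the expectation of the perturbing weight
  have hexp : ∀ s, 0 < s → (boxExpectation N (fun n => ∑ b ∈ B, ((n b : ℝ) + 1) ^ m)
      (expSG (truncLindblad G L N) s (ketBra x.incl x.incl))).re ≤
        2 * B.card * (κ + 1 / (a * s)) ^ ξ * q := by
    intro s hs
    -- `A` is the bound on the moment of order k per unit trace. Interpolating at exactly this scale
    -- makes both terms of size A^ξ.
    set A := κ + 1 / (a * s) with hA
    have hA0 : 0 < A := by positivity
    have hone : ∀ b ∈ B, (boxExpectation N (fun n => ((n b : ℝ) + 1) ^ m)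
        (expSG (truncLindblad G L N) s (ketBra x.incl x.incl))).re ≤ A ^ ξ * (2 * q) := by
      intro b _
      refine (re_boxExpectation_mono h hx hs.le (Z := fun n => A ^ ξ + A ^ ξ * (1 / A) *
        powerWeight (w b) k n) fun n => ?_).trans ?_
      · refine (pow_le_rpow_mul_one_add hk hmk.le hA0 (by positivity)).trans ?_
        rw [mul_add, mul_one, ← mul_assoc]
        have h1 : ((n b : ℝ) + 1) ^ k ≤ powerWeight (w b) k n := by
          have := Finset.single_le_sum (f := fun j => w b j * ((n j : ℝ) + 1) ^ k)
            (fun j _ => mul_nonneg (hw b j) (by positivity)) (Finset.mem_univ b)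
          rwa [hwb, one_mul] at this
        have h2 : 0 ≤ A ^ ξ * (1 / A) := by positivity
        exact add_le_add le_rfl (mul_le_mul_of_nonneg_left h1 h2)
      · rw [re_boxExpectation_affine, re_boxExpectation_one h hx hs.le, ← hq]
        have h1 := boxExpectation_powerWeight_le h (hw b) hC hμ hQ (hwQ b) (hrate b)
          (by linarith) hCκ hx hxn hs
        rw [← ha, ← hA, ← hq] at h1
        have h2 : 0 ≤ A ^ ξ * (1 / A) := by positivity
        have h3 := mul_le_mul_of_nonneg_left h1 h2
        have h4 : A ^ ξ * (1 / A) * (q * A) = A ^ ξ * q := by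
          field_simp
        linarith
    have hlin : ∀ X, (boxExpectation N (fun n : V → ℕ => ∑ b ∈ B, ((n b : ℝ) + 1) ^ m) X).re =
        ∑ b ∈ B, (boxExpectation N (fun n => ((n b : ℝ) + 1) ^ m) X).re := by
      intro X
      simp only [boxExpectation, _root_.sum_apply, _root_.smul_apply, Complex.re_sum, smul_eq_mul,
        Complex.re_ofReal_mul, Finset.sum_mul]
      exact Finset.sum_comm
    rw [hlin]
    refine (Finset.sum_le_card_nsmul _ _ _ hone).trans (le_of_eq ?_)
    rw [nsmul_eq_mul]
    ring
  -- the derivative of the interpolation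
  set f : ℝ → TraceClass (FockSpace V) := fun s => expSG (truncLindblad G' L N) (t - s)
    (expSG (truncLindblad G L N) s (ketBra x.incl x.incl)) with hf
  have hfd := fun s => hasDerivAt_expSG_comp (truncLindblad G L N) (truncLindblad G' L N)
    (ketBra x.incl x.incl) t s
  have hbound : ∀ s, 0 < s → s < t → ‖expSG (truncLindblad G' L N) (t - s)
      ((truncLindblad G L N - truncLindblad G' L N)
        (expSG (truncLindblad G L N) s (ketBra x.incl x.incl)))‖ ≤ ε * K * q * (1 + s ^ (-ξ)) := by
    intro s hs hst
    refine (norm_expSG_truncLindblad_le h' N (t - s) (by linarith) _).trans ?_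
    obtain ⟨y, hy, hyX, hyn⟩ := exists_expSG_truncLindblad_eq_sum h hx hs.le
    have h1 := hexp s hs
    set A := κ + 1 / (a * s) with hA
    have hA1 : 1 ≤ A := by
      have : 0 ≤ 1 / (a * s) := by positivity
      linarith
    have hAξ : 1 ≤ A ^ ξ := Real.one_le_rpow hA1 hξ0
    rw [hyX, map_sum, Complex.re_sum] at h1
    simp only [boxExpectation_ketBra_self _ (hy _), Complex.ofReal_re] at h1
    -- Cauchy-Schwarz yields the root of A^ξ, replaced by A^ξ itself since A ≥ 1: the exponent -ξ is
    -- already integrable and is the one wanted in the result.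
    have h2 : ∑ n ∈ box V N, √(weight (fun n => ∑ b ∈ B, ((n b : ℝ) + 1) ^ m) (y n)) * ‖(y n).incl‖ ≤
        (1 + 2 * B.card) * A ^ ξ * q := by
      refine (sum_mul_norm_le_sqrt (a := 2 * B.card * A ^ ξ * q) (b := q) _ ?_ hyn.le).trans ?_
      · refine le_trans (Finset.sum_le_sum fun n _ => ?_) h1
        rw [Real.sq_sqrt]
        exact weight_nonneg (fun n => Finset.sum_nonneg fun b _ => by positivity) _
      · refine Real.sqrt_le_iff.2 ⟨by positivity, ?_⟩
        have h3 : (0 : ℝ) ≤ B.card := Nat.cast_nonneg _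
        have h4 : A ^ ξ ≤ (A ^ ξ) ^ 2 := by nlinarith
        have h5 : (2 * B.card : ℝ) ≤ (1 + 2 * B.card) ^ 2 := by nlinarith
        calc 2 * B.card * A ^ ξ * q * q = 2 * B.card * A ^ ξ * q ^ 2 := by ring
          _ ≤ (1 + 2 * B.card) ^ 2 * (A ^ ξ) ^ 2 * q ^ 2 := by gcongr
          _ = _ := by ring
    have h3 : ‖(truncLindblad G L N - truncLindblad G' L N)
        (expSG (truncLindblad G L N) s (ketBra x.incl x.incl))‖ ≤
          2 * (ε * P * ((1 + 2 * B.card) * A ^ ξ * q)) := by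
      rw [hyX, map_sum]
      refine (norm_sum_le_of_le _ fun n _ => norm_truncLindblad_sub_drift_le h h' (hy n)).trans ?_
      rw [← Finset.mul_sum]
      refine mul_le_mul_of_nonneg_left ?_ zero_le_two
      refine le_trans ?_ (mul_le_mul_of_nonneg_left h2 (by positivity))
      rw [Finset.mul_sum]
      refine Finset.sum_le_sum fun n _ => ?_
      rw [← mul_assoc]
      exact mul_le_mul_of_nonneg_right (hdiff _) (norm_nonneg _)
    have h4 : A ^ ξ ≤ (κ ^ ξ + (1 / a) ^ ξ) * (1 + s ^ (-ξ)) := by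
      have h5 : A ^ ξ ≤ κ ^ ξ + (1 / (a * s)) ^ ξ :=
        Real.rpow_add_le_add_rpow (by positivity) (by positivity) hξ0 hξ1.le
      have h6 : (1 / (a * s)) ^ ξ = (1 / a) ^ ξ * s ^ (-ξ) := by
        rw [one_div, mul_inv, Real.mul_rpow (by positivity) (by positivity), Real.inv_rpow hs.le,
          Real.rpow_neg hs.le, one_div]
      have h7 : 0 ≤ κ ^ ξ * s ^ (-ξ) := by positivity
      have h8 : 0 ≤ (1 / a) ^ ξ := by positivity
      rw [h6] at h5
      linarith
    refine (mul_le_mul_of_nonneg_left h3 (by norm_num)).trans ?_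
    calc 8 * (2 * (ε * P * ((1 + 2 * B.card) * A ^ ξ * q)))
        ≤ 8 * (2 * (ε * P * ((1 + 2 * B.card) * ((κ ^ ξ + (1 / a) ^ ξ) * (1 + s ^ (-ξ))) * q))) := by
          gcongr
      _ = ε * K * q * (1 + s ^ (-ξ)) := by
          rw [hK, perturbConst]
          ring
  -- integration
  set b : ℝ → ℝ := fun s => s + s ^ (1 - ξ) / (1 - ξ) with hb
  have hb0 : ∀ s, 0 ≤ s → 0 ≤ b s := fun s hs => by
    have : 0 ≤ s ^ (1 - ξ) := Real.rpow_nonneg hs _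
    positivity
  have hbd : ∀ s, 0 < s → HasDerivAt b (1 + s ^ (-ξ)) s := by
    intro s hs
    refine ((hasDerivAt_id s).add ((Real.hasDerivAt_rpow_const (p := 1 - ξ)
      (Or.inl hs.ne')).div_const (1 - ξ))).congr_deriv ?_
    rw [show 1 - ξ - 1 = -ξ by ring, mul_div_cancel_left₀ _ h1ξ.ne']
  -- The bound on the derivative is singular at 0, so the mean value inequality is used from s₀ > 0
  -- on; s₀ → 0 follows by continuity of the interpolation.
  have hstep : ∀ s₀, 0 < s₀ → s₀ ≤ t → ‖f t - f s₀‖ ≤ ε * K * q * b t := by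
    intro s₀ hs₀ hs₀t
    have h1 := image_norm_le_of_norm_deriv_right_le_deriv_boundary' (f := fun s => f s - f s₀)
      (a := s₀) (b := t) (B := fun s => ε * K * q * (b s - b s₀))
      (B' := fun s => ε * K * q * (1 + s ^ (-ξ)))
      (fun s _ => ((hfd s).sub_const _).continuousAt.continuousWithinAt)
      (fun s _ => ((hfd s).sub_const _).hasDerivWithinAt) (by simp)
      (fun s hs => (((hbd s (hs₀.trans_le hs.1)).sub_const _).const_mul _).continuousAt.continuousWithinAt)
      (fun s hs => (((hbd s (hs₀.trans_le hs.1)).sub_const _).const_mul _).hasDerivWithinAt)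
      (fun s hs => hbound s (hs₀.trans_le hs.1) hs.2) ⟨hs₀t, le_rfl⟩
    refine h1.trans (mul_le_mul_of_nonneg_left ?_ (by positivity))
    linarith [hb0 s₀ hs₀.le]
  have hfin : ‖f t - f 0‖ ≤ ε * K * q * b t := by
    rcases ht.eq_or_lt with rfl | ht'
    · rw [sub_self, norm_zero]
      exact mul_nonneg (by positivity) (hb0 0 le_rfl)
    · have h1 : Filter.Tendsto (fun s => ‖f t - f s‖) (𝓝[>] 0) (𝓝 ‖f t - f 0‖) :=
        (((hfd 0).continuousAt.tendsto.mono_left nhdsWithin_le_nhds).const_sub (f t)).norm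
      refine le_of_tendsto h1 ?_
      filter_upwards [self_mem_nhdsWithin, nhdsWithin_le_nhds (gt_mem_nhds ht')] with s hs1 hs2
      exact hstep s hs1 hs2.le
  have hft : f t = expSG (truncLindblad G L N) t (ketBra x.incl x.incl) := by
    simp [hf, expSG_zero]
  have hf0 : f 0 = expSG (truncLindblad G' L N) t (ketBra x.incl x.incl) := by
    simp [hf, expSG_zero]
  rw [← hft, ← hf0]
  refine hfin.trans (le_of_eq ?_)
  simp only [hb]
  ring

end Perturbation


/-! ### Exponential weights on the lattice -/

section LatticeWeights

variable {D : ℕ} {V : Finset (Fin D → ℤ)}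

/-- The weight `2 ^ (-|j - b|₁)`. -/
noncomputable def latticeWeight (b j : V) : ℝ := (1 / 2) ^ ∑ s, (j.1 s - b.1 s).natAbs

theorem latticeWeight_nonneg (b j : V) : 0 ≤ latticeWeight b j := by
  unfold latticeWeight
  positivity

theorem latticeWeight_self (b : V) : latticeWeight b b = 1 := by simp [latticeWeight]

theorem latticeWeight_le_of_edge (b : V) {i j : V} (hij : LatticeEdge i.1 j.1) :
    latticeWeight b i ≤ 2 * latticeWeight b j := by
  have h1 : ∑ s, (j.1 s - b.1 s).natAbs ≤ ∑ s, (i.1 s - b.1 s).natAbs + 1 := by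
    have h2 : ∑ s, (i.1 s - j.1 s).natAbs ≤ 1 := by
      have := hij.sum_abs_sub_le
      zify
      exact this
    refine le_trans ?_ (Nat.add_le_add_left h2 _)
    rw [← Finset.sum_add_distrib]
    exact Finset.sum_le_sum fun s _ => by omega
  have h3 : (1 / 2 : ℝ) ^ (∑ s, (i.1 s - b.1 s).natAbs + 1) ≤ latticeWeight b j :=
    pow_le_pow_of_le_one (by norm_num) (by norm_num) h1
  rw [pow_succ] at h3
  unfold latticeWeight at h3 ⊢
  linarith

theorem hasSum_half_pow_natAbs : HasSum (fun z : ℤ => (1 / 2 : ℝ) ^ z.natAbs) 3 := by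
  have h1 : HasSum (fun n : ℕ => (1 / 2 : ℝ) ^ (n : ℤ).natAbs) 2 := by
    simpa only [Int.natAbs_natCast] using hasSum_geometric_two
  have h2 : HasSum (fun n : ℕ => (1 / 2 : ℝ) ^ (-((n : ℤ) + 1)).natAbs) (1 / 2 * 2) := by
    have h3 : (fun n : ℕ => (1 / 2 : ℝ) ^ (-((n : ℤ) + 1)).natAbs) =
        fun n => 1 / 2 * (1 / 2 : ℝ) ^ n := by
      funext n
      rw [show (-((n : ℤ) + 1)).natAbs = n + 1 by omega, pow_succ']
    rw [h3]
    exact hasSum_geometric_two.mul_left (1 / 2)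
  have h4 := HasSum.of_nat_of_neg_add_one (f := fun z : ℤ => (1 / 2 : ℝ) ^ z.natAbs) h1 h2
  rwa [show (2 : ℝ) + 1 / 2 * 2 = 3 by norm_num] at h4

/-- The weight is a product over coordinates. Enlarging V to the product of its projections
factorizes the sum, and each factor is at most the two-sided geometric series, whose value is 3. -/
theorem sum_latticeWeight_le (b : V) : ∑ j, latticeWeight b j ≤ 3 ^ D := by
  have h1 : ∀ (T : Finset ℤ) (a : ℤ), ∑ z ∈ T, (1 / 2 : ℝ) ^ (z - a).natAbs ≤ 3 := fun T a =>
    sum_le_hasSum (f := fun z : ℤ => (1 / 2 : ℝ) ^ (z - a).natAbs) T (fun _ _ => by positivity)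
      ((Equiv.subRight a).hasSum_iff (f := fun z : ℤ => (1 / 2 : ℝ) ^ z.natAbs) |>.2
        hasSum_half_pow_natAbs)
  have h2 : ∑ j : V, latticeWeight b j = ∑ j ∈ V, ∏ s, (1 / 2 : ℝ) ^ (j s - b.1 s).natAbs := by
    rw [← Finset.sum_coe_sort V]
    exact Finset.sum_congr rfl fun j _ => (Finset.prod_pow_eq_pow_sum _ _ _).symm
  rw [h2]
  have h3 : V ⊆ Fintype.piFinset fun s => V.image fun j => j s := fun j hj =>
    Fintype.mem_piFinset.2 fun s => Finset.mem_image_of_mem _ hj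
  refine (Finset.sum_le_sum_of_subset_of_nonneg h3 fun j _ _ =>
    Finset.prod_nonneg fun s _ => by positivity).trans ?_
  rw [← Finset.prod_univ_sum (fun s => V.image fun j => j s)
    fun s z => (1 / 2 : ℝ) ^ (z - b.1 s).natAbs]
  refine (Finset.prod_le_prod (fun s _ => Finset.sum_nonneg fun z _ => by positivity)
    fun s _ => h1 _ (b.1 s)).trans (le_of_eq ?_)
  simp

end LatticeWeights

/-! ### Comparison of evolutions on all states -/

section Comparison

variable {V : Type*} [DecidableEq V] [Fintype V]

/-- A box compression of X is a finite sum of pure states whose squared norms add up exactly to its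
trace norm, so the bound for pure states passes to it without loss; then N → ∞. -/
theorem norm_apply_le_of_isPositive {F : TraceClass (FockSpace V) →L[ℂ] TraceClass (FockSpace V)}
    {c : ℝ} (hF : ∀ x : FiniteFock V, ‖F (ketBra x.incl x.incl)‖ ≤ c * ‖x.incl‖ ^ 2)
    {X : TraceClass (FockSpace V)} (hX : X.toOp.IsPositive) : ‖F X‖ ≤ c * ‖X‖ := by
  have h1 := tendsto_cutTrace hX
  refine le_of_tendsto_of_tendsto' ((F.continuous.tendsto X).comp h1).norm (h1.norm.const_mul c)
    fun N => ?_
  have hpos := cutTrace_isPositive N hX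
  obtain ⟨y, -, hy⟩ := TraceClass.exists_eq_sum_ketBra hpos (N := N)
    fun n hn => inner_ket_cutTrace hn X _
  have h2 : ‖cutTrace N X‖ = ∑ n ∈ box V N, ‖(y n).incl‖ ^ 2 := by
    have h3 := TraceClass.fockTrace_eq_of_isPositive hpos
    rw [← traceAgainst_id] at h3
    have h4 : traceAgainst (ContinuousLinearMap.id ℂ (FockSpace V)) (cutTrace N X) =
        ((∑ n ∈ box V N, ‖(y n).incl‖ ^ 2 : ℝ) : ℂ) := by
      rw [hy, map_sum]
      push_cast
      refine Finset.sum_congr rfl fun n _ => ?_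
      rw [traceAgainst_id, fockTrace_ketBra, inner_self_eq_norm_sq_to_K]
      rfl
    rw [h4] at h3
    exact_mod_cast h3.symm
  rw [Function.comp_apply, h2, Finset.mul_sum, hy, map_sum]
  exact norm_sum_le_of_le _ fun n _ => hF (y n)

theorem hamRate_add (h h' : Module.End ℂ (FiniteFock V)) (W : (V → ℕ) → ℝ) (x : FiniteFock V) :
    hamRate (h + h') W x = hamRate h W x + hamRate h' W x := by
  simp only [hamRate, smul_add, LinearMap.add_apply, map_add, inner_add_right, Complex.add_re,
    mul_add]

theorem hamRate_smul (r : ℝ) (h : Module.End ℂ (FiniteFock V)) (W : (V → ℕ) → ℝ)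
    (x : FiniteFock V) : hamRate ((r : ℂ) • h) W x = r * hamRate h W x := by
  rw [hamRate, hamRate, smul_comm, LinearMap.smul_apply, _root_.map_smul, inner_smul_right,
    Complex.re_ofReal_mul]
  ring

theorem IsAdjoint.add_ofReal_smul {h h' : Module.End ℂ (FiniteFock V)} (hh : IsAdjoint h h)
    (hh' : IsAdjoint h' h') (r : ℝ) : IsAdjoint (h + (r : ℂ) • h') (h + (r : ℂ) • h') := by
  have := hh.add (hh'.smul (r : ℂ))
  rwa [Complex.conj_ofReal] at this

theorem photonDrift_sub (ℓ : ℕ) (α : V → ℂ) (h h' : Module.End ℂ (FiniteFock V)) (r : ℝ)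
    (x : FiniteFock V) :
    photonDrift ℓ α h x - photonDrift ℓ α (h + (r : ℂ) • h') x = (Complex.I * r) • h' x := by
  simp only [photonDrift, LinearMap.sub_apply, LinearMap.smul_apply, LinearMap.add_apply]
  module

end Comparison

/-! ### Generation and uniform perturbation bounds for lattice systems -/

section LatticePerturbation

variable {D : ℕ} {V : Finset (Fin D → ℤ)}

/-- Generation theorem for photon dissipation with two-body Hamiltonians. -/
theorem exists_isQMS_latticeHamiltonian {ℓ d dB : ℕ} (hℓ : 2 ≤ ℓ) (hd : d ≤ 2 * (ℓ - 2))
    (hdB : dB ≤ 2 * (ℓ - 2)) (α : V → ℂ) {Λ ΛB ε : ℝ} (hΛ : 0 ≤ Λ) (hΛB : 0 ≤ ΛB) (hε : 0 ≤ ε)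
    {lam lamB : V → V → (Fin 4 → ℕ) → ℂ} (hlam : ∀ i j u, ‖lam i j u‖ ≤ Λ)
    (hlamB : ∀ i j u, ‖lamB i j u‖ ≤ ΛB) (A B : Finset V) :
    ∃ T : ℝ → TraceClass (FockSpace V) →L[ℂ] TraceClass (FockSpace V), IsQMS T ∧
      ClosureGenerates (photonDissipation ℓ α
        (latticeHamiltonian A d lam + (ε : ℂ) • latticeHamiltonian B dB lamB)) T ∧
      ∀ t, 0 ≤ t → ∀ X, Filter.Tendsto (fun N => expSG (truncLindblad (photonDrift ℓ α
        (latticeHamiltonian A d lam + (ε : ℂ) • latticeHamiltonian B dB lamB))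
        (photonJump ℓ α) N) t X) Filter.atTop (𝓝 (T t X)) := by
  have h1 : ∀ x, hamRate (latticeHamiltonian A d lam) (powerWeight (fun _ => 1) (2 * ℓ)) x ≤
      hamConst D d (ℓ - 1) (2 * ℓ) Λ 1 *
        weight (powerWeight (fun _ => 1) (2 * ℓ - 1 + (ℓ - 1))) x :=
    hamRate_latticeHamiltonian_le A (by omega) hΛ zero_le_one hlam (fun _ => zero_le_one)
      (fun _ _ _ => (mul_one _).ge) (2 * ℓ)
  have h2 : ∀ x, hamRate (latticeHamiltonian B dB lamB) (powerWeight (fun _ => 1) (2 * ℓ)) x ≤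
      hamConst D dB (ℓ - 1) (2 * ℓ) ΛB 1 *
        weight (powerWeight (fun _ => 1) (2 * ℓ - 1 + (ℓ - 1))) x :=
    hamRate_latticeHamiltonian_le B (by omega) hΛB zero_le_one hlamB (fun _ => zero_le_one)
      (fun _ _ _ => (mul_one _).ge) (2 * ℓ)
  have hH := hamConst_nonneg D d (ℓ - 1) (2 * ℓ) hΛ zero_le_one
  have hHB := hamConst_nonneg D dB (ℓ - 1) (2 * ℓ) hΛB zero_le_one
  refine exists_isQMS_photonDissipation hℓ α ((isAdjoint_latticeHamiltonian A d lam).add_ofReal_smul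
    (isAdjoint_latticeHamiltonian B dB lamB) ε)
    (H := hamConst D d (ℓ - 1) (2 * ℓ) Λ 1 + ε * hamConst D dB (ℓ - 1) (2 * ℓ) ΛB 1)
    (by positivity) (fun x => ?_) ((hasLeakBound_latticeHamiltonian A (by omega) lam).add
      ((hasLeakBound_latticeHamiltonian B (by omega) lamB).smul _))
  rw [hamRate_add, hamRate_smul, add_mul, mul_assoc]
  exact add_le_add (h1 x) (mul_le_mul_of_nonneg_left (h2 x) hε)

/-- Local perturbations change the evolution of positive operators by a small amount, uniformly in
the number of modes. -/
theorem exists_norm_sub_le (D ℓ d dB b : ℕ) {R Λ ΛB : ℝ} (hℓ : 2 ≤ ℓ) (hd : d ≤ 2 * (ℓ - 2))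
    (hdB : dB < ℓ - 1) (hR : 0 ≤ R) (hΛ : 0 ≤ Λ) (hΛB : 0 ≤ ΛB) :
    ∃ K : ℝ, 0 ≤ K ∧ ∀ (V : Finset (Fin D → ℤ)) (α : V → ℂ) (lam lamB : V → V → (Fin 4 → ℕ) → ℂ)
      (B : Finset V) (ε : ℝ), (∀ j, ‖α j‖ ≤ R) → (∀ i j u, ‖lam i j u‖ ≤ Λ) →
      (∀ i j u, ‖lamB i j u‖ ≤ ΛB) → B.card = b → 0 ≤ ε →
      ∀ T S : ℝ → TraceClass (FockSpace V) →L[ℂ] TraceClass (FockSpace V),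
      (∀ t, 0 ≤ t → ∀ X, Filter.Tendsto (fun N => expSG (truncLindblad (photonDrift ℓ α
        (latticeHamiltonian Finset.univ d lam)) (photonJump ℓ α) N) t X) Filter.atTop
        (𝓝 (T t X))) →
      (∀ t, 0 ≤ t → ∀ X, Filter.Tendsto (fun N => expSG (truncLindblad (photonDrift ℓ α
        (latticeHamiltonian Finset.univ d lam + (ε : ℂ) • latticeHamiltonian B dB lamB))
        (photonJump ℓ α) N) t X) Filter.atTop (𝓝 (S t X))) →
      ∀ X : TraceClass (FockSpace V), X.toOp.IsPositive → ∀ t, 0 ≤ t → ‖T t X - S t X‖ ≤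
        ε * K * (t + t ^ (1 - (dB : ℝ) / ((ℓ - 1 : ℕ) : ℝ)) / (1 - (dB : ℝ) / ((ℓ - 1 : ℕ) : ℝ))) *
          ‖X‖ := by
  -- The moment order is ℓ - 1, so that the loss order k + ℓ - 1 equals 2k as the Riccati argument
  -- needs; the 2 compares weights of neighbouring sites.
  set H := hamConst D d (ℓ - 1) (ℓ - 1) Λ 2
  have hH : 0 ≤ H := hamConst_nonneg D d (ℓ - 1) (ℓ - 1) hΛ zero_le_two
  set C := momentConst ℓ (ℓ - 1) R H
  have hC : 0 ≤ C := momentConst_nonneg ℓ (ℓ - 1) hR hH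
  set μ : ℝ := (1 / 2) ^ (ℓ + 1)
  have hμ : 0 < μ := by positivity
  set Q : ℝ := 3 ^ D
  have hQ : 0 < Q := by positivity
  -- Since κ ≥ 1, already κ ≤ κ² gives the required inequality without a square root.
  set κ : ℝ := 1 + Q * C / (μ / Q) with hκ
  have hκ1 : 1 ≤ κ := by
    rw [hκ]
    exact le_add_of_nonneg_right (by positivity)
  have hCκ : Q * C ≤ μ / Q * κ ^ 2 := by
    have h1 : Q * C / (μ / Q) ≤ κ ^ 2 := by nlinarith
    rwa [div_le_iff₀' (by positivity)] at h1
  set P : ℝ := b * (b * ((degreeLE dB).card * (2 * ΛB * √((dB + 1) ^ dB))))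
  have hP : 0 ≤ P := by positivity
  refine ⟨perturbConst b P κ (μ / Q) ((dB : ℝ) / ((ℓ - 1 : ℕ) : ℝ)), ?_, ?_⟩
  · rw [perturbConst]
    positivity
  intro V α lam lamB B ε hα hlam hlamB hB hε T S hT hS X hX t ht
  have hadj := isAdjoint_latticeHamiltonian Finset.univ d lam
  have hadj' := hadj.add_ofReal_smul (isAdjoint_latticeHamiltonian B dB lamB) ε
  rw [← _root_.sub_apply]
  refine norm_apply_le_of_isPositive (fun x => ?_) hX
  rw [_root_.sub_apply]
  obtain ⟨N₀, hN₀⟩ := exists_cut_eq_self x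
  refine le_of_tendsto ((hT t ht _).sub (hS t ht _)).norm ?_
  filter_upwards [Filter.eventually_ge_atTop N₀] with N hN
  rw [← hB]
  refine norm_expSG_truncLindblad_sub_le (isConservative_photonDrift ℓ α hadj)
    (isConservative_photonDrift ℓ α hadj') (w := latticeWeight) latticeWeight_nonneg
    latticeWeight_self hdB hC hμ hQ sum_latticeWeight_le (fun b x => ?_) hκ1 hCκ hP hε (fun x => ?_)
    (cut_eq_self_mono hN hN₀) ht
  · have h1 := momentRate_photonDrift_le hℓ (k := ℓ - 1) (by omega) hR hH hα (latticeWeight_nonneg b)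
      (fun x => hamRate_latticeHamiltonian_le Finset.univ (q := ℓ - 1) (by omega) hΛ zero_le_two hlam
        (latticeWeight_nonneg b) (fun i j hij => latticeWeight_le_of_edge b hij) (ℓ - 1) x) x
    rwa [show ℓ - 1 + ℓ - 1 = 2 * (ℓ - 1) by omega] at h1
  · rw [photonDrift_sub, _root_.map_smul, norm_smul, norm_mul, Complex.norm_I, one_mul,
      Complex.norm_real, Real.norm_eq_abs, abs_of_nonneg hε, mul_assoc]
    refine mul_le_mul_of_nonneg_left ((norm_latticeHamiltonian_le B dB hΛB hlamB x).trans
      (le_of_eq ?_)) hε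
    rw [hB]
    ring

end LatticePerturbation

/-! ### The stability theorem -/

theorem mainTheorem12 (D ℓ d dB b : ℕ) (R Λ ΛB : ℝ)
    (hℓ : 2 ≤ ℓ) (hd : d ≤ 2 * (ℓ - 2)) (hdB : dB ≤ 2 * (ℓ - 2)) (hδ : 2 * dB * b < ℓ - 1) :
    ∃ c₁ μ c : ℝ, 0 < c₁ ∧ 0 < μ ∧ 0 < c ∧
      ∀ (V : Finset (Fin D → ℤ)) (α : V → ℂ) (lam lamB : V → V → (Fin 4 → ℕ) → ℂ)
        (B : Finset V) (ε : ℝ),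
        (∀ j, ‖α j‖ ≤ R) → (∀ i j u, ‖lam i j u‖ ≤ Λ) → (∀ i j u, ‖lamB i j u‖ ≤ ΛB) →
        B.card = b → 0 ≤ ε →
        ∃ T S : ℝ → TraceClass (FockSpace V) →L[ℂ] TraceClass (FockSpace V),
          IsQMS T ∧
          ClosureGenerates (photonDissipation ℓ α (latticeHamiltonian Finset.univ d lam)) T ∧
          IsQMS S ∧
          ClosureGenerates (photonDissipation ℓ α
            (latticeHamiltonian Finset.univ d lam + (ε : ℂ) • latticeHamiltonian B dB lamB)) S ∧
          ∀ (A : Finset V) (O : FockSpace V →L[ℂ] FockSpace V), ActsOn A O →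
            ∀ ρ : TraceClass (FockSpace V), IsState ρ → ∀ t : ℝ, 0 ≤ t →
              ‖fockTrace (O.comp (T t ρ).toOp) - fockTrace (O.comp (S t ρ).toOp)‖ ≤
                ε * ‖O‖ *
                  (c₁ * t ^ (1 - (dB : ℝ) / ((ℓ : ℝ) - 1)) *
                      ((dB : ℝ) / (((ℓ : ℝ) - 1) * μ)) ^ ((dB : ℝ) / ((ℓ : ℝ) - 1)) +
                    c₁ * t * (c / μ) ^ ((dB : ℝ) / ((dB : ℝ) + (ℓ : ℝ) - 1))) := by
  have hℓ1 : (0 : ℝ) < (ℓ : ℝ) - 1 := by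
    have : (2 : ℝ) ≤ ℓ := by exact_mod_cast hℓ
    linarith
  set ξ : ℝ := (dB : ℝ) / ((ℓ : ℝ) - 1) with hξ
  have hξ0 : 0 ≤ ξ := by positivity
  -- The bounds are not assumed nonnegative; absolute values are used instead.
  have hΛ' : ∀ {Λ : ℝ} {V : Finset (Fin D → ℤ)} {lam : V → V → (Fin 4 → ℕ) → ℂ},
      (∀ i j u, ‖lam i j u‖ ≤ Λ) → ∀ i j u, ‖lam i j u‖ ≤ |Λ| := fun h i j u =>
    (h i j u).trans (le_abs_self _)
  rcases Nat.eq_zero_or_pos b with rfl | hb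
  -- Without sites in B the perturbation is zero and one semigroup serves for both; the assumption
  -- on the degrees would not give dB < ℓ - 1 here.
  · refine ⟨1, 1, 1, one_pos, one_pos, one_pos, ?_⟩
    intro V α lam lamB B ε hα hlam hlamB hB hε
    obtain ⟨S, hS, hgen, -⟩ := exists_isQMS_latticeHamiltonian hℓ hd hdB α (abs_nonneg Λ)
      (abs_nonneg ΛB) hε (hΛ' hlam) (hΛ' hlamB) Finset.univ B
    have hB0 : latticeHamiltonian B dB lamB = 0 := by
      rw [Finset.card_eq_zero.1 hB, latticeHamiltonian, Finset.sum_empty]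
    have hgen' := hgen
    rw [hB0, smul_zero, add_zero] at hgen'
    refine ⟨S, S, hS, hgen', hS, hgen, fun A O _ ρ _ t ht => ?_⟩
    rw [sub_self, norm_zero]
    have := Real.rpow_nonneg ht (1 - ξ)
    positivity
  · have hdB' : dB < ℓ - 1 := by
      have : dB * 1 ≤ dB * b := Nat.mul_le_mul_left _ hb
      rw [mul_assoc] at hδ
      omega
    have hcast : ((ℓ - 1 : ℕ) : ℝ) = (ℓ : ℝ) - 1 := by
      rw [Nat.cast_sub (by omega), Nat.cast_one]
    have hξ1 : 0 < 1 - ξ := by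
      rw [sub_pos, hξ, div_lt_one hℓ1, ← hcast]
      exact_mod_cast hdB'
    -- For dB = 0 this relies on 0^0 = 1.
    have hξξ : 0 < ξ ^ ξ := by
      rcases hξ0.eq_or_lt with h | h
      · rw [← h, Real.rpow_zero]
        exact one_pos
      · exact Real.rpow_pos_of_pos h _
    obtain ⟨K, hK, hmain⟩ := exists_norm_sub_le D ℓ d dB b hℓ hd hdB' (abs_nonneg R) (abs_nonneg Λ)
      (abs_nonneg ΛB)
    -- With μ = c = 1 the factors in the statement are ξ^ξ and 1. The first summand cancels ξ^ξ and
    -- supplies 1/(1 - ξ), the second serves the linear term, and the last ensures positivity; the 2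
    -- is the bound on the trace pairing.
    refine ⟨2 * K / ((1 - ξ) * ξ ^ ξ) + 2 * K + 1, 1, 1, by positivity, one_pos, one_pos, ?_⟩
    intro V α lam lamB B ε hα hlam hlamB hB hε
    -- The unperturbed semigroup is the case ε = 0.
    obtain ⟨T, hT, hTgen, hTlim⟩ := exists_isQMS_latticeHamiltonian hℓ hd hdB α (abs_nonneg Λ)
      (abs_nonneg ΛB) le_rfl (hΛ' hlam) (hΛ' hlamB) Finset.univ B
    obtain ⟨S, hS, hSgen, hSlim⟩ := exists_isQMS_latticeHamiltonian hℓ hd hdB α (abs_nonneg Λ)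
      (abs_nonneg ΛB) hε (hΛ' hlam) (hΛ' hlamB) Finset.univ B
    rw [Complex.ofReal_zero, zero_smul, add_zero] at hTgen hTlim
    refine ⟨T, S, hT, hTgen, hS, hSgen, fun A O _ ρ hρ t ht => ?_⟩
    have h1 := hmain V α lam lamB B ε (fun j => (hα j).trans (le_abs_self R)) (hΛ' hlam) (hΛ' hlamB)
      hB hε T S hTlim hSlim ρ hρ.1 t ht
    have hρ1 : ‖ρ‖ = 1 := by
      have h2 := TraceClass.fockTrace_eq_of_isPositive hρ.1
      rw [hρ.2] at h2
      exact_mod_cast h2.symm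
    rw [hcast, ← hξ, hρ1, mul_one] at h1
    rw [← traceAgainst_apply, ← traceAgainst_apply, ← map_sub, mul_one, ← hξ, div_one,
      Real.one_rpow, mul_one]
    have htξ := Real.rpow_nonneg ht (1 - ξ)
    refine (norm_traceAgainst_le O _).trans
      ((mul_le_mul_of_nonneg_left h1 (by positivity)).trans ?_)
    have h3 : 2 * K / ((1 - ξ) * ξ ^ ξ) * t ^ (1 - ξ) * ξ ^ ξ = 2 * K * (t ^ (1 - ξ) / (1 - ξ)) := by
      field_simp
    have h4 : 0 ≤ (2 * K + 1) * t ^ (1 - ξ) * ξ ^ ξ := by positivity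
    have h5 : 0 ≤ (2 * K / ((1 - ξ) * ξ ^ ξ) + 1) * t := by positivity
    have h6 : 2 * K * (t + t ^ (1 - ξ) / (1 - ξ)) ≤
        (2 * K / ((1 - ξ) * ξ ^ ξ) + 2 * K + 1) * t ^ (1 - ξ) * ξ ^ ξ +
          (2 * K / ((1 - ξ) * ξ ^ ξ) + 2 * K + 1) * t := by
      linarith
    calc 2 * ‖O‖ * (ε * K * (t + t ^ (1 - ξ) / (1 - ξ)))
        = ε * ‖O‖ * (2 * K * (t + t ^ (1 - ξ) / (1 - ξ))) := by ring
      _ ≤ _ := mul_le_mul_of_nonneg_left h6 (by positivity)
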